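/- Let $d\in\{2,3\}$, let $\Omega\subset\mathbb R^d$ be a convex bounded polygonal (polyhedral) domain, and let $m\ge 1$, $N\in\mathbb N$ and $\sigma>0$. Then there is a constant $C>0$, depending only on $\Omega$, $d$, $m$, $N$ and $\sigma$, with the following property. Let $\mathcal T_h$ be a partition of $\Omega$ into polygonal (polyhedral) elements with connected interiors, with set $\mathcal E_h^i$ of interior faces and set $\mathcal E_h^b$ of boundary faces. Let $\widetilde{\mathcal T}_h$ be a compatible sub-decomposition, that is, a conforming triangulation of $\overline\Omega$ into triangles (tetrahedra) such that every element of $\mathcal T_h$ is a union of simplices of $\widetilde{\mathcal T}_h$ and every face in $\mathcal E_h^i\cup\mathcal E_h^b$ is a union of $(d-1)$-dimensional faces of $\widetilde{\mathcal T}_h$. Assume that every $K\in\mathcal T_h$ consists of at most $N$ simplices of $\widetilde{\mathcal T}_h$, and that $h_{\widetilde K}\le\sigma\rho_{\widetilde K}$ for every $\widetilde K\in\widetilde{\mathcal T}_h$, where $h_{\widetilde K}$ is the diameter of $\widetilde K$ and $\rho_{\widetilde K}$ the radius of the largest ball contained in it. Let $V_h^m$ (resp. $\widetilde V_h^m$)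 be the space of functions in $L^2(\Omega)$ whose restriction to each element of $\mathcal T_h$ (resp. $\widetilde{\mathcal T}_h$) is a polynomial of degree at most $m$. Then for every $\mathbf V_h\in (V_h^m)^{d\times d}$ there is a $\widetilde{\mathbf V}_h\in(\widetilde V_h^m)^{d\times d}\cap H^1(\Omega)^{d\times d}$ whose tangential trace $\mathbf n\times\widetilde{\mathbf V}_h$ vanishes on $\partial\Omega$ and which satisfies, for both $\alpha=0$ and $\alpha=1$, $$\sum_{K\in\mathcal T_h}\|\nabla^\alpha(\mathbf V_h-\widetilde{\mathbf V}_h)\|_{L^2(K)}^2\le C\Big(\sum_{e\in\mathcal E_h^i}h_e^{1-2\alpha}\|[\![\mathbf n\otimes\mathbf V_h]\!]\|_{L^2(e)}^2+\sum_{e\in\mathcal E_h^b}h_e^{1-2\alpha}\|\mathbf n\times\mathbf V_h\|_{L^2(e)}^2\Big).$$ Here $h_e$ is the diameter of $e$. On an interior face $e$ shared by $K^+$ and $K^-$, $[\![\mathbf n\otimes\mathbf V_h]\!]=\mathbf n^+\otimes\mathbf V_h^++\mathbf n^-\otimes\mathbf V_h^-$, where $\mathbf n^\pm$ is the unit outward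 normal of $K^\pm$ on $e$ and $\mathbf V_h^\pm$ is the trace on $e$ from $K^\pm$; on a boundary face $\mathbf n$ is the unit outward normal. The operations $\mathbf n\otimes\cdot$ and $\mathbf n\times\cdot$ act on each column of a tensor; for $d=2$, $\mathbf n\times\mathbf q=n_1q_2-n_2q_1$. -/

import Mathlib

open MeasureTheory Set

noncomputable section

namespace PolyFEM

/-- Euclidean space `ℝ^d`. -/
abbrev E (d : ℕ) := EuclideanSpace ℝ (Fin d)

variable {d : ℕ}

/-! ### Domains, triangulations, polytopal meshes -/

/-- A convex bounded polygonal (polyhedral) domain: a nonempty open set that is the interior of the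
convex hull of finitely many points. -/
def IsConvexPolytopeDomain (Ω : Set (E d)) : Prop :=
  Ω.Nonempty ∧ ∃ F : Finset (E d), Ω = interior (convexHull ℝ (F : Set (E d)))

/-- The closed simplex with vertex set `s`. -/
def hull (s : Finset (E d)) : Set (E d) := convexHull ℝ (s : Set (E d))

/-- Radius of the largest closed ball contained in `S`. -/
def inradius (S : Set (E d)) : ℝ :=
  sSup {r : ℝ | 0 ≤ r ∧ ∃ c : E d, Metric.closedBall c r ⊆ S}

/-- A conforming triangulation of `closure Ω` by finitely many nondegenerate `d`-simplices, each
given by its set of vertices. Two simplices meet exactly in the common face spanned by their common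
vertices. -/
structure Triangulation (Ω : Set (E d)) where
  cells : Finset (Finset (E d))
  card_cell : ∀ s ∈ cells, s.card = d + 1
  affineIndependent : ∀ s ∈ cells, AffineIndependent ℝ ((↑) : s → E d)
  conforming : ∀ s ∈ cells, ∀ t ∈ cells,
    hull s ∩ hull t ⊆ convexHull ℝ ((s : Set (E d)) ∩ (t : Set (E d)))
  cover : ⋃ s ∈ cells, hull s = closure Ω

/-- `f` is (the vertex set of) a `(d-1)`-dimensional face of the simplex with vertex set `s`. -/
def IsFacetOf (f s : Finset (E d)) : Prop := f ⊆ s ∧ f.card = d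

/-- The vertex sets of all `(d-1)`-dimensional faces of the triangulation. -/
def Triangulation.facets {Ω : Set (E d)} (T : Triangulation Ω) : Set (Finset (E d)) :=
  {f | ∃ s ∈ T.cells, IsFacetOf f s}

open Classical in
/-- The simplices of the triangulation that are contained in `K`. -/
def Triangulation.subcells {Ω : Set (E d)} (T : Triangulation Ω) (K : Set (E d)) :
    Finset (Finset (E d)) :=
  T.cells.filter fun s => hull s ⊆ K

/-- `n` is a unit vector such that `A` lies in the half-space `⟪n, · - x⟫ ≤ 0` for every `x ∈ e`.
If `e` is a `(d-1)`-dimensional piece of the boundary of the convex body `A`, this says that `n` is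
the unit outward normal of `A` on `e`. -/
def IsOuterNormal (A e : Set (E d)) (n : E d) : Prop :=
  ‖n‖ = 1 ∧ ∀ x ∈ e, ∀ y ∈ A, inner ℝ n (y - x) ≤ 0

/-- `n` is the unit outward normal on the flat face `e` of the (possibly nonconvex) element `K`:
`e` is orthogonal to `n`, and each simplex of `K` one of whose facets lies in `e` has `n` as its
outer normal there. -/
def Triangulation.IsElementNormal {Ω : Set (E d)} (T : Triangulation Ω) (K e : Set (E d))
    (n : E d) : Prop :=
  ‖n‖ = 1 ∧ (∀ x ∈ e, ∀ y ∈ e, inner ℝ n (y - x) = 0) ∧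
    ∀ s ∈ T.subcells K, ∀ f, IsFacetOf f s → hull f ⊆ e → IsOuterNormal (hull s) (hull f) n

/-- A partition of `Ω` into polygonal (polyhedral) elements, with its interior and boundary faces
and a compatible sub-decomposition into simplices. -/
structure PolyMesh (Ω : Set (E d)) where
  /-- the compatible sub-decomposition into simplices -/
  sub : Triangulation Ω
  /-- the (closed) elements -/
  elements : Finset (Set (E d))
  /-- the interior faces -/
  intFaces : Finset (Set (E d))
  /-- the boundary faces -/
  bdFaces : Finset (Set (E d))
  /-- each element is a union of simplices of the sub-decomposition -/
  element_eq : ∀ K ∈ elements, K = ⋃ s ∈ sub.subcells K, hull s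
  /-- the interior of an element is nonempty and connected -/
  element_connected : ∀ K ∈ elements, IsConnected (interior K)
  /-- different elements do not overlap -/
  element_disjoint : ∀ K ∈ elements, ∀ L ∈ elements, K ≠ L → Disjoint (interior K) (interior L)
  /-- the elements cover the domain -/
  element_cover : ⋃ K ∈ elements, K = closure Ω
  /-- faces are nonempty unions of `(d-1)`-dimensional faces of the sub-decomposition -/
  face_nonempty : ∀ e, e ∈ intFaces ∨ e ∈ bdFaces → e.Nonempty
  face_eq : ∀ e, e ∈ intFaces ∨ e ∈ bdFaces → e = ⋃ f ∈ {f ∈ sub.facets | hull f ⊆ e}, hull f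
  /-- an interior face is a flat face shared by two elements lying on its two sides -/
  intFace : ∀ e ∈ intFaces, ∃ K ∈ elements, ∃ L ∈ elements, K ≠ L ∧ e ⊆ K ∩ L ∧
    ∃ n : E d, sub.IsElementNormal K e n ∧ sub.IsElementNormal L e (-n)
  /-- a boundary face is a flat face of an element, on the boundary of the domain -/
  bdFace : ∀ e ∈ bdFaces, e ⊆ frontier Ω ∧ ∃ K ∈ elements, e ⊆ K ∧
    ∃ n : E d, sub.IsElementNormal K e n
  /-- the interior faces make up, without overlap, the interfaces between elements -/
  intFace_cover : ∀ f ∈ sub.facets, ∀ K ∈ elements, ∀ L ∈ elements, K ≠ L → hull f ⊆ K ∩ L →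
    ∃! e, e ∈ intFaces ∧ hull f ⊆ e
  /-- the boundary faces make up, without overlap, the boundary of the domain -/
  bdFace_cover : ∀ f ∈ sub.facets, hull f ⊆ frontier Ω → ∃! e, e ∈ bdFaces ∧ hull f ⊆ e

/-- Shape regularity with parameters `N` and `σ`: every element consists of at most `N` simplices,
and the ratio of diameter to inradius of every simplex is at most `σ`. -/
def PolyMesh.ShapeRegular {Ω : Set (E d)} (M : PolyMesh Ω) (N : ℕ) (σ : ℝ) : Prop :=
  (∀ K ∈ M.elements, (M.sub.subcells K).card ≤ N) ∧
    ∀ s ∈ M.sub.cells, Metric.diam (hull s) ≤ σ * inradius (hull s)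

/-! ### Sobolev spaces -/

/-- `g` is the weak partial derivative `∂ₖ u` in the open set `D`. -/
def IsWeakPartial (D : Set (E d)) (k : Fin d) (u g : E d → ℝ) : Prop :=
  ∀ φ : E d → ℝ, ContDiff ℝ (⊤ : ℕ∞) φ → HasCompactSupport φ → tsupport φ ⊆ D →
    ∫ x in D, u x * fderiv ℝ φ x (EuclideanSpace.single k 1) = -∫ x in D, g x * φ x

/-- `u ∈ H¹(D)`. -/
def MemH1 (D : Set (E d)) (u : E d → ℝ) : Prop :=
  MemLp u 2 (volume.restrict D) ∧
    ∀ k, ∃ g, MemLp g 2 (volume.restrict D) ∧ IsWeakPartial D k u g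

open Classical in
/-- The weak partial derivative `∂ₖ u ∈ L²(D)`; it is unique almost everywhere in `D` where it
exists (and `0` by convention if it does not). -/
def weakPartial (D : Set (E d)) (k : Fin d) (u : E d → ℝ) : E d → ℝ :=
  if h : ∃ g, MemLp g 2 (volume.restrict D) ∧ IsWeakPartial D k u g then h.choose else 0

/-- `‖W‖²` in `L²(D)^{d×d}`. -/
def normSqL2 (D : Set (E d)) (W : E d → Matrix (Fin d) (Fin d) ℝ) : ℝ :=
  ∑ i, ∑ j, ∫ x in D, (W x i j) ^ 2

/-- `‖∇W‖²` in `L²(D)`, for a tensor-valued `W`. -/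
def normSqGrad (D : Set (E d)) (W : E d → Matrix (Fin d) (Fin d) ℝ) : ℝ :=
  ∑ i, ∑ j, ∑ k, ∫ x in D, (weakPartial D k (fun y => W y i j) x) ^ 2

/-! ### Piecewise polynomials and traces -/

/-- `W` agrees in the interior of `K` with a tensor of polynomials of degree at most `m`. -/
def IsPolyOn (m : ℕ) (K : Set (E d)) (W : E d → Matrix (Fin d) (Fin d) ℝ) : Prop :=
  ∀ i j, ∃ p : MvPolynomial (Fin d) ℝ, p.totalDegree ≤ m ∧
    ∀ x ∈ interior K, W x i j = MvPolynomial.eval (fun l => x l) p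

/-- `W ∈ (V_h^m)^{d×d}`: polynomial of degree at most `m` on each element. -/
def PolyMesh.IsPiecewisePoly {Ω : Set (E d)} (M : PolyMesh Ω) (m : ℕ)
    (W : E d → Matrix (Fin d) (Fin d) ℝ) : Prop :=
  ∀ K ∈ M.elements, IsPolyOn m K W

/-- Polynomial of degree at most `m` on each simplex of the triangulation. -/
def Triangulation.IsPiecewisePoly {Ω : Set (E d)} (T : Triangulation Ω) (m : ℕ)
    (W : E d → Matrix (Fin d) (Fin d) ℝ) : Prop :=
  ∀ s ∈ T.cells, IsPolyOn m (hull s) W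

/-- The trace on the boundary of `K` of `W` restricted to `K`: the limit from the interior
of `K`. -/
def traceFrom (K : Set (E d)) (W : E d → Matrix (Fin d) (Fin d) ℝ) (x : E d) :
    Matrix (Fin d) (Fin d) ℝ :=
  fun i j => extendFrom (interior K) (fun y => W y i j) x

/-- The columnwise tensor product `n ⊗ τ`: the `c`-th entry is the matrix `n ⊗ τ_c`, where `τ_c` is
the `c`-th column of `τ`. -/
def tensorCols (n : E d) (τ : Matrix (Fin d) (Fin d) ℝ) : Fin d → Fin d → Fin d → ℝ :=
  fun c i j => n i * τ j c

/-- The columnwise cross product `n × τ`: the `c`-th entry is the array of the numbers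
`n i * q j - n j * q i`, with `q` the `c`-th column of `τ`. Its entries with `i < j` are, for
`d = 2`, the scalar `n × q`, and, for `d = 3`, the components of the vector `n × q` up to order and
sign. -/
def crossCols (n : E d) (τ : Matrix (Fin d) (Fin d) ℝ) : Fin d → Fin d → Fin d → ℝ :=
  fun c i j => n i * τ j c - n j * τ i c

/-- Squared Euclidean norm of a columnwise tensor product. -/
def tensorNormSq (a : Fin d → Fin d → Fin d → ℝ) : ℝ := ∑ c, ∑ i, ∑ j, (a c i j) ^ 2

/-- Squared Euclidean norm of a columnwise cross product: only the entries with `i < j` count. -/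
def crossNormSq (a : Fin d → Fin d → Fin d → ℝ) : ℝ := ∑ c, ∑ i, ∑ j ∈ Finset.Ioi i, (a c i j) ^ 2

theorem crossNormSq_two (n : E 2) (τ : Matrix (Fin 2) (Fin 2) ℝ) :
    crossNormSq (crossCols n τ) = ∑ c, (n 0 * τ 1 c - n 1 * τ 0 c) ^ 2 := by
  have h0 : Finset.Ioi (0 : Fin 2) = {1} := by decide
  have h1 : Finset.Ioi (1 : Fin 2) = ∅ := by decide
  simp [crossNormSq, crossCols, Fin.sum_univ_two, h0, h1]

theorem crossNormSq_three (n : E 3) (τ : Matrix (Fin 3) (Fin 3) ℝ) :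
    crossNormSq (crossCols n τ) =
      ∑ c, ∑ i, (crossProduct (fun l => n l) (fun l => τ l c) i) ^ 2 := by
  have h0 : Finset.Ioi (0 : Fin 3) = {1, 2} := by decide
  have h1 : Finset.Ioi (1 : Fin 3) = {2} := by decide
  have h2 : Finset.Ioi (2 : Fin 3) = ∅ := by decide
  simp [crossNormSq, crossCols, Fin.sum_univ_three, h0, h1, h2, cross_apply]
  ring

open Classical in
/-- The unit outward normal of the element `K` on its face `e`. -/
def PolyMesh.normal {Ω : Set (E d)} (M : PolyMesh Ω) (K e : Set (E d)) : E d :=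
  if h : ∃ n, M.sub.IsElementNormal K e n then h.choose else 0

open Classical in
/-- The elements having `e` as a face: two for an interior face, one for a boundary face. -/
def PolyMesh.adj {Ω : Set (E d)} (M : PolyMesh Ω) (e : Set (E d)) : Finset (Set (E d)) :=
  M.elements.filter fun K => e ⊆ K

/-- The jump `[n ⊗ W] = n⁺ ⊗ W⁺ + n⁻ ⊗ W⁻` at a point of an interior face `e`. -/
def PolyMesh.tensorJump {Ω : Set (E d)} (M : PolyMesh Ω) (W : E d → Matrix (Fin d) (Fin d) ℝ)
    (e : Set (E d)) (x : E d) : Fin d → Fin d → Fin d → ℝ :=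
  ∑ K ∈ M.adj e, tensorCols (M.normal K e) (traceFrom K W x)

/-- The tangential trace `n × W` at a point of a boundary face `e` (the sum has one term). -/
def PolyMesh.tangentialTrace {Ω : Set (E d)} (M : PolyMesh Ω)
    (W : E d → Matrix (Fin d) (Fin d) ℝ) (e : Set (E d)) (x : E d) : Fin d → Fin d → Fin d → ℝ :=
  ∑ K ∈ M.adj e, crossCols (M.normal K e) (traceFrom K W x)

open scoped MeasureTheory in
/-- `∑_{e interior} h_e^β ‖[n ⊗ W]‖²_{L²(e)} + ∑_{e boundary} h_e^β ‖n × W‖²_{L²(e)}`, where `h_e` is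
the diameter of `e` and integration is with respect to the `(d-1)`-dimensional surface measure. -/
def PolyMesh.faceTerms {Ω : Set (E d)} (M : PolyMesh Ω) (β : ℤ)
    (W : E d → Matrix (Fin d) (Fin d) ℝ) : ℝ :=
  (∑ e ∈ M.intFaces,
    Metric.diam e ^ β * (∫ x in e, tensorNormSq (M.tensorJump W e x) ∂μHE[d - 1])) +
  (∑ e ∈ M.bdFaces,
    Metric.diam e ^ β * (∫ x in e, crossNormSq (M.tangentialTrace W e x) ∂μHE[d - 1]))

/-- The tangential trace `n × W` vanishes on `∂Ω`: on each boundary face of the triangulation, the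
columnwise cross product of the unit outward normal of `Ω` with the trace of `W` is zero. -/
def Triangulation.TangentialTraceVanishes {Ω : Set (E d)} (T : Triangulation Ω)
    (W : E d → Matrix (Fin d) (Fin d) ℝ) : Prop :=
  ∀ s ∈ T.cells, ∀ f, IsFacetOf f s → hull f ⊆ frontier Ω → ∀ n, IsOuterNormal Ω (hull f) n →
    ∀ x ∈ hull f, crossCols n (traceFrom (hull s) W x) = 0

end PolyFEM

end

open MeasureTheory Set

noncomputable section

namespace PolyFEM

variable {d : ℕ}

/-! ### Simplices and their barycentric coordinates. -/

section

/-! ### Barycentric coordinates of a simplex -/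

/-! On every simplex of the sub-decomposition a polynomial of degree at most `m` has unique
Bernstein coefficients, indexed by multi-indices `a` supported on the vertices. Bernstein
polynomials of two simplices agree on their common face, so coefficients `w a` that depend only on
`a`, not on the simplex, define a continuous piecewise polynomial (`Triangulation.spline`). On the
convex set `closure Ω` it is Lipschitz, hence in H¹. The tangential trace vanishes as soon as each
column of `w a` is parallel to every outer normal of a boundary facet carrying `a`.

The value `w a` is chosen node by node (`BernForm.exists_node_value`). If no boundary facet carries
`a`, it is the coefficient of `V` on an arbitrary simplex carrying `a`; if exactly one normal
occurs, it is the normal part of that coefficient; if two different normals occur, it is zero.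

The error of this choice is controlled locally. Equivalence of norms on the reference simplex bounds
coefficients on a facet by the scaled L² norm there (`exists_facetBound`). Hence coefficients on two
simplices with a common facet differ by at most the jump (`BernForm.coef_sub_sq_le`), and their
tangential components on a boundary facet are bounded by the tangential trace
(`BernForm.cross_coef_sq_le`). All simplices carrying `a` contain the centroid of its support; they
are linked through common facets (`Triangulation.star_connected`) and their number is bounded by
shape regularity, so facet differences can be added up along a chain. With two different normals the
whole vector is small, because tangential components along two independent normals determine it. The
angle between them is bounded below since a polytope has only finitely many facet normals
(`exists_angle_bound`), and normals meeting at a point are never opposite.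

With simplex size h, this gives squared coefficient errors times h^(d-1) bounded by nearby face
terms. The volume h^d and the factor h^(-2) from differentiation yield the weights h and h^(-1).
Sizes of neighbouring simplices, elements and faces are comparable and overlaps are bounded, so the
local bounds can be summed (`PolyMesh.sum_patch_le`). -/

/-- `s` is the vertex set of a nondegenerate `d`-simplex. -/
structure IsSimplex (s : Finset (E d)) : Prop where
  card : s.card = d + 1
  indep : AffineIndependent ℝ ((↑) : s → E d)

theorem Triangulation.isSimplex {Ω : Set (E d)} (T : Triangulation Ω) {s : Finset (E d)}
    (hs : s ∈ T.cells) : IsSimplex s :=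
  ⟨T.card_cell s hs, T.affineIndependent s hs⟩

/-- The affine basis formed by the vertices of a simplex. -/
def IsSimplex.basis {s : Finset (E d)} (hs : IsSimplex s) : AffineBasis s ℝ (E d) where
  toFun := (↑)
  ind' := hs.indep
  tot' := by
    rw [hs.indep.affineSpan_eq_top_iff_card_eq_finrank_add_one]
    simp [hs.card]

@[simp] theorem IsSimplex.basis_apply {s : Finset (E d)} (hs : IsSimplex s) (v : s) :
    hs.basis v = v := rfl

open Classical in
/-- The barycentric coordinate of the simplex `s` belonging to the vertex `v`; zero if `v` is not a
vertex of `s`. -/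
def bary (s : Finset (E d)) (v : E d) : E d →ᵃ[ℝ] ℝ :=
  if h : IsSimplex s ∧ v ∈ s then h.1.basis.coord ⟨v, h.2⟩ else 0

theorem bary_of_notMem {s : Finset (E d)} {v : E d} (hv : v ∉ s) (x : E d) : bary s v x = 0 := by
  simp [bary, hv]

theorem IsSimplex.bary_eq {s : Finset (E d)} (hs : IsSimplex s) (v : s) :
    bary s v = hs.basis.coord v := by
  simp [bary, hs]

theorem IsSimplex.sum_bary {s : Finset (E d)} (hs : IsSimplex s) (x : E d) :
    ∑ v ∈ s, bary s v x = 1 := by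
  rw [← Finset.sum_coe_sort, ← hs.basis.sum_coord_apply_eq_one x]
  simp [hs.bary_eq]

theorem IsSimplex.sum_bary_smul {s : Finset (E d)} (hs : IsSimplex s) (x : E d) :
    ∑ v ∈ s, bary s v x • v = x := by
  rw [← Finset.sum_coe_sort]
  conv_rhs => rw [← hs.basis.linear_combination_coord_eq_self x]
  simp [hs.bary_eq]

theorem IsSimplex.bary_self {s : Finset (E d)} (hs : IsSimplex s) {v : E d} (hv : v ∈ s) :
    bary s v v = 1 := by
  rw [hs.bary_eq ⟨v, hv⟩]; exact hs.basis.coord_apply_eq ⟨v, hv⟩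

theorem IsSimplex.bary_ne {s : Finset (E d)} (hs : IsSimplex s) {v w : E d} (hw : w ∈ s)
    (h : v ≠ w) : bary s v w = 0 := by
  by_cases hv : v ∈ s
  · rw [hs.bary_eq ⟨v, hv⟩]
    exact hs.basis.coord_apply_ne (i := ⟨v, hv⟩) (j := ⟨w, hw⟩) (by simpa using h)
  · exact bary_of_notMem hv w

/-- An affine function is determined by its values at the vertices. -/
theorem IsSimplex.affine_eq {s : Finset (E d)} (hs : IsSimplex s) (φ : E d →ᵃ[ℝ] ℝ) (x : E d) :
    φ x = ∑ v ∈ s, bary s v x * φ v := by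
  have h := s.map_affineCombination id (fun v => bary s v x) (hs.sum_bary x) φ
  rw [s.affineCombination_eq_linear_combination _ _ (hs.sum_bary x),
    s.affineCombination_eq_linear_combination _ _ (hs.sum_bary x)] at h
  simpa [hs.sum_bary_smul x] using h

theorem affine_sum {g : Finset (E d)} {w : E d → ℝ} (hw : ∑ v ∈ g, w v = 1)
    (φ : E d →ᵃ[ℝ] ℝ) : φ (∑ v ∈ g, w v • v) = ∑ v ∈ g, w v * φ v := by
  have h := g.map_affineCombination id w hw φ
  rw [g.affineCombination_eq_linear_combination _ _ hw,
    g.affineCombination_eq_linear_combination _ _ hw] at h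
  simpa using h

theorem IsSimplex.bary_sum {s g : Finset (E d)} (hs : IsSimplex s) (hg : g ⊆ s) {w : E d → ℝ}
    (hw : ∑ v ∈ g, w v = 1) {u : E d} (hu : u ∈ g) : bary s u (∑ v ∈ g, w v • v) = w u := by
  rw [affine_sum hw, Finset.sum_eq_single_of_mem u hu, hs.bary_self (hg hu), mul_one]
  intro v hv hvu
  rw [hs.bary_ne (hg hv) hvu.symm, mul_zero]

theorem IsSimplex.bary_sum_of_notMem {s g : Finset (E d)} (hs : IsSimplex s) (hg : g ⊆ s)
    {w : E d → ℝ} (hw : ∑ v ∈ g, w v = 1) {u : E d} (hu : u ∉ g) :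
    bary s u (∑ v ∈ g, w v • v) = 0 := by
  rw [affine_sum hw]
  refine Finset.sum_eq_zero fun v hv => ?_
  rw [hs.bary_ne (hg hv) (by rintro rfl; exact hu hv), mul_zero]

theorem mem_hull_iff {g : Finset (E d)} {x : E d} : x ∈ hull g ↔
    ∃ w : E d → ℝ, (∀ v ∈ g, 0 ≤ w v) ∧ ∑ v ∈ g, w v = 1 ∧ ∑ v ∈ g, w v • v = x := by
  rw [hull, Finset.mem_convexHull']

theorem IsSimplex.mem_hull_iff {s : Finset (E d)} (hs : IsSimplex s) {x : E d} :
    x ∈ hull s ↔ ∀ v, 0 ≤ bary s v x := by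
  constructor
  · intro hx v
    obtain ⟨w, hw0, hw1, rfl⟩ := PolyFEM.mem_hull_iff.1 hx
    by_cases hv : v ∈ s
    · rw [hs.bary_sum subset_rfl hw1 hv]; exact hw0 v hv
    · rw [bary_of_notMem hv]
  · intro h
    exact PolyFEM.mem_hull_iff.2 ⟨fun v => bary s v x, fun v _ => h v, hs.sum_bary x,
      hs.sum_bary_smul x⟩

theorem IsSimplex.mem_hull_subset_iff {s g : Finset (E d)} (hs : IsSimplex s) (hg : g ⊆ s)
    {x : E d} : x ∈ hull g ↔ x ∈ hull s ∧ ∀ v ∉ g, bary s v x = 0 := by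
  constructor
  · intro hx
    refine ⟨convexHull_mono (by exact_mod_cast hg) hx, fun v hv => ?_⟩
    obtain ⟨w, hw0, hw1, rfl⟩ := PolyFEM.mem_hull_iff.1 hx
    exact hs.bary_sum_of_notMem hg hw1 hv
  · rintro ⟨hx, h⟩
    refine PolyFEM.mem_hull_iff.2 ⟨fun v => bary s v x, fun v _ => hs.mem_hull_iff.1 hx v, ?_, ?_⟩
    · rw [← hs.sum_bary x]
      exact Finset.sum_subset hg fun v _ hv => h v hv
    · conv_rhs => rw [← hs.sum_bary_smul x]
      exact Finset.sum_subset hg fun v _ hv => by simp only [h v hv, zero_smul]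

theorem IsSimplex.bary_le_one {s : Finset (E d)} (hs : IsSimplex s) {x : E d} (hx : x ∈ hull s)
    (v : E d) : bary s v x ≤ 1 := by
  by_cases hv : v ∈ s
  · rw [← hs.sum_bary x]
    exact Finset.single_le_sum (f := fun v => bary s v x)
      (fun v _ => hs.mem_hull_iff.1 hx v) hv
  · rw [bary_of_notMem hv]; exact zero_le_one

theorem IsSimplex.mem_interior_hull_iff {s : Finset (E d)} (hs : IsSimplex s) {x : E d} :
    x ∈ interior (hull s) ↔ ∀ v ∈ s, 0 < bary s v x := by
  have h := hs.basis.interior_convexHull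
  have h2 : range hs.basis = (s : Set (E d)) := by
    ext v; simp
  rw [h2] at h
  rw [hull, h]
  constructor
  · intro hx v hv
    rw [hs.bary_eq ⟨v, hv⟩]; exact hx ⟨v, hv⟩
  · intro hx v
    rw [← hs.bary_eq v]; exact hx v v.2

theorem IsSimplex.nonempty {s : Finset (E d)} (hs : IsSimplex s) : s.Nonempty := by
  rw [← Finset.card_pos, hs.card]; omega

theorem convex_hull (g : Finset (E d)) : Convex ℝ (hull g) := convex_convexHull ℝ _

theorem isCompact_hull (g : Finset (E d)) : IsCompact (hull g) :=
  g.finite_toSet.isCompact_convexHull (𝕜 := ℝ)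

theorem isClosed_hull (g : Finset (E d)) : IsClosed (hull g) := (isCompact_hull g).isClosed

theorem subset_hull {g : Finset (E d)} {v : E d} (hv : v ∈ g) : v ∈ hull g :=
  subset_convexHull ℝ _ hv

theorem hull_mono {f g : Finset (E d)} (h : f ⊆ g) : hull f ⊆ hull g :=
  convexHull_mono (by exact_mod_cast h)

/-- The centroid of a finite set of points. -/
def centre (g : Finset (E d)) : E d := ∑ v ∈ g, (g.card : ℝ)⁻¹ • v

theorem sum_centre_weights {g : Finset (E d)} (hg : g.Nonempty) :
    ∑ _v ∈ g, (g.card : ℝ)⁻¹ = 1 := by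
  have : (g.card : ℝ) ≠ 0 := by exact_mod_cast (Finset.card_pos.2 hg).ne'
  simp [this]

theorem centre_mem_hull {g : Finset (E d)} (hg : g.Nonempty) : centre g ∈ hull g :=
  mem_hull_iff.2 ⟨fun _ => (g.card : ℝ)⁻¹, fun _ _ => by positivity, sum_centre_weights hg, rfl⟩

theorem IsSimplex.bary_centre_pos {s g : Finset (E d)} (hs : IsSimplex s) (hg : g ⊆ s) {v : E d}
    (hv : v ∈ g) : 0 < bary s v (centre g) := by
  have hne : g.Nonempty := ⟨v, hv⟩
  rw [centre, hs.bary_sum (w := fun _ => (g.card : ℝ)⁻¹) hg (sum_centre_weights hne) hv]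
  have := Finset.card_pos.2 hne
  positivity

theorem IsSimplex.centre_mem_interior {s : Finset (E d)} (hs : IsSimplex s) :
    centre s ∈ interior (hull s) :=
  hs.mem_interior_hull_iff.2 fun _ hv => hs.bary_centre_pos subset_rfl hv

theorem IsSimplex.closure_interior {s : Finset (E d)} (hs : IsSimplex s) :
    closure (interior (hull s)) = hull s :=
  (convex_hull s).closure_interior_eq_closure_of_nonempty_interior ⟨_, hs.centre_mem_interior⟩
    |>.trans (isClosed_hull s).closure_eq

/-- If the simplex contains a ball of radius `r`, its barycentric coordinates are `r⁻¹`-Lipschitz. -/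
theorem IsSimplex.abs_bary_sub_le {s : Finset (E d)} (hs : IsSimplex s) {c : E d} {r : ℝ}
    (hr : 0 < r) (hball : Metric.closedBall c r ⊆ hull s) (v x y : E d) :
    |bary s v x - bary s v y| ≤ ‖x - y‖ / r := by
  rcases eq_or_ne x y with rfl | hxy
  · simp
  have hn : 0 < ‖x - y‖ := norm_pos_iff.2 (sub_ne_zero.2 hxy)
  -- Rescaled to length `r`, the displacement joins two points of the ball. The coordinate lies in
  -- [0, 1] at both, so its linear part changes by at most 1 along `u`.
  set u : E d := (r / ‖x - y‖) • (x - y) with hu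
  have hun : ‖u‖ = r := by
    rw [hu, norm_smul, Real.norm_of_nonneg (by positivity)]; field_simp
  have h1 : c + u ∈ hull s := hball (by simp [hun])
  have h2 : c ∈ hull s := hball (by simp [hr.le])
  have h3 : bary s v (c + u) = (bary s v).linear u + bary s v c := by
    have := (bary s v).map_vadd c u
    simpa [add_comm] using this
  have h4 : bary s v x - bary s v y = (bary s v).linear (x - y) := by
    have := (bary s v).linearMap_vsub x y
    simpa using this.symm
  have h5 : (bary s v).linear u = (r / ‖x - y‖) * (bary s v).linear (x - y) := by
    rw [hu, map_smul, smul_eq_mul]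
  have b1 := hs.mem_hull_iff.1 h1 v
  have b2 := hs.mem_hull_iff.1 h2 v
  have b3 := hs.bary_le_one h1 v
  have b4 := hs.bary_le_one h2 v
  rw [h4]
  have h6 : |(r / ‖x - y‖) * (bary s v).linear (x - y)| ≤ 1 := by
    rw [← h5, abs_le]; constructor <;> linarith
  rw [abs_mul, abs_of_pos (by positivity)] at h6
  rw [le_div_iff₀ hr]
  calc |(bary s v).linear (x - y)| * r
      = (r / ‖x - y‖ * |(bary s v).linear (x - y)|) * ‖x - y‖ := by field_simp
    _ ≤ 1 * ‖x - y‖ := by gcongr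
    _ = _ := one_mul _

theorem continuous_bary (s : Finset (E d)) (v : E d) : Continuous (bary s v) :=
  (bary s v).continuous_of_finiteDimensional

/-! ### Conformity expressed through barycentric coordinates. -/

section Conformity

variable {Ω : Set (E d)} (T : Triangulation Ω) {s t : Finset (E d)}

/-- A common point is a convex combination of common vertices, and these weights are its coordinates
in both simplices. This is what makes Bernstein polynomials match across faces. -/
theorem Triangulation.bary_congr (hs : s ∈ T.cells) (ht : t ∈ T.cells) {x : E d}
    (hxs : x ∈ hull s) (hxt : x ∈ hull t) (v : E d) : bary s v x = bary t v x := by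
  classical
  have hx := T.conforming s hs t ht ⟨hxs, hxt⟩
  rw [← Finset.coe_inter] at hx
  obtain ⟨w, -, hw1, rfl⟩ := PolyFEM.mem_hull_iff.1 hx
  by_cases hv : v ∈ s ∩ t
  · rw [(T.isSimplex hs).bary_sum Finset.inter_subset_left hw1 hv,
      (T.isSimplex ht).bary_sum Finset.inter_subset_right hw1 hv]
  · rw [(T.isSimplex hs).bary_sum_of_notMem Finset.inter_subset_left hw1 hv,
      (T.isSimplex ht).bary_sum_of_notMem Finset.inter_subset_right hw1 hv]

theorem Triangulation.mem_of_bary_pos (hs : s ∈ T.cells) (ht : t ∈ T.cells) {x : E d}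
    (hxs : x ∈ hull s) (hxt : x ∈ hull t) {v : E d} (hv : 0 < bary s v x) : v ∈ t := by
  by_contra h
  rw [T.bary_congr hs ht hxs hxt, bary_of_notMem h] at hv
  exact lt_irrefl _ hv

/-- The centroid has positive coordinates at all vertices of `g`, so a simplex containing this one
point has the whole of `g` as a face. -/
theorem Triangulation.subset_of_centre_mem (hs : s ∈ T.cells) (ht : t ∈ T.cells)
    {g : Finset (E d)} (hg : g ⊆ s) (hx : centre g ∈ hull t) : g ⊆ t := by
  intro v hv
  exact T.mem_of_bary_pos hs ht (hull_mono hg (centre_mem_hull ⟨v, hv⟩)) hx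
    ((T.isSimplex hs).bary_centre_pos hg hv)

theorem Triangulation.eq_of_subset (hs : s ∈ T.cells) (ht : t ∈ T.cells) (h : s ⊆ t) : s = t :=
  Finset.eq_of_subset_of_card_le h (by rw [T.card_cell s hs, T.card_cell t ht])

theorem Triangulation.eq_of_mem_interior (hs : s ∈ T.cells) (ht : t ∈ T.cells) {x : E d}
    (hxs : x ∈ interior (hull s)) (hxt : x ∈ hull t) : s = t :=
  T.eq_of_subset hs ht fun _ hv => T.mem_of_bary_pos hs ht (interior_subset hxs) hxt
    ((T.isSimplex hs).mem_interior_hull_iff.1 hxs _ hv)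

end Conformity

end

section

/-! ### Connectedness of stars -/

/-- Propagation along a connected finite relation: a property indexed by the distance from a base
point that is passed on to neighbours holds everywhere at distance `S.card`. -/
theorem forall_of_connected {α : Type*} {S : Finset α} {R : α → α → Prop}
    (hconn : ∀ A ⊆ S, A.Nonempty → A ≠ S → ∃ a ∈ A, ∃ b ∈ S, b ∉ A ∧ R a b)
    {P : ℕ → α → Prop} (mono : ∀ n a, P n a → P (n + 1) a)
    (step : ∀ n, ∀ a ∈ S, ∀ b ∈ S, R a b → P n a → P (n + 1) b)
    {s : α} (hs : s ∈ S) (h0 : P 0 s) : ∀ t ∈ S, P S.card t := by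
  classical
  -- At level `k` the property is known on at least `k` elements or on all of `S`: each step adds
  -- one neighbour and raises the level by one.
  have key : ∀ k : ℕ, ∃ A ⊆ S, A.Nonempty ∧ (k ≤ A.card ∨ A = S) ∧ ∀ a ∈ A, P k a := by
    intro k
    induction k with
    | zero =>
      refine ⟨{s}, by simpa using hs, by simp, by simp, ?_⟩
      simpa using h0
    | succ k ih =>
      obtain ⟨A, hA, hne, hc, hP⟩ := ih
      by_cases hAS : A = S
      · exact ⟨A, hA, hne, Or.inr hAS, fun a ha => mono _ _ (hP a ha)⟩
      obtain ⟨a, ha, b, hb, hbA, hR⟩ := hconn A hA hne hAS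
      refine ⟨insert b A, Finset.insert_subset hb hA, by simp, Or.inl ?_, ?_⟩
      · rw [Finset.card_insert_of_notMem hbA]
        have := hc.resolve_right hAS
        omega
      · intro c hc
        rcases Finset.mem_insert.1 hc with rfl | hc
        · exact step k a (hA ha) c hb hR (hP a ha)
        · exact mono _ _ (hP c hc)
  obtain ⟨A, hA, -, hc, hP⟩ := key S.card
  have : A = S := hc.elim (fun h => Finset.eq_of_subset_of_card_le hA h) id
  exact this ▸ hP

/-- Used for general position: such spans are null sets. -/
theorem affineSpan_ne_top_of_card_le {g : Finset (E d)} (hg : g.card ≤ d) :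
    affineSpan ℝ (g : Set (E d)) ≠ ⊤ := by
  rcases g.eq_empty_or_nonempty with rfl | hne
  · simp
  intro h
  have : Nonempty g := hne.to_subtype
  have h1 := finrank_vectorSpan_range_add_one_le ℝ ((↑) : g → E d)
  have h2 : vectorSpan ℝ (g : Set (E d)) = ⊤ := by
    rw [← direction_affineSpan, h, AffineSubspace.direction_top]
  rw [show range ((↑) : g → E d) = (g : Set (E d)) by ext; simp, Fintype.card_coe, h2] at h1
  simp at h1
  omega

variable {Ω : Set (E d)} (T : Triangulation Ω)

open Classical in
/-- The simplices of the triangulation that contain the point `z`. -/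
def Triangulation.star (z : E d) : Finset (Finset (E d)) := T.cells.filter fun s => z ∈ hull s

theorem Triangulation.mem_star {z : E d} {s : Finset (E d)} :
    s ∈ T.star z ↔ s ∈ T.cells ∧ z ∈ hull s := by
  simp [Triangulation.star]

/-- The finitely many simplices missing `z` form a closed set, so `z` keeps a positive distance from
them. -/
theorem Triangulation.exists_ball_star (z : E d) : ∃ r > 0, ∀ x ∈ Metric.ball z r, ∀ s ∈ T.cells,
    x ∈ hull s → s ∈ T.star z := by
  classical
  set F : Set (E d) := ⋃ s ∈ T.cells.filter (fun s => z ∉ hull s), hull s with hF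
  have hFc : IsClosed F := by
    refine isClosed_biUnion_finset fun s _ => isClosed_hull s
  have hz : z ∈ Fᶜ := by simp [hF]
  obtain ⟨r, hr, hsub⟩ := Metric.isOpen_iff.1 hFc.isOpen_compl z hz
  refine ⟨r, hr, fun x hx s hs hxs => ?_⟩
  rw [T.mem_star]
  refine ⟨hs, ?_⟩
  by_contra hzs
  refine hsub hx (mem_biUnion (x := s) ?_ hxs)
  simp [hs, hzs]

theorem exists_mem_interior_hull_ball {s : Finset (E d)} (hs : IsSimplex s) {z : E d}
    (hz : z ∈ hull s) {r : ℝ} (hr : 0 < r) :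
    (interior (hull s) ∩ Metric.ball z r).Nonempty := by
  rw [← hs.closure_interior] at hz
  obtain ⟨y, hy, hyr⟩ := Metric.mem_closure_iff.1 hz r hr
  exact ⟨y, hy, by rwa [Metric.mem_ball, dist_comm]⟩

/-- The simplices containing a given point are connected through common facets. -/
theorem Triangulation.star_connected (hΩ : Convex ℝ (closure Ω)) (z : E d)
    (A : Finset (Finset (E d))) (hA : A ⊆ T.star z) (hne : A.Nonempty) (hAS : A ≠ T.star z) :
    ∃ a ∈ A, ∃ b ∈ T.star z, b ∉ A ∧ ∃ f, IsFacetOf f a ∧ IsFacetOf f b ∧ z ∈ hull f := by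
  classical
  obtain ⟨s, hsA⟩ := hne
  obtain ⟨t, ht, htA⟩ : ∃ t ∈ T.star z, t ∉ A := by
    by_contra! h
    exact hAS (Finset.Subset.antisymm hA h)
  have hs := T.mem_star.1 (hA hsA)
  have ht' := T.mem_star.1 ht
  obtain ⟨r, hr, hball⟩ := T.exists_ball_star z
  obtain ⟨q, hqt, hqr⟩ := exists_mem_interior_hull_ball (T.isSimplex ht'.1) ht'.2 hr
  set W := interior (hull s) ∩ Metric.ball z r with hW
  have hWo : IsOpen W := isOpen_interior.inter Metric.isOpen_ball
  have hWne : W.Nonempty := exists_mem_interior_hull_ball (T.isSimplex hs.1) hs.2 hr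
  -- Faces of codimension at least two. Together with `q` they span proper affine subspaces, so a
  -- generic `p` near `z` in `hull s` avoids all of these. The segment from `p` to `q` then misses
  -- the faces in `G`, except possibly at `q`.
  set G : Finset (Finset (E d)) :=
    (T.cells.biUnion Finset.powerset).filter fun g => g.card < d with hG
  set bad : Set (E d) := ⋃ g ∈ G, (affineSpan ℝ ((insert q g : Finset (E d)) : Set (E d)) : Set (E d))
    with hbad
  have hnull : volume bad = 0 := by
    refine (measure_biUnion_null_iff G.countable_toSet).2 fun g hg => ?_
    refine Measure.addHaar_affineSubspace _ _ (affineSpan_ne_top_of_card_le ?_)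
    have : g.card < d := (Finset.mem_filter.1 hg).2
    exact (Finset.card_insert_le _ _).trans this
  obtain ⟨p, hpW, hpbad⟩ : ∃ p ∈ W, p ∉ bad := by
    by_contra! h
    have h1 : 0 < volume W := hWo.measure_pos volume hWne
    exact h1.ne' (measure_mono_null h hnull)
  have hcells : ∀ s ∈ T.cells, hull s ⊆ closure Ω := fun s hs => by
    rw [← T.cover]; exact subset_biUnion_of_mem (u := fun s => hull s) hs
  -- By convexity the segment stays in `closure Ω` and in the small ball, so only simplices of the
  -- star meet it. Its connectedness yields a point common to a simplex in `A` and one outside.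
  have hseg : segment ℝ p q ⊆ (⋃ a ∈ A, hull a) ∪ ⋃ b ∈ T.star z \ A, hull b := by
    intro y hy
    have hyΩ : y ∈ closure Ω := hΩ.segment_subset
      (hcells s hs.1 (interior_subset hpW.1)) (hcells t ht'.1 (interior_subset hqt)) hy
    have hyb : y ∈ Metric.ball z r := (convex_ball z r).segment_subset hpW.2 hqr hy
    rw [← T.cover] at hyΩ
    simp only [mem_iUnion] at hyΩ
    obtain ⟨c, hc, hyc⟩ := hyΩ
    have hcs := hball y hyb c hc hyc
    by_cases hcA : c ∈ A
    · exact Or.inl (mem_biUnion hcA hyc)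
    · exact Or.inr (mem_biUnion (Finset.mem_coe.2 (Finset.mem_sdiff.2 ⟨hcs, hcA⟩)) hyc)
  have hpre : IsPreconnected (segment ℝ p q) := (convex_segment p q).isPreconnected
  obtain ⟨y, hy, hy1, hy2⟩ := isPreconnected_closed_iff.1 hpre _ _
    (isClosed_biUnion_finset fun s _ => isClosed_hull s)
    (isClosed_biUnion_finset fun s _ => isClosed_hull s) hseg
    ⟨p, left_mem_segment ℝ p q, mem_biUnion (Finset.mem_coe.2 hsA) (interior_subset hpW.1)⟩
    ⟨q, right_mem_segment ℝ p q, mem_biUnion (Finset.mem_coe.2 (Finset.mem_sdiff.2 ⟨ht, htA⟩))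
      (interior_subset hqt)⟩
  simp only [mem_iUnion] at hy1 hy2
  obtain ⟨a, ha, hya⟩ := hy1
  obtain ⟨b, hb, hyb⟩ := hy2
  obtain ⟨hb, hbA⟩ := Finset.mem_sdiff.1 hb
  have ha' := T.mem_star.1 (hA ha)
  have hb' := T.mem_star.1 hb
  have hyab : y ∈ hull (a ∩ b) := by
    have := T.conforming a ha'.1 b hb'.1 ⟨hya, hyb⟩
    rwa [← Finset.coe_inter] at this
  have hcard_le : (a ∩ b).card ≤ d := by
    by_contra! hlt
    have h1 : a ∩ b = a := Finset.eq_of_subset_of_card_le Finset.inter_subset_left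
      (by rw [T.card_cell a ha'.1]; omega)
    have h2 : a = b := T.eq_of_subset ha'.1 hb'.1 (Finset.inter_eq_left.1 h1)
    exact hbA (h2 ▸ ha)
  -- If the common face were smaller, `p` would lie on the line through `q` and a point of that
  -- face, which the choice of `p` excludes.
  have hcard : (a ∩ b).card = d := by
    by_contra hne
    have hlt : (a ∩ b).card < d := lt_of_le_of_ne hcard_le hne
    have hgG : a ∩ b ∈ G := by
      rw [hG, Finset.mem_filter, Finset.mem_biUnion]
      exact ⟨⟨a, ha'.1, by simp⟩, hlt⟩
    have hyspan : y ∈ affineSpan ℝ ((insert q (a ∩ b) : Finset (E d)) : Set (E d)) :=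
      affineSpan_mono ℝ (by simp) (convexHull_subset_affineSpan _ hyab)
    have hqspan : q ∈ affineSpan ℝ ((insert q (a ∩ b) : Finset (E d)) : Set (E d)) :=
      subset_affineSpan ℝ _ (by simp)
    rw [segment_eq_image_lineMap] at hy
    obtain ⟨τ, hτ, rfl⟩ := hy
    -- For `τ = 1` the crossing point is `q` itself and spans no line; but `q` is interior to `hull
    -- t`, so `a = t`, contrary to `t ∉ A`.
    rcases eq_or_ne τ 1 with rfl | hτ1
    · rw [AffineMap.lineMap_apply_one] at hya
      exact htA (T.eq_of_mem_interior ht'.1 ha'.1 hqt hya ▸ ha)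
    · refine hpbad (mem_biUnion (Finset.mem_coe.2 hgG) ?_)
      have hp : p = AffineMap.lineMap q (AffineMap.lineMap p q τ) (1 - τ)⁻¹ := by
        have : (1 - τ) ≠ 0 := sub_ne_zero.2 hτ1.symm
        simp only [AffineMap.lineMap_apply, vsub_eq_sub, vadd_eq_add]
        have h3 : τ • (q - p) + p - q = (1 - τ) • (p - q) := by module
        rw [h3, smul_smul, inv_mul_cancel₀ this]
        simp
      rw [hp]
      exact AffineMap.lineMap_mem _ hqspan hyspan
  refine ⟨a, ha, b, hb, hbA, a ∩ b, ⟨Finset.inter_subset_left, hcard⟩,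
    ⟨Finset.inter_subset_right, hcard⟩, ?_⟩
  have := T.conforming a ha'.1 b hb'.1 ⟨ha'.2, hb'.2⟩
  rwa [← Finset.coe_inter] at this

/-! ### Shape regularity -/

/-- The diameter of a simplex. -/
def size (s : Finset (E d)) : ℝ := Metric.diam (hull s)

theorem dist_le_size {s : Finset (E d)} {x y : E d} (hx : x ∈ hull s) (hy : y ∈ hull s) :
    dist x y ≤ size s :=
  Metric.dist_le_diam_of_mem (isCompact_hull s).isBounded hx hy

/-- Every simplex contains a ball of radius at least `κ⁻¹` times its diameter. -/
def Triangulation.Regular (κ : ℝ) : Prop :=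
  ∀ s ∈ T.cells, ∃ c r, 0 < r ∧ Metric.closedBall c r ⊆ hull s ∧ size s ≤ κ * r

theorem IsSimplex.size_pos {s : Finset (E d)} (hd : 1 ≤ d) (hs : IsSimplex s) : 0 < size s := by
  have h : 1 < s.card := by rw [hs.card]; omega
  obtain ⟨a, ha, b, hb, hab⟩ := Finset.one_lt_card.1 h
  exact (dist_pos.2 hab).trans_le (dist_le_size (subset_hull ha) (subset_hull hb))

/-- The inradius is a supremum; giving away a factor 2 produces an actual ball. The maximum with 1
makes powers of the constant monotone in the exponent. -/
theorem regular_of_shapeRegular (hd : 1 ≤ d) {M : PolyMesh Ω} {N : ℕ} {σ : ℝ} (hσ : 0 < σ)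
    (h : M.ShapeRegular N σ) : M.sub.Regular (max (2 * σ) 1) := by
  intro s hs
  have hpos := (M.sub.isSimplex hs).size_pos hd
  have h1 : size s ≤ σ * inradius (hull s) := h.2 s hs
  have h2 : size s / (2 * σ) < inradius (hull s) := by
    rw [div_lt_iff₀ (by positivity)]; nlinarith
  obtain ⟨c, hc⟩ : (hull s).Nonempty := ⟨_, centre_mem_hull (M.sub.isSimplex hs).nonempty⟩
  obtain ⟨r, ⟨-, c, hcr⟩, hr⟩ := exists_lt_of_lt_csSup
    (s := {r : ℝ | 0 ≤ r ∧ ∃ c : E d, Metric.closedBall c r ⊆ hull s})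
    ⟨0, le_rfl, c, by simpa using hc⟩ h2
  refine ⟨c, r, lt_trans (by positivity) hr, hcr, ?_⟩
  rw [div_lt_iff₀ (by positivity)] at hr
  have : 0 < r := by
    by_contra! h
    nlinarith [mul_nonpos_of_nonpos_of_nonneg h (by positivity : 0 ≤ 2 * σ)]
  calc size s ≤ 2 * σ * r := by linarith
    _ ≤ _ := by gcongr; exact le_max_left _ _

variable {T} {κ : ℝ}

/-- The coordinate of `v` drops from 1 at `v` to 0 at `w` and is `r⁻¹`-Lipschitz, so every edge has
length at least `r`. -/
theorem Triangulation.Regular.size_le_dist (hT : T.Regular κ) (hκ : 0 ≤ κ) {s : Finset (E d)} (hs : s ∈ T.cells)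
    {v w : E d} (hv : v ∈ s) (hw : w ∈ s) (hvw : v ≠ w) : size s ≤ κ * dist v w := by
  obtain ⟨c, r, hr, hball, hle⟩ := hT s hs
  have h := (T.isSimplex hs).abs_bary_sub_le hr hball v v w
  rw [(T.isSimplex hs).bary_self hv, (T.isSimplex hs).bary_ne hw hvw] at h
  rw [sub_zero, abs_one, le_div_iff₀ hr, one_mul, ← dist_eq_norm] at h
  exact hle.trans (by gcongr)

/-- Since `d ≥ 2`, the facet contains an edge, which belongs to both simplices. -/
theorem Triangulation.Regular.size_le_of_facet (hT : T.Regular κ) (hκ : 0 ≤ κ) (hd : 2 ≤ d) {s t f : Finset (E d)}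
    (hs : s ∈ T.cells) (hfs : IsFacetOf f s) (hft : f ⊆ t) :
    size s ≤ κ * size t := by
  obtain ⟨v, hv, w, hw, hvw⟩ := Finset.one_lt_card.1 (show 1 < f.card by rw [hfs.2]; omega)
  refine (hT.size_le_dist hκ hs (hfs.1 hv) (hfs.1 hw) hvw).trans ?_
  gcongr
  exact dist_le_size (subset_hull (hft hv)) (subset_hull (hft hw))

/-- Shrink every simplex of the star towards `z` to the size `ρ` of the smallest one. Each still
contains a ball of radius `ρ / κ` and lies within distance `ρ` of `z`. The balls are disjoint, being
in different simplices, and volumes are compared. -/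
theorem Triangulation.Regular.card_star_le (hT : T.Regular κ) (hd : 1 ≤ d) (hκ : 0 < κ) (z : E d) :
    ((T.star z).card : ℝ) ≤ κ ^ d := by
  classical
  rcases (T.star z).eq_empty_or_nonempty with he | hne
  · rw [he]; simp; positivity
  obtain ⟨s₀, hs₀, hmin⟩ := Finset.exists_min_image (T.star z) size hne
  set ρ := size s₀ with hρ
  have hρpos : 0 < ρ := (T.isSimplex (T.mem_star.1 hs₀).1).size_pos hd
  have key : ∀ s ∈ T.star z, ∃ c, Metric.ball c (ρ / κ) ⊆ interior (hull s) ∩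
      Metric.closedBall z ρ := by
    intro s hs
    have hs' := T.mem_star.1 hs
    obtain ⟨c, r, hr, hball, hle⟩ := hT s hs'.1
    have hsize : 0 < size s := (T.isSimplex hs'.1).size_pos hd
    set τ := ρ / size s with hτ
    have hτ0 : 0 < τ := by positivity
    have hτ1 : τ ≤ 1 := by rw [hτ, div_le_one hsize]; exact hmin s hs
    have hsub : Metric.ball (AffineMap.homothety z τ c) (ρ / κ) ⊆ hull s ∩ Metric.closedBall z ρ := by
      intro y hy
      set x := z + τ⁻¹ • (y - z) with hx
      have hyx : y = z + τ • (x - z) := by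
        rw [hx]; simp [smul_smul, hτ0.ne']
      have hxball : x ∈ Metric.closedBall c r := by
        rw [Metric.mem_ball, dist_eq_norm, AffineMap.homothety_apply] at hy
        rw [Metric.mem_closedBall, dist_eq_norm]
        have h1 : y - (τ • (c -ᵥ z) +ᵥ z) = τ • (x - c) := by
          rw [hyx]; simp only [vsub_eq_sub, vadd_eq_add]; module
        rw [h1, norm_smul, Real.norm_of_nonneg hτ0.le] at hy
        have h2 : τ * ‖x - c‖ ≤ τ * r := by
          refine hy.le.trans ?_
          rw [hτ, div_le_iff₀ hκ, div_mul_eq_mul_div, div_mul_eq_mul_div, le_div_iff₀ hsize]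
          nlinarith
        exact le_of_mul_le_mul_left h2 hτ0
      have hxs := hball hxball
      refine ⟨?_, ?_⟩
      · rw [hyx]
        have := (convex_hull s).add_smul_sub_mem hs'.2 hxs ⟨hτ0.le, hτ1⟩
        exact this
      · rw [Metric.mem_closedBall, hyx, dist_eq_norm, add_sub_cancel_left, norm_smul,
          Real.norm_of_nonneg hτ0.le, ← dist_eq_norm]
        calc τ * dist x z ≤ τ * size s := by gcongr; exact dist_le_size hxs hs'.2
          _ = ρ := by rw [hτ]; field_simp
    refine ⟨_, subset_inter (interior_maximal (hsub.trans inter_subset_left) Metric.isOpen_ball)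
      (hsub.trans inter_subset_right)⟩
  choose! c hc using key
  have hdisj : (T.star z : Set (Finset (E d))).PairwiseDisjoint
      (fun s => Metric.ball (c s) (ρ / κ)) := by
    intro s hs t ht hst
    refine Set.disjoint_left.2 fun x hx hx' => hst ?_
    exact T.eq_of_mem_interior (T.mem_star.1 hs).1 (T.mem_star.1 ht).1 (hc s hs hx).1
      (interior_subset (hc t ht hx').1)
  have hsum : ∑ s ∈ T.star z, volume (Metric.ball (c s) (ρ / κ)) ≤
      volume (Metric.closedBall z ρ) := by
    rw [← measure_biUnion_finset hdisj fun _ _ => measurableSet_ball]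
    exact measure_mono (iUnion₂_subset fun s hs => (hc s hs).trans inter_subset_right)
  have hfin : volume (Metric.ball (0 : E d) 1) ≠ ⊤ := measure_ball_lt_top.ne
  have hpos : 0 < (volume (Metric.ball (0 : E d) 1)).toReal :=
    ENNReal.toReal_pos (Metric.measure_ball_pos _ _ one_pos).ne' hfin
  have hvol : ∀ s ∈ T.star z, volume (Metric.ball (c s) (ρ / κ)) =
      ENNReal.ofReal ((ρ / κ) ^ d) * volume (Metric.ball (0 : E d) 1) := fun s _ => by
    rw [Measure.addHaar_ball_of_pos volume _ (show 0 < ρ / κ by positivity), finrank_euclideanSpace,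
      Fintype.card_fin]
  rw [Finset.sum_congr rfl hvol, Measure.addHaar_closedBall volume _ hρpos.le, Finset.sum_const,
    nsmul_eq_mul, finrank_euclideanSpace, Fintype.card_fin] at hsum
  have h2 := ENNReal.toReal_mono (ENNReal.mul_ne_top ENNReal.ofReal_ne_top hfin) hsum
  rw [ENNReal.toReal_mul, ENNReal.toReal_mul, ENNReal.toReal_mul, ENNReal.toReal_natCast,
    ENNReal.toReal_ofReal (by positivity), ENNReal.toReal_ofReal (by positivity), ← mul_assoc] at h2
  have h3 := le_of_mul_le_mul_right h2 hpos
  rw [div_pow, mul_div_assoc', div_le_iff₀ (by positivity), mul_comm] at h3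
  exact le_of_mul_le_mul_left h3 (by positivity)

/-- The constant comparing the sizes of two simplices with a common point. -/
def sizeRatio (d : ℕ) (κ : ℝ) : ℝ := κ ^ ⌈κ ^ d⌉₊

theorem one_le_sizeRatio (hκ : 1 ≤ κ) : 1 ≤ sizeRatio d κ := one_le_pow₀ hκ

/-- Each passage through a common facet costs a factor `κ`, and a chain in the star has at most `κ ^
d` members. -/
theorem Triangulation.Regular.size_le_of_mem_star (hT : T.Regular κ) (hΩ : Convex ℝ (closure Ω))
    (hd : 2 ≤ d) (hκ : 1 ≤ κ) {z : E d} {s t : Finset (E d)} (hs : s ∈ T.star z)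
    (ht : t ∈ T.star z) : size t ≤ sizeRatio d κ * size s := by
  have hpos : 0 ≤ size s := Metric.diam_nonneg
  have h := forall_of_connected (T.star_connected hΩ z)
    (P := fun n t => size t ≤ κ ^ n * size s) ?_ ?_ hs (by simp) t ht
  · refine h.trans (mul_le_mul_of_nonneg_right (pow_le_pow_right₀ hκ ?_) hpos)
    exact_mod_cast (hT.card_star_le (by omega) (by linarith) z).trans (Nat.le_ceil _)
  · intro n a h
    refine h.trans (mul_le_mul_of_nonneg_right (pow_le_pow_right₀ hκ n.le_succ) hpos)
  · rintro n a ha b hb ⟨f, hfa, hfb, -⟩ h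
    calc size b ≤ κ * size a :=
          hT.size_le_of_facet (by linarith) hd (T.mem_star.1 hb).1 hfb hfa.1
      _ ≤ κ * (κ ^ n * size s) := by gcongr
      _ = _ := by ring

open Classical in
/-- The simplices having a vertex in common with `s`. -/
def Triangulation.patch (T : Triangulation Ω) (s : Finset (E d)) : Finset (Finset (E d)) :=
  T.cells.filter fun t => ∃ v ∈ s, v ∈ t

theorem Triangulation.mem_patch {s t : Finset (E d)} :
    t ∈ T.patch s ↔ t ∈ T.cells ∧ ∃ v ∈ s, v ∈ t := by
  simp [Triangulation.patch]

theorem Triangulation.mem_patch_comm {s t : Finset (E d)} (hs : s ∈ T.cells)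
    (h : t ∈ T.patch s) : s ∈ T.patch t := by
  obtain ⟨-, v, hvs, hvt⟩ := T.mem_patch.1 h
  exact T.mem_patch.2 ⟨hs, v, hvt, hvs⟩

theorem Triangulation.Regular.size_le_of_mem_patch (hT : T.Regular κ)
    (hΩ : Convex ℝ (closure Ω)) (hd : 2 ≤ d) (hκ : 1 ≤ κ) {s t : Finset (E d)}
    (hs : s ∈ T.cells) (ht : t ∈ T.patch s) : size t ≤ sizeRatio d κ * size s := by
  obtain ⟨ht, v, hvs, hvt⟩ := T.mem_patch.1 ht
  exact hT.size_le_of_mem_star hΩ hd hκ (z := v) (T.mem_star.2 ⟨hs, subset_hull hvs⟩)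
    (T.mem_star.2 ⟨ht, subset_hull hvt⟩)

theorem Triangulation.Regular.card_patch_le (hT : T.Regular κ) (hd : 1 ≤ d) (hκ : 0 < κ)
    {s : Finset (E d)} (hs : s ∈ T.cells) : ((T.patch s).card : ℝ) ≤ (d + 1) * κ ^ d := by
  classical
  have hsub : T.patch s ⊆ s.biUnion fun v => T.star v := by
    intro t ht
    obtain ⟨ht, v, hvs, hvt⟩ := T.mem_patch.1 ht
    exact Finset.mem_biUnion.2 ⟨v, hvs, T.mem_star.2 ⟨ht, subset_hull hvt⟩⟩
  calc ((T.patch s).card : ℝ) ≤ ((∑ v ∈ s, (T.star v).card : ℕ) : ℝ) := by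
        exact_mod_cast (Finset.card_le_card hsub).trans Finset.card_biUnion_le
    _ = ∑ v ∈ s, ((T.star v).card : ℝ) := by push_cast; rfl
    _ ≤ ∑ _v ∈ s, κ ^ d := Finset.sum_le_sum fun v _ => hT.card_star_le hd hκ v
    _ = _ := by rw [Finset.sum_const, T.card_cell s hs]; simp

theorem Triangulation.mem_patch_of_inter {s t : Finset (E d)} (hs : s ∈ T.cells)
    (ht : t ∈ T.cells) {x : E d} (hxs : x ∈ hull s) (hxt : x ∈ hull t) : t ∈ T.patch s := by
  have h := T.conforming s hs t ht ⟨hxs, hxt⟩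
  obtain ⟨v, hv⟩ : ((s : Set (E d)) ∩ t).Nonempty := convexHull_nonempty_iff.1 ⟨x, h⟩
  exact T.mem_patch.2 ⟨ht, v, hv.1, hv.2⟩

/-! ### Elements of a polytopal mesh -/

variable (M : PolyMesh Ω)

theorem Triangulation.mem_subcells {K : Set (E d)} {s : Finset (E d)} :
    s ∈ T.subcells K ↔ s ∈ T.cells ∧ hull s ⊆ K := by
  simp [Triangulation.subcells]

theorem PolyMesh.exists_subcell {K : Set (E d)} (hK : K ∈ M.elements) {x : E d} (hx : x ∈ K) :
    ∃ s ∈ M.sub.subcells K, x ∈ hull s := by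
  rw [M.element_eq K hK] at hx
  simpa only [mem_iUnion, exists_prop] using hx

theorem PolyMesh.subset_closure_interior {K : Set (E d)} (hK : K ∈ M.elements) :
    K ⊆ closure (interior K) := by
  intro x hx
  obtain ⟨s, hs, hxs⟩ := M.exists_subcell hK hx
  obtain ⟨hs, hsK⟩ := Triangulation.mem_subcells.1 hs
  rw [← (M.sub.isSimplex hs).closure_interior] at hxs
  exact closure_mono (interior_mono hsK) hxs

theorem PolyMesh.exists_element {s : Finset (E d)} (hs : s ∈ M.sub.cells) :
    ∃ K ∈ M.elements, s ∈ M.sub.subcells K := by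
  have hS := M.sub.isSimplex hs
  have h1 : centre s ∈ closure Ω := by
    rw [← M.sub.cover]; exact mem_biUnion hs (centre_mem_hull hS.nonempty)
  rw [← M.element_cover] at h1
  simp only [mem_iUnion] at h1
  obtain ⟨K, hK, hsK⟩ := h1
  obtain ⟨t, ht, hst⟩ := M.exists_subcell hK hsK
  obtain rfl := M.sub.eq_of_mem_interior hs (Triangulation.mem_subcells.1 ht).1
    hS.centre_mem_interior hst
  exact ⟨K, hK, ht⟩

theorem PolyMesh.element_unique {s : Finset (E d)} {K L : Set (E d)} (hK : K ∈ M.elements)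
    (hL : L ∈ M.elements) (hsK : s ∈ M.sub.subcells K) (hsL : s ∈ M.sub.subcells L) : K = L := by
  by_contra hne
  obtain ⟨hs, hsK⟩ := Triangulation.mem_subcells.1 hsK
  obtain ⟨-, hsL⟩ := Triangulation.mem_subcells.1 hsL
  have hc := (M.sub.isSimplex hs).centre_mem_interior
  exact Set.disjoint_left.1 (M.element_disjoint K hK L hL hne)
    (interior_mono hsK hc) (interior_mono hsL hc)

/-- An element lies between its connected interior and the closure of it, so it is not a disjoint
union of two nonempty closed sets. Contact in one point suffices, since simplices sharing a point
already have comparable sizes. -/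
theorem PolyMesh.subcells_connected {K : Set (E d)} (hK : K ∈ M.elements)
    (A : Finset (Finset (E d))) (hA : A ⊆ M.sub.subcells K) (hne : A.Nonempty)
    (hAS : A ≠ M.sub.subcells K) :
    ∃ a ∈ A, ∃ b ∈ M.sub.subcells K, b ∉ A ∧ ∃ x, x ∈ hull a ∧ x ∈ hull b := by
  classical
  obtain ⟨s, hsA⟩ := hne
  obtain ⟨t, ht, htA⟩ : ∃ t ∈ M.sub.subcells K, t ∉ A := by
    by_contra! h
    exact hAS (Finset.Subset.antisymm hA h)
  have hpre : IsPreconnected K := (M.element_connected K hK).isPreconnected.subset_closure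
    interior_subset (M.subset_closure_interior hK)
  have hcov : K ⊆ (⋃ a ∈ A, hull a) ∪ ⋃ b ∈ M.sub.subcells K \ A, hull b := by
    intro y hy
    obtain ⟨c, hc, hyc⟩ := M.exists_subcell hK hy
    by_cases hcA : c ∈ A
    · exact Or.inl (mem_biUnion hcA hyc)
    · exact Or.inr (mem_biUnion (Finset.mem_coe.2 (Finset.mem_sdiff.2 ⟨hc, hcA⟩)) hyc)
  have hin : ∀ s ∈ M.sub.subcells K, centre s ∈ hull s ∧ centre s ∈ K := fun s hs => by
    obtain ⟨hs, hsK⟩ := Triangulation.mem_subcells.1 hs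
    have := centre_mem_hull (M.sub.isSimplex hs).nonempty
    exact ⟨this, hsK this⟩
  obtain ⟨y, -, hy1, hy2⟩ := isPreconnected_closed_iff.1 hpre _ _
    (isClosed_biUnion_finset fun s _ => isClosed_hull s)
    (isClosed_biUnion_finset fun s _ => isClosed_hull s) hcov
    ⟨centre s, (hin s (hA hsA)).2, mem_biUnion (Finset.mem_coe.2 hsA) (hin s (hA hsA)).1⟩
    ⟨centre t, (hin t ht).2, mem_biUnion (Finset.mem_coe.2 (Finset.mem_sdiff.2 ⟨ht, htA⟩))
      (hin t ht).1⟩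
  simp only [mem_iUnion] at hy1 hy2
  obtain ⟨a, ha, hya⟩ := hy1
  obtain ⟨b, hb, hyb⟩ := hy2
  obtain ⟨hb, hbA⟩ := Finset.mem_sdiff.1 hb
  exact ⟨a, ha, b, hb, hbA, y, hya, hyb⟩

/-- The constant comparing the diameter of an element with the size of its simplices. -/
def elementRatio (d N : ℕ) (κ : ℝ) : ℝ := 2 * ((N + 1) * sizeRatio d κ ^ N)

theorem elementRatio_pos (N : ℕ) (hκ : 1 ≤ κ) : 0 < elementRatio d N κ := by
  have := one_le_sizeRatio (d := d) hκ
  unfold elementRatio; positivity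

theorem PolyMesh.diam_element_le {N : ℕ} (hN : ∀ K ∈ M.elements, (M.sub.subcells K).card ≤ N)
    (hT : M.sub.Regular κ) (hΩ : Convex ℝ (closure Ω)) (hd : 2 ≤ d) (hκ : 1 ≤ κ) {K : Set (E d)}
    (hK : K ∈ M.elements) {s : Finset (E d)} (hs : s ∈ M.sub.subcells K) :
    Metric.diam K ≤ elementRatio d N κ * size s := by
  set Λ := sizeRatio d κ with hΛ
  have hΛ1 : 1 ≤ Λ := one_le_sizeRatio hκ
  have hpos : 0 ≤ size s := Metric.diam_nonneg
  have h0 : centre s ∈ hull s :=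
    centre_mem_hull (M.sub.isSimplex (Triangulation.mem_subcells.1 hs).1).nonempty
  have hcell : ∀ {t}, t ∈ M.sub.subcells K → t ∈ M.sub.cells := fun h =>
    (Triangulation.mem_subcells.1 h).1
  -- After `n` contacts the size has grown by at most `Λ ^ n`, and the distance from the starting
  -- centroid by one simplex per contact. The factor 2 in `elementRatio` passes from this distance
  -- to the diameter.
  have h := forall_of_connected (M.subcells_connected hK)
    (P := fun n t => size t ≤ Λ ^ n * size s ∧
      ∀ x ∈ hull t, dist x (centre s) ≤ (n + 1) * (Λ ^ n * size s)) ?_ ?_ hs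
    ⟨by simp, fun x hx => by simpa using dist_le_size hx h0⟩
  · have hb : ∀ x ∈ K, dist x (centre s) ≤ (N + 1) * (Λ ^ N * size s) := by
      intro x hx
      obtain ⟨t, ht, hxt⟩ := M.exists_subcell hK hx
      refine ((h t ht).2 x hxt).trans ?_
      have := hN K hK
      gcongr
    refine Metric.diam_le_of_forall_dist_le (by unfold elementRatio; positivity) fun x hx y hy => ?_
    calc dist x y ≤ dist x (centre s) + dist y (centre s) := dist_triangle_right _ _ _
      _ ≤ (N + 1) * (Λ ^ N * size s) + (N + 1) * (Λ ^ N * size s) :=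
        add_le_add (hb x hx) (hb y hy)
      _ = _ := by rw [elementRatio]; ring
  · rintro n a ⟨h1, h2⟩
    have h3 : Λ ^ n * size s ≤ Λ ^ (n + 1) * size s := by gcongr; omega
    refine ⟨h1.trans h3, fun x hx => (h2 x hx).trans ?_⟩
    push_cast
    have h4 : (n : ℝ) + 1 ≤ n + 1 + 1 := by linarith
    gcongr
  · rintro n a ha b hb ⟨y, hya, hyb⟩ ⟨h1, h2⟩
    have h3 : size b ≤ Λ * size a := hT.size_le_of_mem_patch hΩ hd hκ (hcell ha)
      (M.sub.mem_patch_of_inter (hcell ha) (hcell hb) hya hyb)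
    have h4 : size b ≤ Λ ^ (n + 1) * size s := by
      calc size b ≤ Λ * (Λ ^ n * size s) := h3.trans (by gcongr)
        _ = _ := by ring
    refine ⟨h4, fun x hx => ?_⟩
    have h5 : Λ ^ n * size s ≤ Λ ^ (n + 1) * size s := by gcongr; omega
    calc dist x (centre s) ≤ dist x y + dist y (centre s) := dist_triangle _ _ _
      _ ≤ Λ ^ (n + 1) * size s + (n + 1) * (Λ ^ n * size s) :=
        add_le_add ((dist_le_size hx hyb).trans h4) (h2 y hya)
      _ ≤ Λ ^ (n + 1) * size s + (n + 1) * (Λ ^ (n + 1) * size s) := by gcongr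
      _ = _ := by push_cast; ring

end

section

/-! ### Facets and normals -/

theorem IsFacetOf.exists_apex {f s : Finset (E d)} (hs : IsSimplex s) (hf : IsFacetOf f s) :
    ∃ v ∈ s, v ∉ f ∧ ∀ w ∈ s, w ≠ v → w ∈ f := by
  classical
  have h1 : (s \ f).card = 1 := by
    rw [Finset.card_sdiff_of_subset hf.1, hs.card, hf.2]; omega
  obtain ⟨v, hv⟩ := Finset.card_eq_one.1 h1
  have hv' : v ∈ s \ f := by rw [hv]; simp
  rw [Finset.mem_sdiff] at hv'
  refine ⟨v, hv'.1, hv'.2, fun w hw hwv => ?_⟩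
  by_contra hwf
  have : w ∈ s \ f := Finset.mem_sdiff.2 ⟨hw, hwf⟩
  rw [hv, Finset.mem_singleton] at this
  exact hwv this

theorem IsFacetOf.nonempty (hd : 1 ≤ d) {f s : Finset (E d)} (hf : IsFacetOf f s) :
    f.Nonempty := by
  rw [← Finset.card_pos, hf.2]; omega

/-- A linear functional that is constant on the facet opposite to `v` is an affine function of the
barycentric coordinate of `v`. -/
theorem IsSimplex.linear_eq {s : Finset (E d)} (hs : IsSimplex s) {v : E d} (hv : v ∈ s)
    (L : E d →ₗ[ℝ] ℝ) {a : ℝ} (hL : ∀ w ∈ s, w ≠ v → L w = a) (x : E d) :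
    L x = a + bary s v x * (L v - a) := by
  classical
  have h := hs.affine_eq L.toAffineMap x
  simp only [LinearMap.coe_toAffineMap] at h
  have h2 : ∑ w ∈ s, bary s w x * (L w - a) = bary s v x * (L v - a) := by
    refine Finset.sum_eq_single_of_mem v hv fun w hw hwv => ?_
    rw [hL w hw hwv, sub_self, mul_zero]
  rw [← h2, h]
  simp only [mul_sub, Finset.sum_sub_distrib, ← Finset.sum_mul, hs.sum_bary, one_mul]
  ring

/-- The functional of `n` is constant on the facet, so it is a multiple of the apex coordinate. The
half-space condition fixes the sign, and `n ≠ 0` excludes the factor zero. -/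
theorem IsOuterNormal.inner_eq {s f : Finset (E d)} (hs : IsSimplex s) {v : E d} (hv : v ∈ s)
    (hfv : ∀ w ∈ s, w ≠ v → w ∈ f) {n x₀ : E d} (hx₀ : x₀ ∈ hull f) (hfs : f ⊆ s)
    (hn : IsOuterNormal (hull s) (hull f) n) :
    ∃ α > 0, ∀ x, inner ℝ n (x - x₀) = -α * bary s v x := by
  have h0 : ∀ w ∈ s, w ≠ v → inner ℝ n w = (inner ℝ n x₀ : ℝ) := by
    intro w hw hwv
    have hwf := subset_hull (hfv w hw hwv)
    have h1 := hn.2 x₀ hx₀ w (subset_hull hw)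
    have h2 := hn.2 w hwf x₀ (hull_mono hfs hx₀)
    rw [inner_sub_right] at h1 h2
    linarith
  have h1 := hs.linear_eq hv (innerSL ℝ n : E d →L[ℝ] ℝ).toLinearMap (a := inner ℝ n x₀)
    (fun w hw hwv => by simpa using h0 w hw hwv)
  simp only [ContinuousLinearMap.coe_coe, innerSL_apply_apply] at h1
  have hle : inner ℝ n (v - x₀) ≤ (0 : ℝ) := hn.2 x₀ hx₀ v (subset_hull hv)
  refine ⟨-(inner ℝ n v - inner ℝ n x₀), ?_, fun x => by rw [inner_sub_right, h1 x]; ring⟩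
  rw [inner_sub_right] at hle
  rcases hle.lt_or_eq with h | h
  · linarith
  · exfalso
    have h2 := h1 (x₀ + n)
    rw [h, mul_zero, add_zero, inner_add_right, real_inner_self_eq_norm_sq, hn.1] at h2
    norm_num at h2

theorem eq_smul_of_inner {n n' x₀ : E d} {a : ℝ} (h : ∀ x, inner ℝ n (x - x₀) =
    a * inner ℝ n' (x - x₀)) : n = a • n' := by
  refine ext_inner_right ℝ fun y => ?_
  have := h (x₀ + y)
  rw [add_sub_cancel_left] at this
  rw [this, inner_smul_left]; simp

/-- Both vectors are positive multiples of the same direction, the negative gradient of the apex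
coordinate, and both have length one. -/
theorem IsOuterNormal.unique {s f : Finset (E d)} (hd : 1 ≤ d) (hs : IsSimplex s)
    (hf : IsFacetOf f s) {n n' : E d} (hn : IsOuterNormal (hull s) (hull f) n)
    (hn' : IsOuterNormal (hull s) (hull f) n') : n = n' := by
  obtain ⟨v, hv, -, hfv⟩ := hf.exists_apex hs
  obtain ⟨x₀, hx₀⟩ : (hull f).Nonempty := ⟨_, centre_mem_hull (hf.nonempty hd)⟩
  obtain ⟨α, hα, h⟩ := hn.inner_eq hs hv hfv hx₀ hf.1
  obtain ⟨α', hα', h'⟩ := hn'.inner_eq hs hv hfv hx₀ hf.1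
  have h1 : n = (α / α') • n' := eq_smul_of_inner (x₀ := x₀) fun x => by
    rw [h, h']; field_simp
  have h2 : α / α' = 1 := by
    have := congrArg norm h1
    rw [norm_smul, hn.1, hn'.1, Real.norm_of_nonneg (by positivity)] at this
    linarith
  rw [h1, h2, one_smul]

variable {Ω : Set (E d)} {T : Triangulation Ω}

/-- Otherwise the coordinate would vanish at all vertices of `t`, hence everywhere, although it is 1
at `v`. -/
theorem Triangulation.bary_apex_ne_zero {s t f : Finset (E d)} (hs : s ∈ T.cells)
    (ht : t ∈ T.cells) (hfs : f ⊆ s) {v w : E d} (hv : v ∈ s) (hvf : v ∉ f)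
    (hwf : ∀ u ∈ t, u ≠ w → u ∈ f) : bary s v w ≠ 0 := by
  intro h0
  have h := (T.isSimplex ht).affine_eq (bary s v) v
  rw [(T.isSimplex hs).bary_self hv] at h
  refine one_ne_zero (h.trans (Finset.sum_eq_zero fun u hu => ?_))
  rcases eq_or_ne u w with rfl | huw
  · rw [h0, mul_zero]
  · rw [(T.isSimplex hs).bary_ne (hfs (hwf u hu huw)) (by rintro rfl; exact hvf (hwf _ hu huw)),
      mul_zero]

/-- Two different simplices with a common facet lie on opposite sides of it. -/
theorem Triangulation.bary_apex_neg {s t f : Finset (E d)} (hd : 1 ≤ d) (hs : s ∈ T.cells)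
    (ht : t ∈ T.cells) (hst : s ≠ t) (hfs : IsFacetOf f s) (hft : IsFacetOf f t)
    {v w : E d} (hv : v ∈ s) (hvf : v ∉ f) (hfv : ∀ u ∈ s, u ≠ v → u ∈ f)
    (hw : w ∈ t) (hwf : w ∉ f) (hfw : ∀ u ∈ t, u ≠ w → u ∈ f) : bary s v w < 0 := by
  have hS := T.isSimplex hs
  have hT := T.isSimplex ht
  by_contra! h0
  have hpos : 0 < bary s v w := lt_of_le_of_ne h0
    (T.bary_apex_ne_zero hs ht hfs.1 hv hvf hfw).symm
  set z := centre f
  have hz : z ∈ hull f := centre_mem_hull (hfs.nonempty hd)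
  have hlm : ∀ (u' : Finset (E d)) (u : E d) (ε : ℝ), bary u' u (AffineMap.lineMap z w ε) =
      (1 - ε) * bary u' u z + ε * bary u' u w := by
    intro u' u ε
    rw [AffineMap.apply_lineMap, AffineMap.lineMap_apply]
    simp; ring
  -- Close to the centroid of `f`, on the way to `w`, the coordinates of the vertices of `f` stay
  -- positive. With a positive apex coordinate such a point would lie in both simplices, and its
  -- positive coordinate at `w` would make `w` a vertex of `s`.
  have hev : ∀ᶠ ε : ℝ in nhdsWithin 0 (Ioi 0), ∀ u ∈ f,
      0 < bary s u (AffineMap.lineMap z w ε) := by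
    rw [Filter.eventually_all_finset]
    intro u hu
    have hcont : Continuous fun ε : ℝ => bary s u (AffineMap.lineMap z w ε) := by
      simp only [hlm]; fun_prop
    have h1 : 0 < bary s u (AffineMap.lineMap z w (0 : ℝ)) := by
      rw [AffineMap.lineMap_apply_zero]; exact hS.bary_centre_pos hfs.1 hu
    exact (hcont.continuousAt.eventually (lt_mem_nhds h1)).filter_mono nhdsWithin_le_nhds
  have hev2 : ∀ᶠ ε : ℝ in nhdsWithin 0 (Ioi 0), ε ∈ Ioo (0 : ℝ) 1 :=
    Ioo_mem_nhdsGT one_pos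
  obtain ⟨ε, hε, hε0, hε1⟩ := (hev.and hev2).exists
  set x := AffineMap.lineMap z w ε
  have hxt : x ∈ hull t := by
    refine (convex_hull t).segment_subset (hull_mono hft.1 hz) (subset_hull hw) ?_
    rw [segment_eq_image_lineMap]
    exact ⟨ε, ⟨hε0.le, hε1.le⟩, rfl⟩
  have hvz : bary s v z = 0 := ((hS.mem_hull_subset_iff hfs.1).1 hz).2 v hvf
  have hxs : x ∈ hull s := by
    rw [hS.mem_hull_iff]
    intro u
    by_cases hu : u ∈ s
    · rcases eq_or_ne u v with rfl | huv
      · rw [hlm, hvz]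
        have := mul_pos hε0 hpos
        linarith
      · exact (hε u (hfv u hu huv)).le
    · rw [bary_of_notMem hu]
  have hwz : bary t w z = 0 := ((hT.mem_hull_subset_iff hft.1).1 hz).2 w hwf
  have hws : w ∈ s := by
    refine T.mem_of_bary_pos ht hs hxt hxs ?_
    rw [hlm, hwz, hT.bary_self hw]
    linarith
  refine hst (T.eq_of_subset ht hs fun u hu => ?_).symm
  rcases eq_or_ne u w with rfl | huw
  · exact hws
  · exact hfs.1 (hfw u hu huw)

/-- At most two simplices share a facet. -/
theorem Triangulation.eq_or_eq_of_facet {s t u f : Finset (E d)} (hd : 1 ≤ d) (hs : s ∈ T.cells)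
    (ht : t ∈ T.cells) (hu : u ∈ T.cells) (hst : s ≠ t) (hfs : IsFacetOf f s)
    (hft : IsFacetOf f t) (hfu : IsFacetOf f u) : u = s ∨ u = t := by
  by_contra! hne
  obtain ⟨v, hv, hvf, hfv⟩ := hfs.exists_apex (T.isSimplex hs)
  obtain ⟨w, hw, hwf, hfw⟩ := hft.exists_apex (T.isSimplex ht)
  obtain ⟨y, hy, hyf, hfy⟩ := hfu.exists_apex (T.isSimplex hu)
  have h1 := T.bary_apex_neg hd hs ht hst hfs hft hv hvf hfv hw hwf hfw
  have h2 := T.bary_apex_neg hd hs hu hne.1.symm hfs hfu hv hvf hfv hy hyf hfy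
  have h3 := T.bary_apex_neg hd ht hu hne.2.symm hft hfu hw hwf hfw hy hyf hfy
  -- As functions, `bary s v` is `bary t w` times its value at `w`. At `y` this is a product of two
  -- negative numbers, while `h2` makes it negative.
  have h4 := (T.isSimplex ht).affine_eq (bary s v) y
  rw [Finset.sum_eq_single_of_mem w hw fun u hu huw => by
    rw [(T.isSimplex hs).bary_ne (hfs.1 (hfw u hu huw))
      (by rintro rfl; exact hvf (hfw _ hu huw)), mul_zero]] at h4
  nlinarith [mul_pos_of_neg_of_neg h3 h1]

theorem inner_le_of_mem_closure {Ω : Set (E d)} {φ : E d →L[ℝ] ℝ} {a : ℝ} (h : ∀ y ∈ Ω, φ y < a)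
    {x : E d} (hx : x ∈ closure Ω) : φ x ≤ a :=
  closure_minimal (fun y hy => (h y hy).le) (isClosed_le φ.continuous continuous_const) hx

theorem Triangulation.hull_subset (T : Triangulation Ω) {s : Finset (E d)} (hs : s ∈ T.cells) :
    hull s ⊆ closure Ω := by
  rw [← T.cover]; exact subset_biUnion_of_mem (u := fun s => hull s) hs

/-- A facet on the boundary belongs to one simplex only. -/
theorem Triangulation.eq_of_boundary_facet {s t f : Finset (E d)} (hd : 1 ≤ d) (hΩc : Convex ℝ Ω)
    (hΩo : IsOpen Ω) (hΩn : Ω.Nonempty) (hs : s ∈ T.cells) (ht : t ∈ T.cells)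
    (hfs : IsFacetOf f s) (hft : IsFacetOf f t) (hf : hull f ⊆ frontier Ω) : s = t := by
  by_contra hst
  obtain ⟨v, hv, hvf, hfv⟩ := hfs.exists_apex (T.isSimplex hs)
  obtain ⟨w, hw, hwf, hfw⟩ := hft.exists_apex (T.isSimplex ht)
  have hneg := T.bary_apex_neg hd hs ht hst hfs hft hv hvf hfv hw hwf hfw
  have hz : centre f ∈ hull f := centre_mem_hull (hfs.nonempty hd)
  have hzΩ : centre f ∉ Ω := by
    have := hf hz
    rw [hΩo.frontier_eq] at this
    exact this.2
  obtain ⟨φ, hφ⟩ := geometric_hahn_banach_open_point hΩc hΩo hzΩ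
  set a := φ (centre f) with ha
  have hle : ∀ {s}, s ∈ T.cells → ∀ u ∈ s, φ u ≤ a := fun hs u hu =>
    inner_le_of_mem_closure hφ (T.hull_subset hs (subset_hull hu))
  -- No vertex exceeds the supporting value `a`, and the vertices of `f` average to it.
  have hfa : ∀ u ∈ f, φ u = a := by
    have hcard : 0 < (f.card : ℝ) := by exact_mod_cast Finset.card_pos.2 (hfs.nonempty hd)
    have hsum : ∑ u ∈ f, (a - φ u) = 0 := by
      rw [Finset.sum_sub_distrib, ha, centre, map_sum]
      simp only [map_smul, smul_eq_mul, ← Finset.mul_sum, Finset.sum_const, nsmul_eq_mul]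
      field_simp; ring
    intro u hu
    have := (Finset.sum_eq_zero_iff_of_nonneg fun u hu =>
      sub_nonneg.2 (hle hs u (hfs.1 hu))).1 hsum u hu
    linarith
  -- If the apex also had the value `a`, the functional would be constant, against strictness in
  -- `Ω`.
  have hlt : ∀ {s : Finset (E d)} {v}, s ∈ T.cells → v ∈ s → (∀ u ∈ s, u ≠ v → u ∈ f) →
      φ v < a := by
    intro s v hs hv hfv
    refine lt_of_le_of_ne (hle hs v hv) fun h => ?_
    obtain ⟨y, hy⟩ := hΩn
    have h1 := (T.isSimplex hs).linear_eq hv φ.toLinearMap (a := a)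
      (fun u hu huv => hfa u (hfv u hu huv)) y
    simp only [ContinuousLinearMap.coe_coe] at h1
    rw [h, sub_self, mul_zero, add_zero] at h1
    exact (hφ y hy).ne h1
  -- Here `w` has a negative coordinate in `s`, so the functional would exceed `a` at `w`.
  have h1 := (T.isSimplex hs).linear_eq hv φ.toLinearMap (a := a)
      (fun u hu huv => hfa u (hfv u hu huv)) w
  simp only [ContinuousLinearMap.coe_coe] at h1
  nlinarith [hlt hs hv hfv, hlt ht hw hfw]

/-! ### Jumps and tangential traces -/

theorem PolyMesh.exists_subcell_facet (M : PolyMesh Ω) (hd : 1 ≤ d) {f s : Finset (E d)}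
    (hs : s ∈ M.sub.cells) (hfs : IsFacetOf f s) {L : Set (E d)} (hL : L ∈ M.elements)
    (hf : hull f ⊆ L) : ∃ t ∈ M.sub.subcells L, IsFacetOf f t := by
  obtain ⟨t, ht, hft⟩ := M.exists_subcell hL (hf (centre_mem_hull (hfs.nonempty hd)))
  exact ⟨t, ht, M.sub.subset_of_centre_mem hs (Triangulation.mem_subcells.1 ht).1 hfs.1 hft, hfs.2⟩

theorem PolyMesh.normal_spec {M : PolyMesh Ω} {K e : Set (E d)}
    (h : ∃ n, M.sub.IsElementNormal K e n) : M.sub.IsElementNormal K e (M.normal K e) := by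
  rw [PolyMesh.normal, dif_pos h]; exact h.choose_spec

theorem PolyMesh.mem_adj {M : PolyMesh Ω} {e K : Set (E d)} :
    K ∈ M.adj e ↔ K ∈ M.elements ∧ e ⊆ K := by
  simp [PolyMesh.adj]

theorem sum_sq_eq_one {n : E d} (hn : ‖n‖ = 1) : ∑ i, n i ^ 2 = 1 := by
  have := EuclideanSpace.norm_sq_eq n
  rw [hn] at this
  simpa using this.symm

theorem tensorNormSq_tensorCols {n : E d} (hn : ‖n‖ = 1) (τ : Matrix (Fin d) (Fin d) ℝ) :
    tensorNormSq (tensorCols n τ) = ∑ i, ∑ j, τ i j ^ 2 := by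
  simp only [tensorNormSq, tensorCols, mul_pow]
  rw [Finset.sum_comm (γ := Fin d) (f := fun i j => τ i j ^ 2)]
  refine Finset.sum_congr rfl fun c _ => ?_
  simp only [← Finset.mul_sum, ← Finset.sum_mul, sum_sq_eq_one hn, one_mul]

/-- On an interior face, the norm of the jump is the norm of the difference of the two traces. -/
theorem PolyMesh.tensorJump_eq (M : PolyMesh Ω) (hd : 1 ≤ d) {s t f : Finset (E d)}
    {K L e : Set (E d)} (hK : K ∈ M.elements) (hL : L ∈ M.elements) (hKL : K ≠ L)
    (hs : s ∈ M.sub.subcells K) (ht : t ∈ M.sub.subcells L) (hfs : IsFacetOf f s)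
    (hft : IsFacetOf f t) (he : e ∈ M.intFaces) (hfe : hull f ⊆ e)
    (W : E d → Matrix (Fin d) (Fin d) ℝ) (x : E d) : e ⊆ K ∧ e ⊆ L ∧
    tensorNormSq (M.tensorJump W e x) =
      ∑ i, ∑ j, (traceFrom K W x i j - traceFrom L W x i j) ^ 2 := by
  classical
  have hs' := (Triangulation.mem_subcells.1 hs).1
  have ht' := (Triangulation.mem_subcells.1 ht).1
  have hst : s ≠ t := by rintro rfl; exact hKL (M.element_unique hK hL hs ht)
  -- Any element containing `e` has a simplex with facet `f`, and only `s` and `t` have this facet.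
  have honly : ∀ K' ∈ M.elements, e ⊆ K' → K' = K ∨ K' = L := by
    intro K' hK' heK'
    obtain ⟨u, hu, hfu⟩ := M.exists_subcell_facet hd hs' hfs hK' (hfe.trans heK')
    rcases M.sub.eq_or_eq_of_facet hd hs' ht' (Triangulation.mem_subcells.1 hu).1 hst hfs hft hfu
      with rfl | rfl
    · exact Or.inl (M.element_unique hK' hK hu hs)
    · exact Or.inr (M.element_unique hK' hL hu ht)
  have hpair : e ⊆ K ∧ e ⊆ L ∧ (∃ n, M.sub.IsElementNormal K e n) ∧
      ∃ n, M.sub.IsElementNormal L e n := by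
    obtain ⟨K', hK', L', hL', hne, hsub, n, hn, hn'⟩ := M.intFace e he
    have h1 := hsub.trans inter_subset_left
    have h2 := hsub.trans inter_subset_right
    rcases honly K' hK' h1 with rfl | rfl <;> rcases honly L' hL' h2 with rfl | rfl
    · exact absurd rfl hne
    · exact ⟨h1, h2, ⟨n, hn⟩, ⟨-n, hn'⟩⟩
    · exact ⟨h2, h1, ⟨-n, hn'⟩, ⟨n, hn⟩⟩
    · exact absurd rfl hne
  obtain ⟨heK, heL, hnK, hnL⟩ := hpair
  have hadj : M.adj e = {K, L} := by
    ext K'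
    rw [PolyMesh.mem_adj, Finset.mem_insert, Finset.mem_singleton]
    constructor
    · rintro ⟨h1, h2⟩; exact honly K' h1 h2
    · rintro (rfl | rfl)
      · exact ⟨hK, heK⟩
      · exact ⟨hL, heL⟩
  have hnK' := PolyMesh.normal_spec hnK
  have hnL' := PolyMesh.normal_spec hnL
  -- The two normals are chosen independently. Expressed by the apex coordinates at `f`, which
  -- differ by a negative factor, they are negative multiples of each other with equal length.
  have hneg : M.normal L e = -M.normal K e := by
    obtain ⟨v, hv, hvf, hfv⟩ := hfs.exists_apex (M.sub.isSimplex hs')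
    obtain ⟨w, hw, hwf, hfw⟩ := hft.exists_apex (M.sub.isSimplex ht')
    have hlt := M.sub.bary_apex_neg hd hs' ht' hst hfs hft hv hvf hfv hw hwf hfw
    have hx₀ := centre_mem_hull (hfs.nonempty hd)
    obtain ⟨α, hα, h1⟩ := (hnK'.2.2 s hs f hfs hfe).inner_eq (M.sub.isSimplex hs') hv hfv hx₀ hfs.1
    obtain ⟨β, hβ, h2⟩ := (hnL'.2.2 t ht f hft hfe).inner_eq (M.sub.isSimplex ht') hw hfw hx₀ hft.1
    have h3 : ∀ y, bary s v y = bary t w y * bary s v w := by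
      intro y
      have h4 := (M.sub.isSimplex ht').affine_eq (bary s v) y
      rwa [Finset.sum_eq_single_of_mem w hw fun u hu huw => by
        rw [(M.sub.isSimplex hs').bary_ne (hfs.1 (hfw u hu huw))
          (by rintro rfl; exact hvf (hfw _ hu huw)), mul_zero]] at h4
    have h5 : M.normal L e = (β / (α * bary s v w)) • M.normal K e :=
      eq_smul_of_inner (x₀ := centre f) fun y => by
        have := hlt.ne
        rw [h1, h2, h3 y]; field_simp
    have h6 : β / (α * bary s v w) < 0 :=
      div_neg_of_pos_of_neg hβ (mul_neg_of_pos_of_neg hα hlt)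
    have h7 := congrArg norm h5
    rw [norm_smul, hnK'.1, hnL'.1, Real.norm_of_nonpos h6.le] at h7
    rw [h5, show β / (α * bary s v w) = -1 by linarith, neg_one_smul]
  refine ⟨heK, heL, ?_⟩
  rw [PolyMesh.tensorJump, hadj, Finset.sum_pair hKL, hneg]
  have : tensorCols (M.normal K e) (traceFrom K W x) + tensorCols (-M.normal K e) (traceFrom L W x)
      = tensorCols (M.normal K e) (traceFrom K W x - traceFrom L W x) := by
    funext c i j
    simp [tensorCols]; ring
  rw [this, tensorNormSq_tensorCols hnK'.1]
  simp

/-- On a boundary face, the tangential trace is `n × W` with `W` taken from the only element that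
contains the face. -/
theorem PolyMesh.tangentialTrace_eq (M : PolyMesh Ω) (hd : 1 ≤ d) (hΩc : Convex ℝ Ω)
    (hΩo : IsOpen Ω) (hΩn : Ω.Nonempty) {s f : Finset (E d)}
    {K e : Set (E d)} (hK : K ∈ M.elements) (hs : s ∈ M.sub.subcells K) (hfs : IsFacetOf f s)
    (he : e ∈ M.bdFaces) (hfe : hull f ⊆ e)
    (W : E d → Matrix (Fin d) (Fin d) ℝ) : e ⊆ K ∧
      ∃ n, IsOuterNormal (hull s) (hull f) n ∧
        ∀ x, M.tangentialTrace W e x = crossCols n (traceFrom K W x) := by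
  classical
  have hs' := (Triangulation.mem_subcells.1 hs).1
  obtain ⟨hfr, K₀, hK₀, heK₀, hn⟩ := M.bdFace e he
  have honly : ∀ K' ∈ M.elements, e ⊆ K' → K' = K := by
    intro K' hK' heK'
    obtain ⟨u, hu, hfu⟩ := M.exists_subcell_facet hd hs' hfs hK' (hfe.trans heK')
    obtain rfl := M.sub.eq_of_boundary_facet hd hΩc hΩo hΩn hs'
      (Triangulation.mem_subcells.1 hu).1 hfs hfu (hfe.trans hfr)
    exact M.element_unique hK' hK hu hs
  obtain rfl := honly K₀ hK₀ heK₀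
  have hadj : M.adj e = {K₀} := by
    ext K'
    rw [PolyMesh.mem_adj, Finset.mem_singleton]
    constructor
    · rintro ⟨h1, h2⟩; exact honly K' h1 h2
    · rintro rfl; exact ⟨hK, heK₀⟩
  refine ⟨heK₀, M.normal K₀ e, (PolyMesh.normal_spec hn).2.2 s hs f hfs hfe, fun x => ?_⟩
  rw [PolyMesh.tangentialTrace, hadj, Finset.sum_singleton]

end

section

/-! ### Convex polytopes have finitely many facet normals -/

theorem IsOuterNormal.mono {A B e : Set (E d)} {n : E d} (hn : IsOuterNormal A e n)
    (h : B ⊆ closure A) : IsOuterNormal B e n := by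
  refine ⟨hn.1, fun x hx y hy => ?_⟩
  exact closure_minimal (t := {y | inner ℝ n (y - x) ≤ 0}) (fun y hy => hn.2 x hx y hy)
    (isClosed_le (by fun_prop) continuous_const) (h hy)

/-- The unit outer normals of `Ω` along `(d-1)`-dimensional simplices. -/
def facetNormals (Ω : Set (E d)) : Set (E d) :=
  {n | ∃ f s : Finset (E d), IsSimplex s ∧ IsFacetOf f s ∧ hull s ⊆ closure Ω ∧
    IsOuterNormal Ω (hull f) n}

variable {Ω : Set (E d)}

theorem IsConvexPolytopeDomain.convex (hΩ : IsConvexPolytopeDomain Ω) : Convex ℝ Ω := by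
  obtain ⟨-, F, rfl⟩ := hΩ
  exact (convex_convexHull ℝ _).interior

theorem IsConvexPolytopeDomain.isOpen (hΩ : IsConvexPolytopeDomain Ω) : IsOpen Ω := by
  obtain ⟨-, F, rfl⟩ := hΩ
  exact isOpen_interior

theorem IsConvexPolytopeDomain.exists_closure_eq (hΩ : IsConvexPolytopeDomain Ω) :
    ∃ F : Finset (E d), closure Ω = hull F := by
  obtain ⟨hne, F, rfl⟩ := hΩ
  exact ⟨F, ((convex_hull F).closure_interior_eq_closure_of_nonempty_interior hne).trans
    (isClosed_hull F).closure_eq⟩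

/-- A facet normal is determined by the set of generating points of the polytope at which its
functional is maximal, and there are only finitely many such sets. -/
theorem finite_facetNormals (hd : 1 ≤ d) (hΩ : IsConvexPolytopeDomain Ω) :
    (facetNormals Ω).Finite := by
  classical
  obtain ⟨F, hF⟩ := hΩ.exists_closure_eq
  have hFc : ∀ z ∈ F, z ∈ closure Ω := fun z hz => by rw [hF]; exact subset_hull hz
  set G : E d → Finset (E d) := fun n =>
    F.filter fun y => ∀ z ∈ F, (inner ℝ n z : ℝ) ≤ inner ℝ n y with hG
  refine Set.Finite.of_injOn (f := G) (t := (F.powerset : Set (Finset (E d)))) ?_ ?_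
    (Finset.finite_toSet _)
  · intro n _
    exact Finset.mem_coe.2 (Finset.mem_powerset.2 (Finset.filter_subset _ _))
  rintro n ⟨f, s, hs, hfs, hsΩ, hn⟩ n' hn'' hGn
  have hn' : ‖n'‖ = 1 := by
    obtain ⟨_, _, -, -, -, h⟩ := hn''
    exact h.1
  have hnc : IsOuterNormal (closure Ω) (hull f) n := hn.mono subset_rfl
  refine IsOuterNormal.unique hd hs hfs (hn.mono hsΩ) ⟨hn', fun x hx y hy => ?_⟩
  have hxF : x ∈ hull F := by rw [← hF]; exact hsΩ (hull_mono hfs.1 hx)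
  obtain ⟨w, hw0, hw1, hwx⟩ := mem_hull_iff.1 hxF
  have hle : ∀ z ∈ F, inner ℝ n z ≤ (inner ℝ n x : ℝ) := fun z hz => by
    have := hnc.2 x hx z (hFc z hz)
    rw [inner_sub_right] at this; linarith
  have hinner : ∀ m : E d, (inner ℝ m x : ℝ) = ∑ z ∈ F, w z * inner ℝ m z := by
    intro m
    rw [← hwx, inner_sum]
    simp [inner_smul_right]
  -- The point `x` of the facet attains the maximum of `n`, so its convex weights sit on maximising
  -- points only.
  have hzero : ∀ z ∈ F, w z * (inner ℝ n x - inner ℝ n z) = 0 := by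
    refine (Finset.sum_eq_zero_iff_of_nonneg fun z hz =>
      mul_nonneg (hw0 z hz) (sub_nonneg.2 (hle z hz))).1 ?_
    simp only [mul_sub, Finset.sum_sub_distrib, ← Finset.sum_mul, hw1, ← hinner]
    ring
  -- The same points maximise `n'`, so `n'` is also maximal at `x` and is an outer normal along `f`.
  have hmax : ∀ z ∈ F, (inner ℝ n' z : ℝ) ≤ inner ℝ n' x := by
    intro z hz
    rw [hinner n']
    calc (inner ℝ n' z : ℝ) = ∑ u ∈ F, w u * inner ℝ n' z := by
          rw [← Finset.sum_mul, hw1, one_mul]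
      _ ≤ _ := Finset.sum_le_sum fun u hu => by
          rcases mul_eq_zero.1 (hzero u hu) with h | h
          · simp [h]
          · have hu' : u ∈ G n := by
              rw [hG, Finset.mem_filter]
              refine ⟨hu, fun z hz => ?_⟩
              have := hle z hz
              linarith
            rw [hGn, hG, Finset.mem_filter] at hu'
            exact mul_le_mul_of_nonneg_left (hu'.2 z hz) (hw0 u hu)
  have hy' : y ∈ hull F := by rw [← hF]; exact hsΩ hy
  have hsub : hull F ⊆ {y | (inner ℝ n' y : ℝ) ≤ inner ℝ n' x} :=
    convexHull_min hmax (convex_halfSpace_le (innerSL ℝ n').toLinearMap.isLinear _)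
  have := hsub hy'
  rw [mem_ofPred_eq] at this
  rw [inner_sub_right]; linarith

/-- If all cross terms vanish, `n` is its own projection onto the line of `n'`, hence equal to `n'`
or `-n'`. -/
theorem exists_cross_ne_zero {n n' : E d} (hn : ‖n‖ = 1) (hn' : ‖n'‖ = 1) (h1 : n ≠ n')
    (h2 : n ≠ -n') : ∃ i j, n' i * n j - n' j * n i ≠ 0 := by
  by_contra! h
  have h3 : n = (inner ℝ n' n : ℝ) • n' := by
    ext j
    have h4 : n j = ∑ i, n' i ^ 2 * n j := by rw [← Finset.sum_mul, sum_sq_eq_one hn', one_mul]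
    rw [h4, PiLp.smul_apply, PiLp.inner_apply, smul_eq_mul, Finset.sum_mul]
    refine Finset.sum_congr rfl fun i _ => ?_
    have := h i j
    simp only [RCLike.inner_apply, conj_trivial]
    linear_combination n' i * this
  have h5 := congrArg norm h3
  rw [norm_smul, hn, hn', mul_one, Real.norm_eq_abs] at h5
  rcases eq_or_eq_neg_of_abs_eq h5.symm with h6 | h6
  · rw [h6, one_smul] at h3; exact h1 h3
  · rw [h6, neg_one_smul] at h3; exact h2 h3

/-- The angle between the normals of different facets is bounded away from `0` and `π`. -/
theorem exists_angle_bound (hd : 1 ≤ d) (hΩ : IsConvexPolytopeDomain Ω) :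
    ∃ δ > 0, ∀ n ∈ facetNormals Ω, ∀ n' ∈ facetNormals Ω, n ≠ n' → n ≠ -n' →
      ∃ i j, δ ≤ |n' i * n j - n' j * n i| := by
  have hfin := finite_facetNormals hd hΩ
  have hnorm : ∀ n ∈ facetNormals Ω, ‖n‖ = 1 := by
    rintro n ⟨_, _, -, -, -, h⟩; exact h.1
  -- Each of the finitely many pairs admits all sufficiently small `δ`.
  have hev : ∀ᶠ δ : ℝ in nhdsWithin 0 (Ioi 0), ∀ n ∈ facetNormals Ω, ∀ n' ∈ facetNormals Ω,
      n ≠ n' → n ≠ -n' → ∃ i j, δ ≤ |n' i * n j - n' j * n i| := by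
    rw [Filter.eventually_all_finite hfin]
    intro n hn
    rw [Filter.eventually_all_finite hfin]
    intro n' hn'
    by_cases h : n ≠ n' ∧ n ≠ -n'
    · obtain ⟨i, j, hij⟩ := exists_cross_ne_zero (hnorm n hn) (hnorm n' hn') h.1 h.2
      filter_upwards [Ioo_mem_nhdsGT (abs_pos.2 hij)] with δ hδ _ _
      exact ⟨i, j, hδ.2.le⟩
    · exact Filter.Eventually.of_forall fun δ h1 h2 => absurd ⟨h1, h2⟩ h
  obtain ⟨δ, h1, h2⟩ := (hev.and self_mem_nhdsWithin).exists
  exact ⟨δ, h2, h1⟩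

/-- Opposite normals at a common point would confine the nonempty open set to a hyperplane. -/
theorem IsOuterNormal.ne_neg {e e' : Set (E d)} (hΩo : IsOpen Ω) (hΩn : Ω.Nonempty) {n n' : E d}
    (hn : IsOuterNormal Ω e n) (hn' : IsOuterNormal Ω e' n') {x : E d} (hx : x ∈ e) (hx' : x ∈ e') :
    n ≠ -n' := by
  rintro rfl
  obtain ⟨y, hy⟩ := hΩn
  have h0 : ∀ y ∈ Ω, (inner ℝ n' (y - x) : ℝ) = 0 := by
    intro y hy
    have h1 := hn.2 x hx y hy
    have h2 := hn'.2 x hx' y hy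
    rw [inner_neg_left] at h1
    linarith
  obtain ⟨r, hr, hball⟩ := Metric.isOpen_iff.1 hΩo y hy
  have h1 : y + (r / 2) • n' ∈ Ω := hball (by
    rw [Metric.mem_ball, dist_eq_norm, add_sub_cancel_left, norm_smul, hn'.1,
      Real.norm_of_nonneg (by positivity)]
    linarith)
  have h2 := h0 _ h1
  rw [add_sub_right_comm, inner_add_right, h0 y hy, inner_smul_right, real_inner_self_eq_norm_sq,
    hn'.1] at h2
  linarith

/-! ### Vectors controlled by their tangential components -/

/-- The normal part of a vector along a unit vector `n` approximates it up to its tangential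
components. -/
theorem abs_sub_normal_part_le {n : E d} (hn : ‖n‖ = 1) {q : Fin d → ℝ} {δ : ℝ}
    (h : ∀ i j, |n i * q j - n j * q i| ≤ δ) (j : Fin d) :
    |q j - n j * ∑ i, n i * q i| ≤ d * δ := by
  -- Uses that the squares of the components of `n` sum to 1.
  have h1 : q j - n j * ∑ i, n i * q i = ∑ i, n i * (n i * q j - n j * q i) := by
    have : q j = ∑ i, n i ^ 2 * q j := by rw [← Finset.sum_mul, sum_sq_eq_one hn, one_mul]
    conv_lhs => rw [this, Finset.mul_sum]
    rw [← Finset.sum_sub_distrib]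
    exact Finset.sum_congr rfl fun i _ => by ring
  have h2 : ∀ i, |n i| ≤ 1 := fun i => by
    have := PiLp.norm_apply_le n i
    rwa [hn] at this
  rw [h1]
  calc |∑ i, n i * (n i * q j - n j * q i)| ≤ ∑ i, |n i * (n i * q j - n j * q i)| :=
        Finset.abs_sum_le_sum_abs _ _
    _ ≤ ∑ _i : Fin d, δ := Finset.sum_le_sum fun i _ => by
        rw [abs_mul]
        calc _ ≤ 1 * |n i * q j - n j * q i| := by gcongr; exact h2 i
          _ ≤ δ := by rw [one_mul]; exact h i j
    _ = d * δ := by simp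

/-- A vector whose tangential components with respect to two independent unit vectors are small is
small. -/
theorem abs_le_of_two_normals {n n' : E d} (hn : ‖n‖ = 1) (hn' : ‖n'‖ = 1) {q : Fin d → ℝ}
    {δ η : ℝ} (hη : 0 < η) (h : ∀ i j, |n i * q j - n j * q i| ≤ δ)
    (h' : ∀ i j, |n' i * q j - n' j * q i| ≤ δ)
    (hnn : ∃ i j, η ≤ |n' i * n j - n' j * n i|) (j : Fin d) :
    |q j| ≤ (d + (2 * d + 1) / η) * δ := by
  have hc : ∀ {m : E d}, ‖m‖ = 1 → ∀ i, |m i| ≤ 1 := fun {m} hm i => by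
    have := PiLp.norm_apply_le m i
    rwa [hm] at this
  obtain ⟨i, k, hik⟩ := hnn
  have hδ : 0 ≤ δ := (abs_nonneg _).trans (h i i)
  set β := ∑ i, n i * q i with hβ
  have hq := fun j => abs_sub_normal_part_le hn h j
  -- The vector `q` is `β n` up to an error of order `δ`. Crossing with `n'` isolates `β`, with a
  -- factor at least `η` in absolute value.
  have h1 : β * (n' i * n k - n' k * n i) = (n' i * q k - n' k * q i) -
      n' i * (q k - n k * β) + n' k * (q i - n i * β) := by ring
  have h2 : |β| * η ≤ (2 * d + 1) * δ := by
    calc |β| * η ≤ |β| * |n' i * n k - n' k * n i| := by gcongr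
      _ = |(n' i * q k - n' k * q i) - n' i * (q k - n k * β) + n' k * (q i - n i * β)| := by
        rw [← abs_mul, h1]
      _ ≤ |n' i * q k - n' k * q i| + |n' i * (q k - n k * β)| + |n' k * (q i - n i * β)| := by
        refine (abs_add_le _ _).trans ?_
        gcongr
        exact abs_sub _ _
      _ ≤ δ + 1 * (d * δ) + 1 * (d * δ) := by
        rw [abs_mul, abs_mul]
        gcongr
        · exact h' i k
        · exact hc hn' i
        · exact hq k
        · exact hc hn' k
        · exact hq i
      _ = _ := by ring
  have h3 : |β| ≤ (2 * d + 1) / η * δ := by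
    rw [div_mul_eq_mul_div, le_div_iff₀ hη]; exact h2
  calc |q j| = |(q j - n j * β) + n j * β| := by ring_nf
    _ ≤ |q j - n j * β| + |n j * β| := abs_add_le _ _
    _ ≤ d * δ + 1 * ((2 * d + 1) / η * δ) := by
      rw [abs_mul]
      gcongr
      · exact hq j
      · exact hc hn j
    _ = _ := by ring

end

section

/-! ### Lipschitz functions and weak derivatives -/

open Filter Topology in
/-- A function on a convex set that is Lipschitz on each of finitely many closed pieces is
Lipschitz. -/
theorem lipschitzOnWith_of_closed_cover {ι : Type*} {I : Finset ι} {S : Set (E d)}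
    (hS : Convex ℝ S) {C : ι → Set (E d)} (hC : ∀ i ∈ I, IsClosed (C i)) (hcov : S ⊆ ⋃ i ∈ I, C i)
    {u : E d → ℝ} {L : NNReal} (hu : ∀ i ∈ I, LipschitzOnWith L u (C i)) :
    LipschitzOnWith L u S := by
  refine LipschitzOnWith.of_dist_le_mul fun x hx y hy => ?_
  set γ : ℝ → E d := fun t => AffineMap.lineMap x y t with hγ
  have hγc : Continuous γ := AffineMap.lineMap_continuous
  have hγS : ∀ t ∈ Icc (0 : ℝ) 1, γ t ∈ S := fun t ht =>
    hS.segment_subset hx hy (by rw [segment_eq_image_lineMap]; exact ⟨t, ht, rfl⟩)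
  have hγd : ∀ t t', dist (γ t) (γ t') = |t - t'| * dist x y := fun t t' => by
    rw [hγ, dist_lineMap_lineMap, Real.dist_eq]
  have hcont : ContinuousOn (fun t => u (γ t)) (Icc 0 1) := by
    have h1 : ContinuousOn u (⋃ i : I, C i) :=
      (locallyFinite_of_finite _).continuousOn_iUnion (fun i => hC i i.2)
        fun i => (hu i i.2).continuousOn
    refine h1.comp hγc.continuousOn fun t ht => ?_
    have := hcov (hγS t ht)
    simpa using this
  -- The parameters at which the estimate from the starting point holds: a closed set, shown to
  -- exhaust the segment by continuation to the right.
  set A : Set ℝ := {t | |u (γ t) - u (γ 0)| ≤ L * (t * dist x y)} with hA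
  have hAcl : IsClosed (A ∩ Icc 0 1) := by
    have := isClosed_Icc.isClosed_le (s := Icc (0 : ℝ) 1) (f := fun t => |u (γ t) - u (γ 0)|)
      (g := fun t => L * (t * dist x y)) (hcont.sub continuousOn_const).abs (by fun_prop)
    rw [inter_comm]
    exact this
  have hsub : Icc (0 : ℝ) 1 ⊆ A := by
    refine hAcl.Icc_subset_of_forall_exists_gt (by simp [hA]) ?_
    rintro t ⟨htA, ht0, ht1⟩ y' hy'
    have hev : ∀ᶠ t' in 𝓝[>] t, t' ∈ Ioc t (min y' 1) :=
      Ioc_mem_nhdsGT (lt_min hy' ht1)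
    -- Finitely many pieces cover the segment, so one of them meets every right neighbourhood of
    -- `t`; being closed, it contains `γ t` too.
    obtain ⟨i, hi, hfr⟩ : ∃ i ∈ I, ∃ᶠ t' in 𝓝[>] t, γ t' ∈ C i := by
      by_contra! h
      have h2 : ∀ᶠ t' in 𝓝[>] t, ∀ i ∈ I, γ t' ∉ C i := by
        rw [eventually_all_finset]
        intro i hi
        simpa using h i hi
      obtain ⟨t', h3, h4⟩ := (h2.and hev).exists
      have := hcov (hγS t' ⟨ht0.trans h4.1.le, h4.2.trans (min_le_right _ _)⟩)
      simp only [mem_iUnion] at this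
      obtain ⟨i, hi, hmem⟩ := this
      exact h3 i hi hmem
    have htC : γ t ∈ C i := by
      have h1 : t ∈ closure (γ ⁻¹' C i) :=
        mem_closure_iff_frequently.2 (hfr.filter_mono nhdsWithin_le_nhds)
      rwa [((hC i hi).preimage hγc).closure_eq] at h1
    obtain ⟨t', h3, h4⟩ := (hfr.and_eventually hev).exists
    refine ⟨t', ?_, h4.1, h4.2.trans (min_le_left _ _)⟩
    have h5 := (hu i hi).dist_le_mul _ h3 _ htC
    rw [hγd, Real.dist_eq, abs_of_pos (sub_pos.2 h4.1)] at h5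
    have h6 : |u (γ t) - u (γ 0)| ≤ L * (t * dist x y) := htA
    change |u (γ t') - u (γ 0)| ≤ L * (t' * dist x y)
    calc |u (γ t') - u (γ 0)| ≤ |u (γ t') - u (γ t)| + |u (γ t) - u (γ 0)| := abs_sub_le _ _ _
      _ ≤ L * ((t' - t) * dist x y) + L * (t * dist x y) := add_le_add h5 h6
      _ = _ := by ring
  have h1 : |u (γ 1) - u (γ 0)| ≤ L * (1 * dist x y) := hsub ⟨zero_le_one, le_rfl⟩
  simp only [hγ, AffineMap.lineMap_apply_one, AffineMap.lineMap_apply_zero, one_mul] at h1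
  rwa [dist_comm (u x), Real.dist_eq]

theorem norm_single_one (k : Fin d) : ‖(EuclideanSpace.single k (1 : ℝ) : E d)‖ = 1 := by simp

/-- A Lipschitz function has bounded weak derivatives. -/
theorem exists_weakPartial_of_lipschitzOn {U : Set (E d)} {u : E d → ℝ} {L : NNReal}
    (hu : LipschitzOnWith L u U) (k : Fin d) :
    ∃ g : E d → ℝ, Measurable g ∧ (∀ x, |g x| ≤ L) ∧
      ∀ φ : E d → ℝ, ContDiff ℝ (⊤ : ℕ∞) φ → HasCompactSupport φ → tsupport φ ⊆ U →
        ∫ x, u x * fderiv ℝ φ x (EuclideanSpace.single k 1) = -∫ x, g x * φ x := by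
  -- The line derivative of a global Lipschitz extension serves as weak derivative. The extension is
  -- irrelevant outside `U`, where the derivative of the test function vanishes.
  obtain ⟨v, hv, huv⟩ := hu.extend_real
  set e : E d := EuclideanSpace.single k 1 with he
  refine ⟨fun x => lineDeriv ℝ v x e, measurable_lineDeriv hv.continuous, fun x => ?_, ?_⟩
  · have := norm_lineDeriv_le_of_lipschitz (x₀ := x) (v := e) ℝ hv
    rwa [he, norm_single_one, mul_one, Real.norm_eq_abs] at this
  · intro φ hφ hφc hφU
    obtain ⟨D, hD⟩ := ContDiff.lipschitzWith_of_hasCompactSupport hφc hφ (by simp)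
    rw [hv.integral_lineDeriv_mul_eq hD hφc e, ← integral_neg]
    refine integral_congr_ae (Filter.Eventually.of_forall fun x => ?_)
    have h1 : lineDeriv ℝ φ x (-e) = -fderiv ℝ φ x e := by
      rw [(hφ.differentiable (by simp)).differentiableAt.lineDeriv_eq_fderiv, map_neg]
    simp only [h1]
    by_cases hx : x ∈ U
    · rw [huv hx]; ring
    · have h2 : fderiv ℝ φ x = 0 := by
        by_contra h
        exact hx (hφU (support_fderiv_subset ℝ h))
      simp [h2]

theorem setIntegral_mul_eq_of_tsupport {D : Set (E d)} {φ : E d → ℝ} (hφ : tsupport φ ⊆ D)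
    (g : E d → ℝ) : ∫ x in D, g x * φ x = ∫ x, g x * φ x :=
  setIntegral_eq_integral_of_forall_compl_eq_zero fun x hx => by
    rw [image_eq_zero_of_notMem_tsupport fun h => hx (hφ h), mul_zero]

theorem setIntegral_mul_fderiv_eq_of_tsupport {D : Set (E d)} {φ : E d → ℝ} (hφ : tsupport φ ⊆ D)
    (g : E d → ℝ) (e : E d) :
    ∫ x in D, g x * fderiv ℝ φ x e = ∫ x, g x * fderiv ℝ φ x e :=
  setIntegral_eq_integral_of_forall_compl_eq_zero fun x hx => by
    have h2 : fderiv ℝ φ x = 0 := by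
      by_contra h
      exact hx (hφ (support_fderiv_subset ℝ h))
    simp [h2]

theorem memLp_of_abs_le {D : Set (E d)} (hD : volume D ≠ ⊤) {g : E d → ℝ}
    (hg : AEStronglyMeasurable g (volume.restrict D)) {L : ℝ}
    (hL : ∀ᵐ x ∂volume.restrict D, |g x| ≤ L) : MemLp g 2 (volume.restrict D) := by
  have : IsFiniteMeasure (volume.restrict D) := ⟨by simpa using hD.lt_top⟩
  exact MemLp.of_bound hg L (by simpa using hL)

theorem memH1_of_lipschitzOn {D : Set (E d)} (hDo : IsOpen D) (hDb : Bornology.IsBounded D)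
    {u : E d → ℝ} {L : NNReal} (hu : LipschitzOnWith L u D) : MemH1 D u := by
  have hfin : volume D ≠ ⊤ := hDb.measure_lt_top.ne
  constructor
  · have hub : Bornology.IsBounded (u '' D) := by
      obtain ⟨v, hv, huv⟩ := hu.extend_real
      rw [huv.image_eq]
      exact hv.isBounded_image hDb
    obtain ⟨B, hB⟩ := hub.exists_norm_le
    refine memLp_of_abs_le hfin (hu.continuousOn.aestronglyMeasurable hDo.measurableSet) (L := B) ?_
    filter_upwards [ae_restrict_mem hDo.measurableSet] with x hx
    exact hB _ ⟨x, hx, rfl⟩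
  · intro k
    obtain ⟨g, hgm, hgL, hg⟩ := exists_weakPartial_of_lipschitzOn hu k
    refine ⟨g, memLp_of_abs_le hfin hgm.aestronglyMeasurable (Filter.Eventually.of_forall hgL),
      fun φ h1 h2 h3 => ?_⟩
    rw [setIntegral_mul_fderiv_eq_of_tsupport h3, setIntegral_mul_eq_of_tsupport h3, hg φ h1 h2 h3]

/-- A weak derivative is bounded by the Lipschitz constant. -/
theorem IsWeakPartial.abs_le {D U : Set (E d)} (hUo : IsOpen U) (hUD : U ⊆ D)
    {u g : E d → ℝ} {k : Fin d} (hg2 : MemLp g 2 (volume.restrict D)) (hg : IsWeakPartial D k u g)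
    {L : NNReal} (hu : LipschitzOnWith L u U) : ∀ᵐ x, x ∈ U → |g x| ≤ L := by
  obtain ⟨w, hwm, hwL, hw⟩ := exists_weakPartial_of_lipschitzOn hu k
  have hwloc : LocallyIntegrable w volume :=
    (memLp_top_of_bound hwm.aestronglyMeasurable (L : ℝ)
      (Filter.Eventually.of_forall fun x => by simpa using hwL x)).locallyIntegrable le_top
  have hloc : LocallyIntegrableOn (g - w) U volume := by
    refine LocallyIntegrableOn.sub ?_ (hwloc.locallyIntegrableOn U)
    exact (locallyIntegrableOn_of_locallyIntegrable_restrict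
      (hg2.locallyIntegrable one_le_two)).mono_set hUD
  -- Both `g` and the bounded weak derivative `w` satisfy the same identities in `U`, so they agree
  -- there almost everywhere.
  have h := hUo.ae_eq_zero_of_integral_contDiff_smul_eq_zero hloc fun φ h1 h2 h3 => ?_
  · filter_upwards [h] with x hx hxU
    have := hx hxU
    rw [Pi.sub_apply, sub_eq_zero] at this
    rw [this]; exact hwL x
  · have hφ2 : MemLp φ 2 (volume.restrict D) :=
      (h1.continuous.memLp_of_hasCompactSupport h2).restrict D
    have i1 : Integrable (fun x => g x * φ x) (volume.restrict D) := hg2.integrable_mul hφ2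
    have i2 : Integrable (fun x => w x * φ x) (volume.restrict D) :=
      ((h1.continuous.integrable_of_hasCompactSupport h2).restrict (s := D)).bdd_mul
        hwm.aestronglyMeasurable (Filter.Eventually.of_forall fun x => by simpa using hwL x)
    have e1 := hg φ h1 h2 (h3.trans hUD)
    have e2 := hw φ h1 h2 h3
    rw [setIntegral_mul_fderiv_eq_of_tsupport (h3.trans hUD), e2, neg_inj,
      ← setIntegral_mul_eq_of_tsupport (h3.trans hUD)] at e1
    have e3 : ∫ x, φ x • (g - w) x = ∫ x, (g - w) x * φ x := by
      simp only [smul_eq_mul, mul_comm]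
    rw [e3, ← setIntegral_mul_eq_of_tsupport (h3.trans hUD)]
    simp only [Pi.sub_apply, sub_mul]
    rw [integral_sub i1 i2, e1, sub_self]

end

section

/-! ### Bernstein polynomials on the reference simplex -/

/-- Barycentric coordinates with respect to the standard simplex of `ℝ^k`. -/
def refBary {k : ℕ} (y : E k) : Fin (k + 1) → ℝ := Fin.cons (1 - ∑ i, y i) fun i => y i

theorem continuous_refBary {k : ℕ} (i : Fin (k + 1)) : Continuous fun y : E k => refBary y i := by
  refine Fin.cases ?_ (fun i => ?_) i
  · simp only [refBary, Fin.cons_zero]; fun_prop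
  · simp only [refBary, Fin.cons_succ]; fun_prop

/-- The standard simplex of `ℝ^k`. -/
def refSimplex (k : ℕ) : Set (E k) := {y | ∀ i, 0 ≤ refBary y i}

theorem sum_refBary {k : ℕ} (y : E k) : ∑ i, refBary y i = 1 := by
  simp [refBary, Fin.sum_univ_succ]

theorem isClosed_refSimplex (k : ℕ) : IsClosed (refSimplex k) := by
  rw [refSimplex, ofPred_forall]
  exact isClosed_iInter fun i => isClosed_le continuous_const (continuous_refBary i)

theorem isCompact_refSimplex (k : ℕ) : IsCompact (refSimplex k) := by
  refine Metric.isCompact_of_isClosed_isBounded (isClosed_refSimplex k) ?_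
  refine (Metric.isBounded_closedBall (x := (0 : E k)) (r := k + 1)).subset fun y hy => ?_
  have h1 : ∀ i, refBary y i ≤ 1 := fun i => by
    rw [← sum_refBary y]
    exact Finset.single_le_sum (f := refBary y) (fun i _ => hy i) (Finset.mem_univ i)
  have h2 : ∀ i, y i ^ 2 ≤ 1 := fun i => by
    have a := hy i.succ
    have b := h1 i.succ
    simp only [refBary, Fin.cons_succ] at a b
    nlinarith
  rw [mem_closedBall_zero_iff]
  refine abs_le_of_sq_le_sq' ?_ (by positivity) |>.2
  rw [EuclideanSpace.real_norm_sq_eq]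
  calc ∑ i, y i ^ 2 ≤ ∑ _i : Fin k, (1 : ℝ) := Finset.sum_le_sum fun i _ => h2 i
    _ = k := by simp
    _ ≤ (k + 1 : ℝ) ^ 2 := by nlinarith [(Nat.cast_nonneg k : (0 : ℝ) ≤ k)]

/-- A homogeneous polynomial vanishing in the interior of the standard simplex is zero. -/
theorem eq_zero_of_eval_refBary {k m : ℕ} {R : MvPolynomial (Fin (k + 1)) ℝ}
    (hR : R.IsHomogeneous m)
    (h : ∀ y : E k, (∀ i, 0 < refBary y i) → MvPolynomial.eval (refBary y) R = 0) : R = 0 := by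
  refine MvPolynomial.funext_set (fun _ => Ioi (0 : ℝ)) (fun _ => Ioi_infinite 0) fun x hx => ?_
  have hx : ∀ i, 0 < x i := fun i => hx i (mem_univ i)
  set t := ∑ i, x i with ht
  have htpos : 0 < t := Finset.sum_pos (fun i _ => hx i) Finset.univ_nonempty
  -- Any vector with positive entries is a multiple of a barycentric vector, and homogeneity carries
  -- the vanishing over to it.
  set y : E k := WithLp.toLp 2 fun i => x i.succ / t with hy
  have hxy : x = t • refBary y := by
    funext i
    rw [Pi.smul_apply, smul_eq_mul]
    refine Fin.cases ?_ (fun i => ?_) i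
    · simp only [refBary, Fin.cons_zero, hy, ← Finset.sum_div]
      field_simp
      rw [ht, Fin.sum_univ_succ]; ring
    · simp only [refBary, Fin.cons_succ, hy]
      field_simp
  have hpos : ∀ i, 0 < refBary y i := fun i => by
    have h1 := hx i
    rw [hxy, Pi.smul_apply, smul_eq_mul] at h1
    exact pos_of_mul_pos_right h1 htpos.le
  rw [map_zero]
  have h3 : MvPolynomial.eval (t • refBary y) R = t ^ m * MvPolynomial.eval (refBary y) R := by
    rw [MvPolynomial.eval_eq, MvPolynomial.eval_eq, Finset.mul_sum]
    refine Finset.sum_congr rfl fun a ha => ?_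
    have h4 : ∑ i ∈ a.support, a i = m := by
      have := hR (MvPolynomial.mem_support_iff.1 ha)
      simpa [Finsupp.weight_apply, Finsupp.sum] using this
    simp only [Pi.smul_apply, smul_eq_mul, mul_pow, Finset.prod_mul_distrib]
    rw [Finset.prod_pow_eq_pow_sum, h4]; ring
  rw [hxy, h3, h y hpos, mul_zero]

/-- The Bernstein coefficients are bounded by the `L²` norm on the standard simplex. -/
theorem exists_refSimplex_coeff_bound (k m : ℕ) : ∃ C > 0, ∀ c : (Fin (k + 1) →₀ ℕ) → ℝ,
    ∀ a ∈ (Finset.univ : Finset (Fin (k + 1))).finsuppAntidiag m, c a ^ 2 ≤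
      C * ∫ y in refSimplex k, (∑ a ∈ (Finset.univ : Finset (Fin (k + 1))).finsuppAntidiag m,
        c a * ∏ i, refBary y i ^ a i) ^ 2 := by
  set A := (Finset.univ : Finset (Fin (k + 1))).finsuppAntidiag m with hA
  set b : (Fin (k + 1) →₀ ℕ) → E k → ℝ := fun a y => ∏ i, refBary y i ^ a i with hb
  have hbc : ∀ a, Continuous (b a) := fun a =>
    continuous_finsetProd _ fun i _ => (continuous_refBary i).pow _
  set q : (A → ℝ) → E k → ℝ := fun c y => ∑ a, c a * b a y with hq
  have hqc : ∀ c, Continuous (q c) := fun c =>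
    continuous_finsetSum _ fun a _ => continuous_const.mul (hbc a)
  set F : (A → ℝ) → ℝ := fun c => ∫ y in refSimplex k, q c y ^ 2 with hF
  have hFexp : ∀ c, F c = ∑ a, ∑ a', c a * c a' * ∫ y in refSimplex k, b a y * b a' y := by
    intro c
    have h1 : ∀ y, q c y ^ 2 = ∑ a, ∑ a', c a * c a' * (b a y * b a' y) := by
      intro y
      rw [hq, sq, Finset.sum_mul_sum]
      exact Finset.sum_congr rfl fun a _ => Finset.sum_congr rfl fun a' _ => by ring
    have hintg : ∀ a a' : A, IntegrableOn (fun y => c a * c a' * (b a y * b a' y)) (refSimplex k) :=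
      fun a a' => (continuous_const.mul ((hbc a).mul (hbc a'))).continuousOn.integrableOn_compact
        (isCompact_refSimplex k)
    simp only [hF, h1]
    rw [integral_finsetSum _ fun a _ => integrable_finsetSum _ fun a' _ => hintg a a']
    refine Finset.sum_congr rfl fun a _ => ?_
    rw [integral_finsetSum _ fun a' _ => hintg a a']
    exact Finset.sum_congr rfl fun a' _ => integral_const_mul _ _
  have hFc : Continuous F := by
    simp only [funext hFexp]; fun_prop
  have hF0 : ∀ c, 0 ≤ F c := fun c => setIntegral_nonneg (isClosed_refSimplex k).measurableSet
    fun y _ => sq_nonneg _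
  -- Definiteness: a zero L² norm forces vanishing on the open simplex, hence of the homogeneous
  -- polynomial, hence of its coefficients.
  have hFpos : ∀ c, F c = 0 → c = 0 := by
    intro c hc
    have hae : ∀ᵐ y ∂volume.restrict (refSimplex k), q c y ^ 2 = 0 := by
      have := (integral_eq_zero_iff_of_nonneg (fun y => sq_nonneg (q c y))
        (((hqc c).pow 2).continuousOn.integrableOn_compact (isCompact_refSimplex k))).1 hc
      exact this
    set U : Set (E k) := {y | ∀ i, 0 < refBary y i} with hU
    have hUo : IsOpen U := by
      rw [hU, ofPred_forall]
      exact isOpen_iInter_of_finite fun i => isOpen_lt continuous_const (continuous_refBary i)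
    have hUs : U ⊆ refSimplex k := fun y hy i => (hy i).le
    have hzero : EqOn (q c) 0 U := by
      refine Measure.eqOn_open_of_ae_eq (μ := volume) ?_ hUo (hqc c).continuousOn continuousOn_const
      have h2 := ae_restrict_of_ae_restrict_of_subset hUs hae
      filter_upwards [h2] with y hy
      simpa using hy
    set R : MvPolynomial (Fin (k + 1)) ℝ := ∑ a : A, MvPolynomial.monomial a.1 (c a) with hR
    have hRh : R.IsHomogeneous m := by
      refine MvPolynomial.IsHomogeneous.sum _ _ _ fun a _ => MvPolynomial.isHomogeneous_monomial _ ?_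
      have := (Finset.mem_finsuppAntidiag'.1 a.2).1
      exact this
    have hR0 : R = 0 := eq_zero_of_eval_refBary hRh fun y hy => by
      have := hzero hy
      rw [hR, map_sum]
      simp only [MvPolynomial.eval_monomial, Finsupp.prod_fintype _ _ fun i => pow_zero _]
      exact this
    funext a
    have h3 := congrArg (MvPolynomial.coeff a.1) hR0
    rw [hR, MvPolynomial.coeff_sum] at h3
    simp only [MvPolynomial.coeff_monomial, MvPolynomial.coeff_zero] at h3
    rw [Finset.sum_eq_single a (fun a' _ h => if_neg fun h' => h (Subtype.ext h'))
      (by simp)] at h3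
    simpa using h3
  have hAne : Nonempty A := ⟨⟨Finsupp.single 0 m, by simp [hA]⟩⟩
  -- The constant is the inverse of the minimum of the definite quadratic form `F` on the unit
  -- sphere of coefficient vectors.
  obtain ⟨c₀, hc₀, hmin⟩ := (isCompact_sphere (0 : A → ℝ) 1).exists_isMinOn
    (NormedSpace.sphere_nonempty.2 zero_le_one) hFc.continuousOn
  have hc₀n : ‖c₀‖ = 1 := by simpa using hc₀
  have hμ : 0 < F c₀ := lt_of_le_of_ne (hF0 c₀) fun h => by
    rw [hFpos c₀ h.symm] at hc₀n
    simp at hc₀n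
  refine ⟨(F c₀)⁻¹, by positivity, fun c a ha => ?_⟩
  set c' : A → ℝ := fun a => c a.1 with hc'
  have hintg : ∫ y in refSimplex k, (∑ a ∈ A, c a * ∏ i, refBary y i ^ a i) ^ 2 = F c' := by
    simp only [hF, hq, hc', hb]
    refine integral_congr_ae (Filter.Eventually.of_forall fun y => ?_)
    simp only
    rw [← Finset.sum_coe_sort A]
  rw [hintg, ← div_eq_inv_mul, le_div_iff₀ hμ]
  have hle : c a ^ 2 ≤ ‖c'‖ ^ 2 := by
    have := norm_le_pi_norm c' ⟨a, ha⟩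
    rw [← sq_abs]
    exact pow_le_pow_left₀ (abs_nonneg _) this 2
  refine (mul_le_mul_of_nonneg_right hle hμ.le).trans ?_
  rcases eq_or_ne c' 0 with h0 | h0
  · rw [h0]; simpa using hF0 0
  have hn : 0 < ‖c'‖ := norm_pos_iff.2 h0
  have hs : F (‖c'‖⁻¹ • c') = (‖c'‖⁻¹) ^ 2 * F c' := by
    rw [hFexp, hFexp, Finset.mul_sum]
    refine Finset.sum_congr rfl fun a _ => ?_
    rw [Finset.mul_sum]
    refine Finset.sum_congr rfl fun a' _ => ?_
    simp only [Pi.smul_apply, smul_eq_mul]; ring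
  have h4 : F c₀ ≤ F (‖c'‖⁻¹ • c') := hmin (by simp [norm_smul, hn.ne'])
  rw [hs] at h4
  calc ‖c'‖ ^ 2 * F c₀ ≤ ‖c'‖ ^ 2 * (‖c'‖⁻¹ ^ 2 * F c') := by gcongr
    _ = F c' := by field_simp

end

section

/-! ### Bernstein coefficients on facets -/

open Classical in
/-- The multi-indices of degree `m` supported in `s`. -/
def nodes (m : ℕ) (s : Finset (E d)) : Finset (E d →₀ ℕ) := s.finsuppAntidiag m

theorem mem_nodes {m : ℕ} {s : Finset (E d)} {a : E d →₀ ℕ} :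
    a ∈ nodes m s ↔ a.sum (fun _ n => n) = m ∧ a.support ⊆ s := by
  rw [nodes, Finset.mem_finsuppAntidiag']

theorem nodes_mono {m : ℕ} {f s : Finset (E d)} (h : f ⊆ s) : nodes m f ⊆ nodes m s :=
  fun _ ha => mem_nodes.2 ⟨(mem_nodes.1 ha).1, (mem_nodes.1 ha).2.trans h⟩

/-- The Bernstein polynomial of the simplex `s` with multi-index `a`. -/
def bern (s : Finset (E d)) (a : E d →₀ ℕ) (x : E d) : ℝ := a.prod fun v n => bary s v x ^ n

theorem continuous_bern (s : Finset (E d)) (a : E d →₀ ℕ) : Continuous (bern s a) :=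
  continuous_finsetProd _ fun v _ => (continuous_bary s v).pow _

theorem bern_eq_zero {s : Finset (E d)} {a : E d →₀ ℕ} {x v : E d} (hv : v ∈ a.support)
    (h : bary s v x = 0) : bern s a x = 0 :=
  Finset.prod_eq_zero hv (by simp only [h]; exact zero_pow (Finsupp.mem_support_iff.1 hv))

open scoped MeasureTheory in
theorem euclideanHausdorffMeasure_image_le {k : ℕ} {X Y : Type*} [EMetricSpace X]
    [MeasurableSpace X] [BorelSpace X] [EMetricSpace Y] [MeasurableSpace Y] [BorelSpace Y]
    {K : NNReal} {f : X → Y} (hf : LipschitzWith K f) (s : Set X) :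
    μHE[k] (f '' s) ≤ (K : ENNReal) ^ k * μHE[k] s := by
  have h := hf.hausdorffMeasure_image_le (d := k) (by positivity) s
  rw [ENNReal.rpow_natCast] at h
  simp only [Measure.euclideanHausdorffMeasure_def, Measure.smul_apply, ENNReal.smul_def,
    smul_eq_mul]
  rw [mul_left_comm]
  gcongr

/-! ### Transport between a facet and the reference simplex. -/

section Facet

variable {k : ℕ} {s f : Finset (E d)} (e : Fin (k + 1) ≃ f)

/-- Barycentric coordinates of a facet, as a map to the standard simplex. -/
def facetChart (s : Finset (E d)) (e : Fin (k + 1) ≃ f) (x : E d) : E k :=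
  WithLp.toLp 2 fun i => bary s (e i.succ) x

theorem lipschitzWith_facetChart (hs : IsSimplex s) {c : E d} {r : ℝ} (hr : 0 < r)
    (hball : Metric.closedBall c r ⊆ hull s) :
    LipschitzWith (Real.toNNReal ((k + 1) / r)) (facetChart s e) := by
  refine LipschitzWith.of_dist_le_mul fun x y => ?_
  rw [Real.coe_toNNReal _ (by positivity), dist_eq_norm, dist_eq_norm]
  refine abs_le_of_sq_le_sq' ?_ (by positivity) |>.2
  rw [EuclideanSpace.real_norm_sq_eq]
  have hk : (0 : ℝ) ≤ k := Nat.cast_nonneg k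
  calc ∑ i, (facetChart s e x - facetChart s e y) i ^ 2
      ≤ ∑ _i : Fin k, (‖x - y‖ / r) ^ 2 := Finset.sum_le_sum fun i _ => by
        rw [← sq_abs]
        exact pow_le_pow_left₀ (abs_nonneg _) (hs.abs_bary_sub_le hr hball _ x y) 2
    _ = k * (‖x - y‖ / r) ^ 2 := by simp
    _ ≤ (k + 1) ^ 2 * (‖x - y‖ / r) ^ 2 := by gcongr; nlinarith
    _ = _ := by ring

theorem refBary_facetChart (hs : IsSimplex s) (hf : f ⊆ s) {x : E d} (hx : x ∈ hull f)
    (i : Fin (k + 1)) : refBary (facetChart s e x) i = bary s (e i) x := by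
  have h1 : ∑ i, bary s (e i) x = 1 := by
    rw [← hs.sum_bary x, e.sum_comp (fun v : f => bary s v x),
      Finset.sum_coe_sort f (fun v => bary s v x)]
    exact Finset.sum_subset hf fun v _ hv => ((hs.mem_hull_subset_iff hf).1 hx).2 v hv
  refine Fin.cases ?_ (fun i => ?_) i
  · rw [Fin.sum_univ_succ] at h1
    simp only [refBary, Fin.cons_zero, facetChart]
    linarith
  · simp only [refBary, Fin.cons_succ, facetChart]

theorem exists_facetChart_eq (hs : IsSimplex s) (hf : f ⊆ s) {y : E k} (hy : y ∈ refSimplex k) :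
    ∃ x ∈ hull f, facetChart s e x = y := by
  classical
  set w : E d → ℝ := fun v => if h : v ∈ f then refBary y (e.symm ⟨v, h⟩) else 0 with hw
  have hwe : ∀ v : f, w v = refBary y (e.symm v) := fun v => by simp [hw]
  have hw1 : ∑ v ∈ f, w v = 1 := by
    rw [← Finset.sum_coe_sort]
    simp only [hwe]
    rw [e.symm.sum_comp (fun i => refBary y i), sum_refBary]
  refine ⟨∑ v ∈ f, w v • v, mem_hull_iff.2 ⟨w, fun v hv => ?_, hw1, rfl⟩, ?_⟩
  · rw [hwe ⟨v, hv⟩]; exact hy _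
  · ext i
    simp only [facetChart]
    rw [hs.bary_sum hf hw1 (e i.succ).2, hwe, e.symm_apply_apply]
    simp [refBary]

-- The chart maps the facet onto the reference simplex and is Lipschitz. The estimate needs only
-- this inequality of measures, so no Jacobian has to be computed.
open scoped MeasureTheory in
theorem volume_restrict_refSimplex_le (hs : IsSimplex s) (hf : f ⊆ s) {c : E d} {r : ℝ}
    (hr : 0 < r) (hball : Metric.closedBall c r ⊆ hull s) :
    volume.restrict (refSimplex k) ≤ ((Real.toNNReal ((k + 1) / r) : ENNReal) ^ k) •
      (μHE[k].restrict (hull f)).map (facetChart s e) := by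
  have hL := lipschitzWith_facetChart e hs hr hball
  refine Measure.le_iff.2 fun B hB => ?_
  rw [Measure.restrict_apply hB, Measure.smul_apply, Measure.map_apply hL.continuous.measurable hB,
    Measure.restrict_apply (hL.continuous.measurable hB), smul_eq_mul]
  have hsub : B ∩ refSimplex k ⊆ facetChart s e '' (facetChart s e ⁻¹' B ∩ hull f) := by
    rintro y ⟨hyB, hy⟩
    obtain ⟨x, hx, rfl⟩ := exists_facetChart_eq e hs hf hy
    exact ⟨x, ⟨hyB, hx⟩, rfl⟩
  refine (measure_mono hsub).trans ?_
  rw [← EuclideanSpace.euclideanHausdorffMeasure_eq_volume]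
  exact euclideanHausdorffMeasure_image_le hL _

-- The facet is contained in the Lipschitz image `Ψ` of the compact reference simplex under its
-- affine parametrisation.
open scoped MeasureTheory in
theorem euclideanHausdorffMeasure_hull_lt_top (hs : IsSimplex s) (hf : f ⊆ s)
    (e : Fin (k + 1) ≃ f) : μHE[k] (hull f) < ⊤ := by
  set Φ : E k →L[ℝ] E d := ∑ i : Fin k,
    (EuclideanSpace.proj i : E k →L[ℝ] ℝ).smulRight ((e i.succ : E d) - e 0) with hΦ
  set Ψ : E k → E d := fun y => (e 0 : E d) + Φ y with hΨ
  have hΨL : LipschitzWith ‖Φ‖₊ Ψ := LipschitzWith.of_dist_le_mul fun x y => by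
    rw [hΨ, dist_add_left]; exact Φ.lipschitz.dist_le_mul x y
  have hsub : hull f ⊆ Ψ '' refSimplex k := by
    intro x hx
    refine ⟨facetChart s e x, fun i => ?_, ?_⟩
    · rw [refBary_facetChart e hs hf hx]
      exact hs.mem_hull_iff.1 (hull_mono hf hx) _
    · have h1 := refBary_facetChart e hs hf hx 0
      have h2 : x = ∑ i, bary s (e i) x • (e i : E d) := by
        rw [e.sum_comp (fun v : f => bary s v x • (v : E d)),
          Finset.sum_coe_sort f (fun v => bary s v x • v)]
        conv_lhs => rw [← hs.sum_bary_smul x]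
        exact (Finset.sum_subset hf fun v _ hv => by
          rw [((hs.mem_hull_subset_iff hf).1 hx).2 v hv, zero_smul]).symm
      have hproj : ∀ (i : Fin k) (y : E k), (EuclideanSpace.proj i : E k →L[ℝ] ℝ) y = y i :=
        fun _ _ => rfl
      conv_rhs => rw [h2, Fin.sum_univ_succ, ← h1]
      simp only [hΨ, hΦ, refBary, Fin.cons_zero, facetChart,
        sum_apply, ContinuousLinearMap.smulRight_apply,
        hproj, smul_sub, Finset.sum_sub_distrib, ← Finset.sum_smul, sub_smul,
        one_smul]
      abel
  refine (measure_mono hsub).trans_lt ((euclideanHausdorffMeasure_image_le hΨL _).trans_lt ?_)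
  rw [EuclideanSpace.euclideanHausdorffMeasure_eq_volume]
  exact ENNReal.mul_lt_top (ENNReal.pow_lt_top ENNReal.coe_lt_top)
    (isCompact_refSimplex k).measure_lt_top

/-- Renames vertices by `Fin (k + 1)`, so that the estimate on the reference simplex applies to
facet polynomials. -/
theorem sum_nodes_eq (e : Fin (k + 1) ≃ f) {m : ℕ} (c : (E d →₀ ℕ) → ℝ) :
    ∃ c' : (Fin (k + 1) →₀ ℕ) → ℝ,
      (∀ a ∈ nodes m f, ∃ a' ∈ (Finset.univ : Finset (Fin (k + 1))).finsuppAntidiag m,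
        c' a' = c a) ∧
      ∀ lam : E d → ℝ, ∑ a ∈ nodes m f, c a * a.prod (fun v n => lam v ^ n) =
        ∑ a' ∈ (Finset.univ : Finset (Fin (k + 1))).finsuppAntidiag m,
          c' a' * ∏ i, lam (e i) ^ a' i := by
  classical
  set ι : Fin (k + 1) ↪ E d := e.toEmbedding.trans (Function.Embedding.subtype _) with hι
  have hιe : ∀ i, ι i = e i := fun i => rfl
  have hsum : ∀ a' : Fin (k + 1) →₀ ℕ,
      (Finsupp.embDomain ι a').sum (fun _ n => n) = a'.sum fun _ n => n := fun a' =>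
    Finsupp.sum_embDomain
  have hmem : ∀ a' ∈ (Finset.univ : Finset (Fin (k + 1))).finsuppAntidiag m,
      Finsupp.embDomain ι a' ∈ nodes m f := fun a' ha' => by
    refine mem_nodes.2 ⟨(hsum a').trans (Finset.mem_finsuppAntidiag'.1 ha').1, ?_⟩
    rw [Finsupp.support_embDomain]
    intro v hv
    obtain ⟨i, -, rfl⟩ := Finset.mem_map.1 hv
    exact (e i).2
  have hsurj : ∀ a ∈ nodes m f, ∃ a' ∈ (Finset.univ : Finset (Fin (k + 1))).finsuppAntidiag m,
      Finsupp.embDomain ι a' = a := fun a ha => by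
    obtain ⟨h1, h2⟩ := mem_nodes.1 ha
    set a' : Fin (k + 1) →₀ ℕ := a.comapDomain ι ι.injective.injOn with ha'
    have hemb : Finsupp.embDomain ι a' = a := by
      refine Finsupp.embDomain_comapDomain fun v hv => ⟨e.symm ⟨v, h2 hv⟩, ?_⟩
      rw [hιe, e.apply_symm_apply]
    refine ⟨a', Finset.mem_finsuppAntidiag'.2 ⟨?_, Finset.subset_univ _⟩, hemb⟩
    rw [← hsum, hemb, h1]
  refine ⟨fun a' => c (Finsupp.embDomain ι a'), fun a ha => ?_, fun lam => ?_⟩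
  · obtain ⟨a', h1, h2⟩ := hsurj a ha
    exact ⟨a', h1, congrArg c h2⟩
  · symm
    refine Finset.sum_bij (fun a' _ => Finsupp.embDomain ι a') hmem
      (fun a _ b _ h => Finsupp.embDomain_injective ι h) (fun a ha => ?_) fun a' _ => ?_
    · obtain ⟨a', h1, h2⟩ := hsurj a ha
      exact ⟨a', h1, h2⟩
    · rw [Finsupp.prod_embDomain, Finsupp.prod_fintype _ _ fun i => pow_zero _]
      rfl

end Facet

open scoped MeasureTheory in
theorem measure_facet_lt_top (hd : 1 ≤ d) {s f : Finset (E d)} (hs : IsSimplex s)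
    (hf : IsFacetOf f s) : μHE[d - 1] (hull f) < ⊤ := by
  obtain ⟨k, hk⟩ : ∃ k, d = k + 1 := ⟨d - 1, by omega⟩
  have hk' : d - 1 = k := by omega
  rw [hk']
  exact euclideanHausdorffMeasure_hull_lt_top hs hf.1
    (f.equivFinOfCardEq (hf.2.trans hk)).symm

open scoped MeasureTheory in
/-- On every facet, the Bernstein coefficients of degree `m` are bounded, with the constant `C`, by
the scaled `L²` norm on the facet. -/
def FacetBound (d m : ℕ) (C : ℝ) : Prop := ∀ s f : Finset (E d),
    IsSimplex s → IsFacetOf f s → ∀ (x₀ : E d) (r : ℝ), 0 < r → Metric.closedBall x₀ r ⊆ hull s →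
    ∀ (c : (E d →₀ ℕ) → ℝ), ∀ a ∈ nodes m f, c a ^ 2 * r ^ (d - 1) ≤
      C * ∫ x in hull f, (∑ a ∈ nodes m f, c a * bern s a x) ^ 2 ∂μHE[d - 1]

-- The reference estimate is pulled back by the chart, whose Lipschitz constant `(k + 1) / r` to the
-- power `k = d - 1` accounts for the scaling. The constant depends on `d` and `m` only.
open scoped MeasureTheory in
theorem exists_facetBound (hd : 1 ≤ d) (m : ℕ) : ∃ C > 0, FacetBound d m C := by
  unfold FacetBound
  obtain ⟨k, hk⟩ : ∃ k, d = k + 1 := ⟨d - 1, by omega⟩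
  have hk' : d - 1 = k := by omega
  rw [hk']
  obtain ⟨C, hC, hbound⟩ := exists_refSimplex_coeff_bound k m
  refine ⟨C * (k + 1) ^ k, by positivity, fun s f hs hf x₀ r hr hball c a ha => ?_⟩
  set e : Fin (k + 1) ≃ f := (f.equivFinOfCardEq (hf.2.trans hk)).symm
  obtain ⟨c', hc'a, hc'⟩ := sum_nodes_eq e (m := m) c
  obtain ⟨a', ha', hca⟩ := hc'a a ha
  have h1 := hbound c' a' ha'
  rw [hca] at h1
  set q : E k → ℝ := fun y => (∑ a ∈ (Finset.univ : Finset (Fin (k + 1))).finsuppAntidiag m,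
    c' a * ∏ i, refBary y i ^ a i) ^ 2 with hq
  have hqc : Continuous q := by
    refine (continuous_finsetSum _ fun a _ => continuous_const.mul ?_).pow 2
    exact continuous_finsetProd _ fun i _ => (continuous_refBary i).pow _
  have hq0 : ∀ y, 0 ≤ q y := fun y => sq_nonneg _
  have hL := lipschitzWith_facetChart e hs hr hball
  have hpt : ∀ x ∈ hull f, (∑ a ∈ nodes m f, c a * bern s a x) ^ 2 = q (facetChart s e x) := by
    intro x hx
    simp only [hq, bern, hc', refBary_facetChart e hs hf.1 hx]
  have hclosed : MeasurableSet (hull f) := (isClosed_hull f).measurableSet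
  rw [setIntegral_congr_fun hclosed hpt]
  have hfin : μHE[k] (hull f) < ⊤ := euclideanHausdorffMeasure_hull_lt_top hs hf.1 e
  have hintg : IntegrableOn (fun x => q (facetChart s e x)) (hull f) μHE[k] :=
    (hqc.comp hL.continuous).continuousOn.integrableOn_of_subset_isCompact (isCompact_hull f)
      hclosed subset_rfl hfin.ne
  set κ : ℝ := (k + 1) / r with hκ
  have hκ0 : 0 < κ := by positivity
  have h2 : ∫ y in refSimplex k, q y ≤ κ ^ k * ∫ x in hull f, q (facetChart s e x) ∂μHE[k] := by
    rw [integral_eq_lintegral_of_nonneg_ae (Filter.Eventually.of_forall hq0)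
      hqc.aestronglyMeasurable, integral_eq_lintegral_of_nonneg_ae
      (Filter.Eventually.of_forall fun x => hq0 _) hintg.aestronglyMeasurable]
    have h3 : ∫⁻ y in refSimplex k, ENNReal.ofReal (q y) ≤ ENNReal.ofReal (κ ^ k) *
        ∫⁻ x in hull f, ENNReal.ofReal (q (facetChart s e x)) ∂μHE[k] := by
      refine (lintegral_mono' (volume_restrict_refSimplex_le e hs hf.1 hr hball) le_rfl).trans ?_
      rw [lintegral_smul_measure, lintegral_map (hqc.measurable.ennreal_ofReal)
        hL.continuous.measurable, ENNReal.ofReal_pow hκ0.le]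
      rfl
    have hne : ∫⁻ x in hull f, ENNReal.ofReal (q (facetChart s e x)) ∂μHE[k] ≠ ⊤ := by
      have := hintg.lintegral_lt_top
      exact this.ne
    have h4 := ENNReal.toReal_mono (ENNReal.mul_ne_top ENNReal.ofReal_ne_top hne) h3
    rwa [ENNReal.toReal_mul, ENNReal.toReal_ofReal (by positivity)] at h4
  calc c a ^ 2 * r ^ k ≤ (C * (κ ^ k * ∫ x in hull f, q (facetChart s e x) ∂μHE[k])) * r ^ k := by
        gcongr
        exact h1.trans (by gcongr)
    _ = _ := by rw [hκ, div_pow]; field_simp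

end

section

/-! ### The Bernstein form of polynomials on a simplex -/

/-- Each Cartesian coordinate is a linear form in the barycentric ones. Multiplying every monomial
by a power of their sum, which is 1, makes the polynomial homogeneous of degree `m`. -/
theorem exists_bern_coeff {s : Finset (E d)} (hs : IsSimplex s) {m : ℕ}
    {p : MvPolynomial (Fin d) ℝ} (hp : p.totalDegree ≤ m) : ∃ c : (E d →₀ ℕ) → ℝ, ∀ x : E d,
      MvPolynomial.eval (fun l => x l) p = ∑ a ∈ nodes m s, c a * bern s a x := by
  classical
  set P : MvPolynomial (E d) ℝ := ∑ b ∈ p.support, MvPolynomial.C (p.coeff b) *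
    ((∏ l, (∑ v ∈ s, MvPolynomial.C (v l) * MvPolynomial.X v) ^ b l) *
      (∑ v ∈ s, MvPolynomial.X v) ^ (m - ∑ l, b l)) with hP
  have hPh : P.IsHomogeneous m := by
    refine MvPolynomial.IsHomogeneous.sum _ _ _ fun b hb => ?_
    have hbm : ∑ l, b l ≤ m := by
      have := (MvPolynomial.le_totalDegree hb).trans hp
      rwa [Finsupp.sum_fintype _ _ fun _ => rfl] at this
    have h1 : (∏ l, (∑ v ∈ s, MvPolynomial.C (v l) * MvPolynomial.X v) ^ b l :
        MvPolynomial (E d) ℝ).IsHomogeneous (∑ l, b l) := by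
      refine MvPolynomial.IsHomogeneous.prod _ _ _ fun l _ => ?_
      have h2 : (∑ v ∈ s, MvPolynomial.C (v l) * MvPolynomial.X v :
          MvPolynomial (E d) ℝ).IsHomogeneous 1 :=
        MvPolynomial.IsHomogeneous.sum _ _ _ fun v _ => by
          simpa using (MvPolynomial.isHomogeneous_C (E d) (v l)).mul
            (MvPolynomial.isHomogeneous_X ℝ v)
      simpa using h2.pow (b l)
    have h3 : (∑ v ∈ s, MvPolynomial.X v : MvPolynomial (E d) ℝ).IsHomogeneous 1 :=
      MvPolynomial.IsHomogeneous.sum _ _ _ fun v _ => MvPolynomial.isHomogeneous_X ℝ v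
    have h4 := (MvPolynomial.isHomogeneous_C (E d) (p.coeff b)).mul (h1.mul (h3.pow (m - ∑ l, b l)))
    convert h4 using 1
    omega
  refine ⟨fun a => P.coeff a, fun x => ?_⟩
  have h1 : MvPolynomial.eval (fun v => bary s v x) P = MvPolynomial.eval (fun l => x l) p := by
    rw [hP, map_sum, MvPolynomial.eval_eq']
    refine Finset.sum_congr rfl fun b _ => ?_
    have h2 : ∀ l, ∑ v ∈ s, v l * bary s v x = x l := fun l => by
      have := congrArg (fun z : E d => z l) (hs.sum_bary_smul x)
      simp only [WithLp.ofLp_sum, Finset.sum_apply, PiLp.smul_apply, smul_eq_mul] at this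
      rw [← this]
      exact Finset.sum_congr rfl fun v _ => mul_comm _ _
    simp only [map_mul, map_prod, map_pow, map_sum, MvPolynomial.eval_C, MvPolynomial.eval_X, h2,
      hs.sum_bary, one_pow, mul_one]
  rw [← h1, MvPolynomial.eval_eq]
  -- Monomials involving points outside `s` contribute nothing, as their coordinates are zero by
  -- convention.
  refine Finset.sum_congr_of_eq_on_inter (fun a ha hna => ?_) (fun a _ ha => ?_) fun a _ _ => rfl
  · have hdeg : a.sum (fun _ n => n) = m := by
      have := hPh (MvPolynomial.mem_support_iff.1 ha)
      simpa [Finsupp.weight_apply] using this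
    have : ¬ a.support ⊆ s := fun h => hna (mem_nodes.2 ⟨hdeg, h⟩)
    obtain ⟨v, hv, hvs⟩ := Finset.not_subset.1 this
    exact mul_eq_zero_of_right _ (bern_eq_zero hv (bary_of_notMem hvs x))
  · simp only [MvPolynomial.notMem_support_iff.1 ha, zero_mul]

theorem exists_poly_of_affine (φ : E d →ᵃ[ℝ] ℝ) : ∃ p : MvPolynomial (Fin d) ℝ,
    p.totalDegree ≤ 1 ∧ ∀ x : E d, MvPolynomial.eval (fun l => x l) p = φ x := by
  refine ⟨MvPolynomial.C (φ 0) + ∑ l, MvPolynomial.C (φ.linear (EuclideanSpace.single l 1)) *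
    MvPolynomial.X l, ?_, fun x => ?_⟩
  · refine (MvPolynomial.totalDegree_add _ _).trans (max_le (by simp) ?_)
    refine MvPolynomial.totalDegree_finsetSum_le fun l _ => ?_
    refine (MvPolynomial.totalDegree_mul _ _).trans ?_
    simp
  · have h1 : φ x = φ.linear x + φ 0 := by
      have := φ.map_vadd 0 x
      simpa using this
    have h2 : x = ∑ l, x l • (EuclideanSpace.single l (1 : ℝ) : E d) := by
      ext j; simp [Finset.sum_apply, Pi.single_apply]
    have h3 : φ.linear x = ∑ l, x l * φ.linear (EuclideanSpace.single l 1) := by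
      conv_lhs => rw [h2, map_sum]
      simp
    rw [h1, h3]
    simp [mul_comm, add_comm]

theorem exists_poly_of_bern (s : Finset (E d)) (m : ℕ) (c : (E d →₀ ℕ) → ℝ) :
    ∃ p : MvPolynomial (Fin d) ℝ, p.totalDegree ≤ m ∧ ∀ x : E d,
      MvPolynomial.eval (fun l => x l) p = ∑ a ∈ nodes m s, c a * bern s a x := by
  choose B hB1 hB2 using fun v => exists_poly_of_affine (bary s v)
  refine ⟨∑ a ∈ nodes m s, MvPolynomial.C (c a) * ∏ v ∈ a.support, B v ^ a v, ?_, fun x => ?_⟩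
  · refine MvPolynomial.totalDegree_finsetSum_le fun a ha => ?_
    refine (MvPolynomial.totalDegree_mul _ _).trans ?_
    rw [MvPolynomial.totalDegree_C, zero_add]
    refine (MvPolynomial.totalDegree_finsetProd _ _).trans ?_
    rw [← (mem_nodes.1 ha).1, Finsupp.sum]
    refine Finset.sum_le_sum fun v _ => (MvPolynomial.totalDegree_pow _ _).trans ?_
    calc a v * (B v).totalDegree ≤ a v * 1 := Nat.mul_le_mul_left _ (hB1 v)
      _ = a v := mul_one _
  · simp only [map_sum, map_mul, map_prod, map_pow, MvPolynomial.eval_C, hB2]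
    rfl

theorem abs_pow_sub_pow_le_mul {x y : ℝ} (hx : x ∈ Icc (0 : ℝ) 1) (hy : y ∈ Icc (0 : ℝ) 1) (n : ℕ) :
    |x ^ n - y ^ n| ≤ n * |x - y| := by
  induction n with
  | zero => simp
  | succ n ih =>
    have h1 : x ^ (n + 1) - y ^ (n + 1) = x * (x ^ n - y ^ n) + (x - y) * y ^ n := by ring
    have h2 : |y ^ n| ≤ 1 := by
      rw [abs_of_nonneg (pow_nonneg hy.1 n)]; exact pow_le_one₀ hy.1 hy.2
    rw [h1]
    calc |x * (x ^ n - y ^ n) + (x - y) * y ^ n|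
        ≤ |x| * |x ^ n - y ^ n| + |x - y| * |y ^ n| := by
          rw [← abs_mul, ← abs_mul]; exact abs_add_le _ _
      _ ≤ 1 * (n * |x - y|) + |x - y| * 1 := by
          gcongr
          rw [abs_of_nonneg hx.1]; exact hx.2
      _ = _ := by push_cast; ring

theorem abs_prod_pow_sub_prod_pow_le {ι : Type*} (t : Finset ι) {x y : ι → ℝ}
    (hx : ∀ i, x i ∈ Icc (0 : ℝ) 1) (hy : ∀ i, y i ∈ Icc (0 : ℝ) 1) (n : ι → ℕ) :
    |∏ i ∈ t, x i ^ n i - ∏ i ∈ t, y i ^ n i| ≤ ∑ i ∈ t, n i * |x i - y i| := by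
  classical
  induction t using Finset.induction_on with
  | empty => simp
  | insert i t hi ih =>
    rw [Finset.prod_insert hi, Finset.prod_insert hi, Finset.sum_insert hi]
    have h1 : x i ^ n i * ∏ i ∈ t, x i ^ n i - y i ^ n i * ∏ i ∈ t, y i ^ n i =
        (x i ^ n i - y i ^ n i) * ∏ i ∈ t, x i ^ n i +
          y i ^ n i * (∏ i ∈ t, x i ^ n i - ∏ i ∈ t, y i ^ n i) := by ring
    have h2 : |∏ i ∈ t, x i ^ n i| ≤ 1 := by
      rw [abs_of_nonneg (Finset.prod_nonneg fun i _ => pow_nonneg (hx i).1 _)]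
      exact Finset.prod_le_one (fun i _ => pow_nonneg (hx i).1 _)
        fun i _ => pow_le_one₀ (hx i).1 (hx i).2
    have h3 : |y i ^ n i| ≤ 1 := by
      rw [abs_of_nonneg (pow_nonneg (hy i).1 _)]; exact pow_le_one₀ (hy i).1 (hy i).2
    rw [h1]
    refine (abs_add_le _ _).trans ?_
    rw [abs_mul, abs_mul]
    calc _ ≤ (n i * |x i - y i|) * 1 + 1 * ∑ i ∈ t, n i * |x i - y i| := by
          gcongr
          exact abs_pow_sub_pow_le_mul (hx i) (hy i) _
      _ = _ := by ring

theorem IsSimplex.bary_mem_Icc {s : Finset (E d)} (hs : IsSimplex s) {x : E d} (hx : x ∈ hull s)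
    (v : E d) : bary s v x ∈ Icc (0 : ℝ) 1 :=
  ⟨hs.mem_hull_iff.1 hx v, hs.bary_le_one hx v⟩

theorem IsSimplex.abs_bern_le_one {s : Finset (E d)} (hs : IsSimplex s) {x : E d}
    (hx : x ∈ hull s) (a : E d →₀ ℕ) : |bern s a x| ≤ 1 := by
  rw [bern, Finsupp.prod,
    abs_of_nonneg (Finset.prod_nonneg fun v _ => pow_nonneg (hs.bary_mem_Icc hx v).1 _)]
  exact Finset.prod_le_one (fun v _ => pow_nonneg (hs.bary_mem_Icc hx v).1 _)
    fun v _ => pow_le_one₀ (hs.bary_mem_Icc hx v).1 (hs.bary_mem_Icc hx v).2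

theorem IsSimplex.abs_bern_sub_le {s : Finset (E d)} (hs : IsSimplex s) {x₀ : E d} {r : ℝ}
    (hr : 0 < r) (hball : Metric.closedBall x₀ r ⊆ hull s) {x y : E d} (hx : x ∈ hull s)
    (hy : y ∈ hull s) {m : ℕ} {a : E d →₀ ℕ} (ha : a ∈ nodes m s) :
    |bern s a x - bern s a y| ≤ m / r * ‖x - y‖ := by
  refine (abs_prod_pow_sub_prod_pow_le a.support (hs.bary_mem_Icc hx) (hs.bary_mem_Icc hy)
    a).trans ?_
  calc ∑ v ∈ a.support, (a v : ℝ) * |bary s v x - bary s v y|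
      ≤ ∑ v ∈ a.support, (a v : ℝ) * (‖x - y‖ / r) := Finset.sum_le_sum fun v _ => by
        gcongr; exact hs.abs_bary_sub_le hr hball v x y
    _ = m / r * ‖x - y‖ := by
        rw [← Finset.sum_mul, ← Nat.cast_sum, show ∑ v ∈ a.support, a v = m from (mem_nodes.1 ha).1]
        ring

theorem IsSimplex.abs_sum_bern_le {s : Finset (E d)} (hs : IsSimplex s) {x : E d}
    (hx : x ∈ hull s) {m : ℕ} (c : (E d →₀ ℕ) → ℝ) :
    |∑ a ∈ nodes m s, c a * bern s a x| ≤ ∑ a ∈ nodes m s, |c a| := by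
  refine (Finset.abs_sum_le_sum_abs _ _).trans (Finset.sum_le_sum fun a _ => ?_)
  rw [abs_mul]
  exact mul_le_of_le_one_right (abs_nonneg _) (hs.abs_bern_le_one hx a)

theorem IsSimplex.lipschitzOnWith_sum_bern {s : Finset (E d)} (hs : IsSimplex s) {x₀ : E d} {r : ℝ}
    (hr : 0 < r) (hball : Metric.closedBall x₀ r ⊆ hull s) {m : ℕ} (c : (E d →₀ ℕ) → ℝ) :
    LipschitzOnWith (Real.toNNReal (m / r * ∑ a ∈ nodes m s, |c a|))
      (fun x => ∑ a ∈ nodes m s, c a * bern s a x) (hull s) := by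
  refine LipschitzOnWith.of_dist_le_mul fun x hx y hy => ?_
  rw [Real.coe_toNNReal _ (by positivity), Real.dist_eq, dist_eq_norm, ← Finset.sum_sub_distrib]
  refine (Finset.abs_sum_le_sum_abs _ _).trans ?_
  rw [mul_right_comm, Finset.mul_sum]
  refine Finset.sum_le_sum fun a ha => ?_
  rw [← mul_sub, abs_mul, mul_comm]
  gcongr
  exact hs.abs_bern_sub_le hr hball hx hy ha

/-! ### Traces of piecewise polynomials -/

theorem traceFrom_eq {K : Set (E d)} {W : E d → Matrix (Fin d) (Fin d) ℝ} {i j : Fin d}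
    {F : E d → ℝ} (hF : Continuous F) (hW : ∀ x ∈ interior K, W x i j = F x) {x : E d}
    (hx : x ∈ closure (interior K)) : traceFrom K W x i j = F x := by
  refine extendFrom_eq hx ((hF.tendsto x).mono_left nhdsWithin_le_nhds |>.congr' ?_)
  filter_upwards [self_mem_nhdsWithin] with y hy
  exact (hW y hy).symm

theorem continuous_eval (p : MvPolynomial (Fin d) ℝ) :
    Continuous fun x : E d => MvPolynomial.eval (fun l => x l) p :=
  (MvPolynomial.continuous_eval p).comp (by fun_prop)

theorem continuous_sum_bern (s : Finset (E d)) (m : ℕ) (c : (E d →₀ ℕ) → ℝ) :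
    Continuous fun x => ∑ a ∈ nodes m s, c a * bern s a x :=
  continuous_finsetSum _ fun a _ => continuous_const.mul (continuous_bern s a)

/-- On a face only the Bernstein polynomials of the face contribute. -/
theorem IsSimplex.sum_bern_face {s f : Finset (E d)} (hs : IsSimplex s) (hf : f ⊆ s) {m : ℕ}
    (c : (E d →₀ ℕ) → ℝ) {x : E d} (hx : x ∈ hull f) :
    ∑ a ∈ nodes m s, c a * bern s a x = ∑ a ∈ nodes m f, c a * bern s a x := by
  symm
  refine Finset.sum_subset (nodes_mono hf) fun a ha hna => ?_
  have : ¬ a.support ⊆ f := fun h => hna (mem_nodes.2 ⟨(mem_nodes.1 ha).1, h⟩)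
  obtain ⟨v, hv, hvf⟩ := Finset.not_subset.1 this
  rw [bern_eq_zero hv (((hs.mem_hull_subset_iff hf).1 hx).2 v hvf), mul_zero]

theorem Triangulation.bern_congr {Ω : Set (E d)} (T : Triangulation Ω) {s t : Finset (E d)}
    (hs : s ∈ T.cells) (ht : t ∈ T.cells) {x : E d} (hxs : x ∈ hull s) (hxt : x ∈ hull t)
    (a : E d →₀ ℕ) : bern s a x = bern t a x := by
  simp only [bern, T.bary_congr hs ht hxs hxt]

end

section

/-! ### Face integrals -/

open scoped MeasureTheory

variable {Ω : Set (E d)} (M : PolyMesh Ω)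

/-- The facet `f` of the simplex `s` is part of the face `e`. -/
def Touches (s : Finset (E d)) (e : Set (E d)) : Prop := ∃ f, IsFacetOf f s ∧ hull f ⊆ e

/-- The squared norm of the jump on an interior face. -/
def PolyMesh.jumpSq (V : E d → Matrix (Fin d) (Fin d) ℝ) (e : Set (E d)) : ℝ :=
  ∫ x in e, tensorNormSq (M.tensorJump V e x) ∂μHE[d - 1]

/-- The squared norm of the tangential trace on a boundary face. -/
def PolyMesh.tangSq (V : E d → Matrix (Fin d) (Fin d) ℝ) (e : Set (E d)) : ℝ :=
  ∫ x in e, crossNormSq (M.tangentialTrace V e x) ∂μHE[d - 1]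

open Classical in
/-- The squared norms of the jumps and tangential traces on the faces touching the simplex `t`. -/
def PolyMesh.cellSq (V : E d → Matrix (Fin d) (Fin d) ℝ) (t : Finset (E d)) : ℝ :=
  ∑ e ∈ M.intFaces.filter (Touches t), M.jumpSq V e +
    ∑ e ∈ M.bdFaces.filter (Touches t), M.tangSq V e

theorem tensorNormSq_nonneg (a : Fin d → Fin d → Fin d → ℝ) : 0 ≤ tensorNormSq a :=
  Finset.sum_nonneg fun _ _ => Finset.sum_nonneg fun _ _ => Finset.sum_nonneg fun _ _ =>
    sq_nonneg _

theorem crossNormSq_nonneg (a : Fin d → Fin d → Fin d → ℝ) : 0 ≤ crossNormSq a :=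
  Finset.sum_nonneg fun _ _ => Finset.sum_nonneg fun _ _ => Finset.sum_nonneg fun _ _ =>
    sq_nonneg _

theorem PolyMesh.jumpSq_nonneg (V : E d → Matrix (Fin d) (Fin d) ℝ) (e : Set (E d)) :
    0 ≤ M.jumpSq V e := integral_nonneg fun _ => tensorNormSq_nonneg _

theorem PolyMesh.tangSq_nonneg (V : E d → Matrix (Fin d) (Fin d) ℝ) (e : Set (E d)) :
    0 ≤ M.tangSq V e := integral_nonneg fun _ => crossNormSq_nonneg _

theorem PolyMesh.cellSq_nonneg (V : E d → Matrix (Fin d) (Fin d) ℝ) (t : Finset (E d)) :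
    0 ≤ M.cellSq V t :=
  add_nonneg (Finset.sum_nonneg fun _ _ => M.jumpSq_nonneg V _)
    (Finset.sum_nonneg fun _ _ => M.tangSq_nonneg V _)

variable {M} in
theorem PolyMesh.jumpSq_le_cellSq {V : E d → Matrix (Fin d) (Fin d) ℝ} {e : Set (E d)}
    (he : e ∈ M.intFaces) {t : Finset (E d)} (ht : Touches t e) : M.jumpSq V e ≤ M.cellSq V t := by
  classical
  refine le_add_of_le_of_nonneg ?_ (Finset.sum_nonneg fun _ _ => M.tangSq_nonneg V _)
  exact Finset.single_le_sum (f := fun e => M.jumpSq V e) (fun e _ => M.jumpSq_nonneg V e)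
    (Finset.mem_filter.2 ⟨he, ht⟩)

variable {M} in
theorem PolyMesh.tangSq_le_cellSq {V : E d → Matrix (Fin d) (Fin d) ℝ} {e : Set (E d)}
    (he : e ∈ M.bdFaces) {t : Finset (E d)} (ht : Touches t e) : M.tangSq V e ≤ M.cellSq V t := by
  classical
  refine le_add_of_nonneg_of_le (Finset.sum_nonneg fun _ _ => M.jumpSq_nonneg V _) ?_
  exact Finset.single_le_sum (f := fun e => M.tangSq V e) (fun e _ => M.tangSq_nonneg V e)
    (Finset.mem_filter.2 ⟨he, ht⟩)

theorem Triangulation.finite_facets (T : Triangulation Ω) : T.facets.Finite := by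
  classical
  refine (T.cells.biUnion Finset.powerset).finite_toSet.subset ?_
  rintro f ⟨s, hs, hf⟩
  exact Finset.mem_coe.2 (Finset.mem_biUnion.2 ⟨s, hs, Finset.mem_powerset.2 hf.1⟩)

theorem PolyMesh.isCompact_face {e : Set (E d)} (he : e ∈ M.intFaces ∨ e ∈ M.bdFaces) :
    IsCompact e := by
  rw [M.face_eq e he]
  exact (M.sub.finite_facets.subset fun f hf => hf.1).isCompact_biUnion fun f _ => isCompact_hull f

theorem PolyMesh.measure_face_lt_top (hd : 1 ≤ d) {e : Set (E d)}
    (he : e ∈ M.intFaces ∨ e ∈ M.bdFaces) : μHE[d - 1] e < ⊤ := by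
  rw [M.face_eq e he]
  refine measure_biUnion_lt_top (M.sub.finite_facets.subset fun f hf => hf.1) ?_
  rintro f ⟨⟨s, hs, hf⟩, -⟩
  exact measure_facet_lt_top hd (M.sub.isSimplex hs) hf

/-- The integral over a facet is bounded by the integral over the face containing it. -/
theorem PolyMesh.integral_facet_le (hd : 1 ≤ d) {e : Set (E d)}
    (he : e ∈ M.intFaces ∨ e ∈ M.bdFaces) {f : Finset (E d)} (hfe : hull f ⊆ e)
    {g h H : E d → ℝ} (hg : Continuous g) (hH : Continuous H) (hhH : ∀ x ∈ e, h x = H x)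
    (h0 : ∀ x, 0 ≤ h x) (hgh : ∀ x ∈ hull f, g x ≤ h x) :
    ∫ x in hull f, g x ∂μHE[d - 1] ≤ ∫ x in e, h x ∂μHE[d - 1] := by
  have hec := M.isCompact_face he
  have hem := hec.isClosed.measurableSet
  have hfin := (M.measure_face_lt_top hd he).ne
  have hintg : IntegrableOn h e μHE[d - 1] := by
    refine (integrableOn_congr_fun hhH hem).2 ?_
    exact hH.continuousOn.integrableOn_of_subset_isCompact hec hem subset_rfl hfin
  have hfm : MeasurableSet (hull f) := (isClosed_hull f).measurableSet
  have hfint : IntegrableOn g (hull f) μHE[d - 1] :=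
    hg.continuousOn.integrableOn_of_subset_isCompact hec hfm hfe
      (ne_top_of_le_ne_top hfin (measure_mono hfe))
  calc ∫ x in hull f, g x ∂μHE[d - 1] ≤ ∫ x in hull f, h x ∂μHE[d - 1] :=
        setIntegral_mono_on hfint (hintg.mono_set hfe) hfm hgh
    _ ≤ _ := setIntegral_mono_set hintg (Filter.Eventually.of_forall h0)
        (Filter.Eventually.of_forall hfe)

/-! ### Bernstein form of a piecewise polynomial tensor -/

/-- The polynomials representing `V` on the elements, and their Bernstein coefficients on the
simplices. -/
structure BernForm (m : ℕ) (V : E d → Matrix (Fin d) (Fin d) ℝ) where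
  poly : Set (E d) → Fin d → Fin d → E d → ℝ
  coef : Finset (E d) → (E d →₀ ℕ) → Fin d → Fin d → ℝ
  cont : ∀ K ∈ M.elements, ∀ i j, Continuous (poly K i j)
  eq_poly : ∀ K ∈ M.elements, ∀ i j, ∀ x ∈ interior K, V x i j = poly K i j x
  eq_bern : ∀ K ∈ M.elements, ∀ s ∈ M.sub.subcells K, ∀ i j x,
    poly K i j x = ∑ a ∈ nodes m s, coef s a i j * bern s a x

variable {M}

theorem PolyMesh.IsPiecewisePoly.nonempty_bernForm {m : ℕ}
    {V : E d → Matrix (Fin d) (Fin d) ℝ} (hV : M.IsPiecewisePoly m V) :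
    Nonempty (BernForm M m V) := by
  choose! p hp1 hp2 using hV
  have hc : ∀ s, ∃ c : (E d →₀ ℕ) → Fin d → Fin d → ℝ, ∀ K ∈ M.elements, s ∈ M.sub.subcells K →
      ∀ i j x, MvPolynomial.eval (fun l => x l) (p K i j) =
        ∑ a ∈ nodes m s, c a i j * bern s a x := by
    intro s
    by_cases h : ∃ K ∈ M.elements, s ∈ M.sub.subcells K
    · obtain ⟨K, hK, hs⟩ := h
      choose c hc using fun i j => exists_bern_coeff
        (M.sub.isSimplex (Triangulation.mem_subcells.1 hs).1) (hp1 K hK i j)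
      refine ⟨fun a i j => c i j a, fun L hL hsL i j x => ?_⟩
      obtain rfl := M.element_unique hK hL hs hsL
      exact hc i j x
    · exact ⟨0, fun K hK hs => absurd ⟨K, hK, hs⟩ h⟩
  choose c hc using hc
  exact ⟨⟨fun K i j x => MvPolynomial.eval (fun l => x l) (p K i j), c,
    fun K _ i j => continuous_eval _, fun K hK i j x hx => hp2 K hK i j x hx,
    fun K hK s hs => hc s K hK hs⟩⟩

variable {m : ℕ} {V : E d → Matrix (Fin d) (Fin d) ℝ} (B : BernForm M m V)

theorem BernForm.traceFrom_eq {K : Set (E d)} (hK : K ∈ M.elements) {x : E d} (hx : x ∈ K)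
    (i j : Fin d) : traceFrom K V x i j = B.poly K i j x :=
  PolyFEM.traceFrom_eq (B.cont K hK i j) (B.eq_poly K hK i j) (M.subset_closure_interior hK hx)

/-- Differences of Bernstein coefficients across a facet are controlled by the jumps. -/
theorem BernForm.coef_sub_sq_le (hd : 1 ≤ d) {C : ℝ} (hC : 0 < C)
    (hbound : FacetBound d m C)
    {s t f : Finset (E d)} (hs : s ∈ M.sub.cells) (ht : t ∈ M.sub.cells) (hfs : IsFacetOf f s)
    (hft : IsFacetOf f t) {x₀ : E d} {r : ℝ} (hr : 0 < r) (hball : Metric.closedBall x₀ r ⊆ hull s)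
    {a : E d →₀ ℕ} (ha : a ∈ nodes m f) (i j : Fin d) :
    (B.coef s a i j - B.coef t a i j) ^ 2 * r ^ (d - 1) ≤ C * M.cellSq V s := by
  obtain ⟨K, hK, hsK⟩ := M.exists_element hs
  obtain ⟨L, hL, htL⟩ := M.exists_element ht
  have hS := M.sub.isSimplex hs
  have hT := M.sub.isSimplex ht
  refine (hbound s f hS hfs x₀ r hr hball (fun a => B.coef s a i j - B.coef t a i j) a ha).trans ?_
  refine mul_le_mul_of_nonneg_left ?_ hC.le
  have hpt : ∀ x ∈ hull f, (∑ a ∈ nodes m f, (B.coef s a i j - B.coef t a i j) * bern s a x) ^ 2 =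
      (B.poly K i j x - B.poly L i j x) ^ 2 := by
    intro x hx
    rw [B.eq_bern K hK s hsK i j x, B.eq_bern L hL t htL i j x, hS.sum_bern_face hfs.1 _ hx,
      hT.sum_bern_face hft.1 _ hx, ← Finset.sum_sub_distrib]
    congr 1
    refine Finset.sum_congr rfl fun a _ => ?_
    rw [M.sub.bern_congr hs ht (hull_mono hfs.1 hx) (hull_mono hft.1 hx), sub_mul]
  rw [setIntegral_congr_fun (isClosed_hull f).measurableSet hpt]
  -- Inside one element both simplices carry the same polynomial, so the difference is zero and no
  -- mesh face is needed.
  by_cases hKL : K = L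
  · subst hKL
    simpa using M.cellSq_nonneg V s
  · have hfK := (hull_mono hfs.1).trans (Triangulation.mem_subcells.1 hsK).2
    have hfL := (hull_mono hft.1).trans (Triangulation.mem_subcells.1 htL).2
    obtain ⟨e, ⟨he, hfe⟩, -⟩ := M.intFace_cover f ⟨s, hs, hfs⟩ K hK L hL hKL
      (subset_inter hfK hfL)
    have hjump := M.tensorJump_eq hd hK hL hKL hsK htL hfs hft he hfe V
    have heK : e ⊆ K := (hjump 0).1
    have heL : e ⊆ L := (hjump 0).2.1
    refine le_trans ?_ (PolyMesh.jumpSq_le_cellSq he ⟨f, hfs, hfe⟩)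
    have hval : ∀ x ∈ e, tensorNormSq (M.tensorJump V e x) =
        ∑ i, ∑ j, (B.poly K i j x - B.poly L i j x) ^ 2 := fun x hx => by
      rw [(hjump x).2.2]
      simp only [B.traceFrom_eq hK (heK hx), B.traceFrom_eq hL (heL hx)]
    refine M.integral_facet_le hd (Or.inl he) hfe
      (((B.cont K hK i j).sub (B.cont L hL i j)).pow 2)
      (continuous_finsetSum _ fun i _ => continuous_finsetSum _ fun j _ =>
        ((B.cont K hK i j).sub (B.cont L hL i j)).pow 2) hval
      (fun x => tensorNormSq_nonneg _) fun x hx => ?_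
    rw [hval x (hfe hx)]
    refine le_trans ?_ (Finset.single_le_sum (f := fun i => ∑ j, (B.poly K i j x -
      B.poly L i j x) ^ 2) (fun i _ => Finset.sum_nonneg fun j _ => sq_nonneg _) (Finset.mem_univ i))
    exact Finset.single_le_sum (f := fun j => (B.poly K i j x - B.poly L i j x) ^ 2)
      (fun j _ => sq_nonneg _) (Finset.mem_univ j)

/-- Entries with `i > j` are not counted in the norm, but they are the negatives of counted ones. -/
theorem sq_le_crossNormSq (n : E d) (τ : Matrix (Fin d) (Fin d) ℝ) (i j c : Fin d) :
    (n i * τ j c - n j * τ i c) ^ 2 ≤ crossNormSq (crossCols n τ) := by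
  have key : ∀ i j, i < j → (n i * τ j c - n j * τ i c) ^ 2 ≤ crossNormSq (crossCols n τ) := by
    intro i j hij
    unfold crossNormSq
    refine le_trans ?_ (Finset.single_le_sum (f := fun c => ∑ i, ∑ j ∈ Finset.Ioi i,
      crossCols n τ c i j ^ 2) (fun c _ => Finset.sum_nonneg fun _ _ => Finset.sum_nonneg
        fun _ _ => sq_nonneg _) (Finset.mem_univ c))
    refine le_trans ?_ (Finset.single_le_sum (f := fun i => ∑ j ∈ Finset.Ioi i,
      crossCols n τ c i j ^ 2) (fun i _ => Finset.sum_nonneg fun _ _ => sq_nonneg _)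
        (Finset.mem_univ i))
    exact Finset.single_le_sum (f := fun j => crossCols n τ c i j ^ 2)
      (fun j _ => sq_nonneg _) (Finset.mem_Ioi.2 hij)
  rcases lt_trichotomy i j with h | rfl | h
  · exact key i j h
  · simpa using crossNormSq_nonneg _
  · calc _ = (n j * τ i c - n i * τ j c) ^ 2 := by ring
      _ ≤ _ := key j i h

/-- The tangential components of the Bernstein coefficients on a boundary facet are controlled by
the tangential trace. -/
theorem BernForm.cross_coef_sq_le (hd : 1 ≤ d) (hΩ : IsConvexPolytopeDomain Ω) {C : ℝ} (hC : 0 < C)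
    (hbound : FacetBound d m C)
    {s f : Finset (E d)} (hs : s ∈ M.sub.cells) (hfs : IsFacetOf f s)
    (hf : hull f ⊆ frontier Ω) {n : E d} (hn : IsOuterNormal Ω (hull f) n)
    {x₀ : E d} {r : ℝ} (hr : 0 < r) (hball : Metric.closedBall x₀ r ⊆ hull s)
    {a : E d →₀ ℕ} (ha : a ∈ nodes m f) (i j c : Fin d) :
    (n i * B.coef s a j c - n j * B.coef s a i c) ^ 2 * r ^ (d - 1) ≤ C * M.cellSq V s := by
  obtain ⟨K, hK, hsK⟩ := M.exists_element hs
  have hS := M.sub.isSimplex hs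
  refine (hbound s f hS hfs x₀ r hr hball
    (fun a => n i * B.coef s a j c - n j * B.coef s a i c) a ha).trans ?_
  refine mul_le_mul_of_nonneg_left ?_ hC.le
  have hpt : ∀ x ∈ hull f,
      (∑ a ∈ nodes m f, (n i * B.coef s a j c - n j * B.coef s a i c) * bern s a x) ^ 2 =
      (n i * B.poly K j c x - n j * B.poly K i c x) ^ 2 := by
    intro x hx
    rw [B.eq_bern K hK s hsK j c x, B.eq_bern K hK s hsK i c x, hS.sum_bern_face hfs.1 _ hx,
      hS.sum_bern_face hfs.1 _ hx, Finset.mul_sum, Finset.mul_sum, ← Finset.sum_sub_distrib]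
    congr 1
    exact Finset.sum_congr rfl fun a _ => by ring
  rw [setIntegral_congr_fun (isClosed_hull f).measurableSet hpt]
  obtain ⟨e, ⟨he, hfe⟩, -⟩ := M.bdFace_cover f ⟨s, hs, hfs⟩ hf
  obtain ⟨heK, n', hn', htr⟩ := M.tangentialTrace_eq hd hΩ.convex hΩ.isOpen hΩ.1 hK hsK hfs he hfe V
  -- The normal of `Ω` is also an outer normal of the simplex, hence the one used in the mesh.
  obtain rfl : n = n' := IsOuterNormal.unique hd hS hfs (hn.mono (M.sub.hull_subset hs)) hn'
  refine le_trans ?_ (PolyMesh.tangSq_le_cellSq he ⟨f, hfs, hfe⟩)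
  have hval : ∀ x ∈ e, crossNormSq (M.tangentialTrace V e x) =
      crossNormSq (crossCols n fun i j => B.poly K i j x) := fun x hx => by
    rw [htr x]
    congr 2
    funext i j
    exact B.traceFrom_eq hK (heK hx) i j
  refine M.integral_facet_le hd (Or.inr he) hfe
    ((((B.cont K hK j c).const_mul _).sub ((B.cont K hK i c).const_mul _)).pow 2)
    (H := fun x => crossNormSq (crossCols n fun i j => B.poly K i j x)) ?_ hval
    (fun x => crossNormSq_nonneg _) fun x hx => ?_
  · refine continuous_finsetSum _ fun c _ => continuous_finsetSum _ fun i _ =>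
      continuous_finsetSum _ fun j _ => ?_
    exact (((B.cont K hK j c).const_mul _).sub ((B.cont K hK i c).const_mul _)).pow 2
  · rw [hval x (hfe hx)]
    exact sq_le_crossNormSq n (fun i j => B.poly K i j x) i j c

end

section

/-! ### Choice of the conforming coefficients -/

variable {Ω : Set (E d)} {M : PolyMesh Ω}

/-- The outer normals of `Ω` on the boundary facets that carry the multi-index `a`. -/
def Triangulation.nodeNormals (T : Triangulation Ω) (a : E d →₀ ℕ) : Set (E d) :=
  {n | ∃ s ∈ T.cells, ∃ f, IsFacetOf f s ∧ a.support ⊆ f ∧ hull f ⊆ frontier Ω ∧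
    IsOuterNormal Ω (hull f) n}

theorem support_nonempty {m : ℕ} (hm : 1 ≤ m) {s : Finset (E d)} {a : E d →₀ ℕ}
    (ha : a ∈ nodes m s) : a.support.Nonempty := by
  rw [Finset.nonempty_iff_ne_empty]
  intro h
  have := (mem_nodes.1 ha).1
  rw [Finsupp.sum, h, Finset.sum_empty] at this
  omega

theorem Triangulation.mem_star_centre {T : Triangulation Ω} {g s : Finset (E d)}
    (hg : g.Nonempty) (hs : s ∈ T.cells) (hgs : g ⊆ s) : s ∈ T.star (centre g) :=
  T.mem_star.2 ⟨hs, hull_mono hgs (centre_mem_hull hg)⟩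

variable {m : ℕ} {V : E d → Matrix (Fin d) (Fin d) ℝ} (B : BernForm M m V)

/-- Variation and tangential components of the Bernstein coefficients around a node. -/
theorem BernForm.star_bounds (hd : 2 ≤ d) (hΩ : IsConvexPolytopeDomain Ω) (hm : 1 ≤ m) {κ : ℝ}
    (hκ : 1 ≤ κ) (hT : M.sub.Regular κ) {C : ℝ} (hC : 0 < C) (hbound : FacetBound d m C)
    {s : Finset (E d)} (hs : s ∈ M.sub.cells) {a : E d →₀ ℕ} (ha : a ∈ nodes m s) :
    ∃ δ ≥ 0, δ ^ 2 * size s ^ (d - 1) = C * (sizeRatio d κ * κ) ^ (d - 1) *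
        ∑ t ∈ M.sub.patch s, M.cellSq V t ∧
      (∀ t ∈ M.sub.cells, a ∈ nodes m t → ∀ t' ∈ M.sub.cells, a ∈ nodes m t' → ∀ i j,
        |B.coef t a i j - B.coef t' a i j| ≤ κ ^ d * δ) ∧
      ∀ n ∈ M.sub.nodeNormals a, ∀ t ∈ M.sub.cells, a ∈ nodes m t → ∀ i j c,
        |n i * B.coef t a j c - n j * B.coef t a i c| ≤ (1 + 2 * κ ^ d) * δ := by
  have hconv : Convex ℝ (closure Ω) := hΩ.convex.closure
  have hsize : 0 < size s := (M.sub.isSimplex hs).size_pos (by omega)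
  have hΛ : 1 ≤ sizeRatio d κ := one_le_sizeRatio hκ
  set Λ := sizeRatio d κ
  set G := ∑ t ∈ M.sub.patch s, M.cellSq V t with hG
  have hG0 : 0 ≤ G := Finset.sum_nonneg fun t _ => M.cellSq_nonneg V t
  have hne := support_nonempty hm ha
  -- The simplices containing `z` are exactly those having `a` as a node.
  set z := centre a.support with hz
  -- One bound for all facet quantities in the star: the patch sum replaces the individual terms,
  -- and `Λ * κ` converts the inscribed radius of any star simplex into the size of `s`.
  set δ := Real.sqrt (C * (Λ * κ) ^ (d - 1) * G / size s ^ (d - 1)) with hδ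
  have hδ0 : 0 ≤ δ := Real.sqrt_nonneg _
  have hδsq : δ ^ 2 = C * (Λ * κ) ^ (d - 1) * G / size s ^ (d - 1) :=
    Real.sq_sqrt (by positivity)
  have hdeg := (mem_nodes.1 ha).1
  have hstar : ∀ t ∈ M.sub.star z, t ∈ M.sub.cells ∧ a ∈ nodes m t ∧ t ∈ M.sub.patch s := by
    intro t ht
    obtain ⟨ht, hzt⟩ := M.sub.mem_star.1 ht
    have hsub := M.sub.subset_of_centre_mem hs ht (mem_nodes.1 ha).2 hzt
    obtain ⟨v, hv⟩ := hne
    exact ⟨ht, mem_nodes.2 ⟨hdeg, hsub⟩,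
      M.sub.mem_patch.2 ⟨ht, v, (mem_nodes.1 ha).2 hv, hsub hv⟩⟩
  have hstar' : ∀ t ∈ M.sub.cells, a ∈ nodes m t → t ∈ M.sub.star z := fun t ht hat =>
    Triangulation.mem_star_centre hne ht (mem_nodes.1 hat).2
  have hle : ∀ t ∈ M.sub.star z, ∀ X r : ℝ, 0 < r → size t ≤ κ * r →
      X ^ 2 * r ^ (d - 1) ≤ C * M.cellSq V t → |X| ≤ δ := by
    intro t ht X r hr htr hX
    obtain ⟨htc, hat, htp⟩ := hstar t ht
    have h1 : size s ≤ Λ * κ * r := by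
      calc size s ≤ Λ * size t :=
            hT.size_le_of_mem_patch hconv hd hκ htc (M.sub.mem_patch_comm hs htp)
        _ ≤ Λ * (κ * r) := by gcongr
        _ = _ := by ring
    have h2 : M.cellSq V t ≤ G :=
      Finset.single_le_sum (f := fun t => M.cellSq V t) (fun t _ => M.cellSq_nonneg V t) htp
    refine Real.abs_le_sqrt ?_
    rw [le_div_iff₀ (by positivity)]
    calc X ^ 2 * size s ^ (d - 1) ≤ X ^ 2 * (Λ * κ * r) ^ (d - 1) := by gcongr
      _ = (Λ * κ) ^ (d - 1) * (X ^ 2 * r ^ (d - 1)) := by rw [mul_pow]; ring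
      _ ≤ (Λ * κ) ^ (d - 1) * (C * G) := by
        refine mul_le_mul_of_nonneg_left (hX.trans ?_) (by positivity)
        gcongr
      _ = _ := by ring
  have hchain : ∀ t ∈ M.sub.cells, a ∈ nodes m t → ∀ t' ∈ M.sub.cells, a ∈ nodes m t' → ∀ i j,
      |B.coef t a i j - B.coef t' a i j| ≤ κ ^ d * δ := by
    intro t ht hat t' ht' hat' i j
    have h := forall_of_connected (M.sub.star_connected hconv z)
      (P := fun n t' => |B.coef t a i j - B.coef t' a i j| ≤ n * δ) ?_ ?_ (hstar' t ht hat)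
      (by simp) t' (hstar' t' ht' hat')
    · exact h.trans (mul_le_mul_of_nonneg_right (hT.card_star_le (by omega) (by linarith) z) hδ0)
    · intro n b h
      refine h.trans (mul_le_mul_of_nonneg_right ?_ hδ0)
      push_cast; linarith
    · rintro n b hb b' hb' ⟨f, hfb, hfb', hzf⟩ h
      obtain ⟨hbc, hab, -⟩ := hstar b hb
      obtain ⟨x₀, r, hr, hball, hsz⟩ := hT b hbc
      -- The crossed facet contains `z`, whose coordinates are positive on the support of `a`; so
      -- the coefficient at `a` is visible on that facet.
      have haf : a ∈ nodes m f := by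
        refine mem_nodes.2 ⟨hdeg, fun v hv => ?_⟩
        by_contra hvf
        have h1 := (M.sub.isSimplex hbc).bary_centre_pos (mem_nodes.1 hab).2 hv
        exact h1.ne' ((((M.sub.isSimplex hbc).mem_hull_subset_iff hfb.1).1 hzf).2 v hvf)
      have h1 := hle b hb _ r hr hsz (B.coef_sub_sq_le (by omega) hC hbound hbc (hstar b' hb').1
        hfb hfb' hr hball haf i j)
      calc |B.coef t a i j - B.coef b' a i j|
          ≤ |B.coef t a i j - B.coef b a i j| + |B.coef b a i j - B.coef b' a i j| :=
            abs_sub_le _ _ _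
        _ ≤ n * δ + δ := add_le_add h h1
        _ = _ := by push_cast; ring
  refine ⟨δ, hδ0, by rw [hδsq]; field_simp, hchain, ?_⟩
  rintro n ⟨t', ht', f, hft', haf, hfΩ, hn⟩ t ht hat i j c
  have hat' : a ∈ nodes m t' := mem_nodes.2 ⟨hdeg, haf.trans hft'.1⟩
  obtain ⟨x₀, r, hr, hball, hsz⟩ := hT t' ht'
  have h1 := hle t' (hstar' t' ht' hat') _ r hr hsz (B.cross_coef_sq_le (by omega) hΩ hC hbound ht'
    hft' hfΩ hn hr hball (mem_nodes.2 ⟨hdeg, haf⟩) i j c)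
  have hni : ∀ i, |n i| ≤ 1 := fun i => by
    have := PiLp.norm_apply_le n i
    rwa [hn.1] at this
  -- The condition is known on the simplex `t'` at the boundary. Moving it to `t` costs two
  -- coefficient differences, whence `1 + 2 * κ ^ d`.
  have h2 : n i * B.coef t a j c - n j * B.coef t a i c =
      (n i * B.coef t' a j c - n j * B.coef t' a i c) +
        n i * (B.coef t a j c - B.coef t' a j c) - n j * (B.coef t a i c - B.coef t' a i c) := by
    ring
  rw [h2]
  calc _ ≤ |n i * B.coef t' a j c - n j * B.coef t' a i c| +
        |n i * (B.coef t a j c - B.coef t' a j c)| + |n j * (B.coef t a i c - B.coef t' a i c)| := by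
        refine (abs_sub _ _).trans ?_
        gcongr
        exact abs_add_le _ _
    _ ≤ δ + 1 * (κ ^ d * δ) + 1 * (κ ^ d * δ) := by
        rw [abs_mul, abs_mul]
        gcongr
        · exact hni i
        · exact hchain t ht hat t' ht' hat' j c
        · exact hni j
        · exact hchain t ht hat t' ht' hat' i c
    _ = _ := by ring

/-- The constant bounding the change of the Bernstein coefficients at a node. -/
def nodeConst (d : ℕ) (κ C η : ℝ) : ℝ :=
  (κ ^ d + (d + (2 * d + 1) / η) * (1 + 2 * κ ^ d)) ^ 2 * (C * (sizeRatio d κ * κ) ^ (d - 1))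

/-- At each node there is a value satisfying all tangential boundary conditions that is close to the
Bernstein coefficients of all simplices carrying the node. -/
theorem BernForm.exists_node_value (hd : 2 ≤ d) (hΩ : IsConvexPolytopeDomain Ω) (hm : 1 ≤ m)
    {κ : ℝ} (hκ : 1 ≤ κ) (hT : M.sub.Regular κ) {C : ℝ} (hC : 0 < C) (hbound : FacetBound d m C)
    {η : ℝ} (hη : 0 < η) (hangle : ∀ n ∈ facetNormals Ω, ∀ n' ∈ facetNormals Ω, n ≠ n' → n ≠ -n' →
      ∃ i j, η ≤ |n' i * n j - n' j * n i|) (a : E d →₀ ℕ) :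
    ∃ w : Fin d → Fin d → ℝ,
      (∀ n ∈ M.sub.nodeNormals a, ∀ i j c, n i * w j c = n j * w i c) ∧
      ∀ s ∈ M.sub.cells, a ∈ nodes m s → ∀ i j,
        (B.coef s a i j - w i j) ^ 2 * size s ^ (d - 1) ≤
          nodeConst d κ C η * ∑ t ∈ M.sub.patch s, M.cellSq V t := by
  by_cases hex : ∃ s ∈ M.sub.cells, a ∈ nodes m s
  swap
  · exact ⟨0, fun _ _ _ _ _ => by simp, fun s hs has => absurd ⟨s, hs, has⟩ hex⟩
  obtain ⟨s₀, hs₀, has₀⟩ := hex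
  have hκ0 : 0 ≤ κ ^ d := by positivity
  have hη' : 0 ≤ (2 * (d : ℝ) + 1) / η := by positivity
  set b : ℝ := κ ^ d with hb
  set Q : ℝ := b + (d + (2 * d + 1) / η) * (1 + 2 * b) with hQ
  -- The value `w` has to be fixed before `δ`, since `δ` depends on the simplex and `w` must serve
  -- all of them.
  suffices h : ∃ w : Fin d → Fin d → ℝ,
      (∀ n ∈ M.sub.nodeNormals a, ∀ i j c, n i * w j c = n j * w i c) ∧
      ∀ δ ≥ 0, ∀ s ∈ M.sub.cells, a ∈ nodes m s →
        (∀ i j, |B.coef s a i j - B.coef s₀ a i j| ≤ b * δ) →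
        (∀ n ∈ M.sub.nodeNormals a, ∀ t ∈ M.sub.cells, a ∈ nodes m t → ∀ i j c,
          |n i * B.coef t a j c - n j * B.coef t a i c| ≤ (1 + 2 * b) * δ) →
        ∀ i j, |B.coef s a i j - w i j| ≤ Q * δ by
    obtain ⟨w, hw1, hw2⟩ := h
    refine ⟨w, hw1, fun s hs has i j => ?_⟩
    obtain ⟨δ, hδ0, hδ, h1, h2⟩ := B.star_bounds hd hΩ hm hκ hT hC hbound hs has
    have h3 := hw2 δ hδ0 s hs has (fun i j => h1 s hs has s₀ hs₀ has₀ i j) h2 i j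
    calc (B.coef s a i j - w i j) ^ 2 * size s ^ (d - 1) ≤ (Q * δ) ^ 2 * size s ^ (d - 1) := by
          rw [← sq_abs]
          have : 0 ≤ size s := Metric.diam_nonneg
          gcongr
      _ = Q ^ 2 * (δ ^ 2 * size s ^ (d - 1)) := by ring
      _ = _ := by rw [hδ, nodeConst]; ring
  -- No boundary condition at this node: the coefficient of the reference simplex `s₀` is kept.
  rcases (M.sub.nodeNormals a).eq_empty_or_nonempty with hemp | ⟨n, hn⟩
  · refine ⟨B.coef s₀ a, by simp [hemp], fun δ hδ s hs has h1 _ i j => (h1 i j).trans ?_⟩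
    gcongr
    rw [hQ]
    exact le_add_of_nonneg_right (by positivity)
  have hn1 : ‖n‖ = 1 := by
    obtain ⟨_, _, _, _, _, _, h⟩ := hn
    exact h.1
  -- A single normal: the columns are projected onto its direction, which removes only the small
  -- tangential components.
  by_cases hsing : ∀ n' ∈ M.sub.nodeNormals a, n' = n
  · refine ⟨fun i j => n i * ∑ l, n l * B.coef s₀ a l j, ?_, fun δ hδ s hs has h1 h2 i j => ?_⟩
    · intro n' hn' i j c
      rw [hsing n' hn']; ring
    · have h3 := abs_sub_normal_part_le hn1 (q := fun l => B.coef s₀ a l j)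
        (fun i l => h2 n hn s₀ hs₀ has₀ i l j) i
      calc |B.coef s a i j - n i * ∑ l, n l * B.coef s₀ a l j|
          ≤ |B.coef s a i j - B.coef s₀ a i j| +
            |B.coef s₀ a i j - n i * ∑ l, n l * B.coef s₀ a l j| := abs_sub_le _ _ _
        _ ≤ b * δ + d * ((1 + 2 * b) * δ) := add_le_add (h1 i j) h3
        _ ≤ b * δ + (d + (2 * d + 1) / η) * ((1 + 2 * b) * δ) := by
          gcongr
          exact le_add_of_nonneg_right hη'
        _ = _ := by rw [hQ]; ring
  -- Two independent normals leave only the value zero, and they make the coefficient itself small.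
  · push Not at hsing
    obtain ⟨n', hn', hne⟩ := hsing
    refine ⟨0, fun _ _ _ _ _ => by simp, fun δ hδ s hs has h1 h2 i j => ?_⟩
    have hmem : ∀ n ∈ M.sub.nodeNormals a, n ∈ facetNormals Ω := by
      rintro n ⟨t, ht, f, hft, -, -, h⟩
      exact ⟨f, t, M.sub.isSimplex ht, hft, M.sub.hull_subset ht, h⟩
    have hopp : n' ≠ -n := by
      obtain ⟨v, hv⟩ := support_nonempty hm has
      obtain ⟨_, _, f, _, haf, _, h⟩ := hn
      obtain ⟨_, _, f', _, haf', _, h'⟩ := hn'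
      exact h'.ne_neg hΩ.isOpen hΩ.1 h (subset_hull (haf' hv)) (subset_hull (haf hv))
    have hn1' : ‖n'‖ = 1 := by
      obtain ⟨_, _, _, _, _, _, h⟩ := hn'
      exact h.1
    have h3 := abs_le_of_two_normals hn1' hn1 (q := fun l => B.coef s a l j) hη
      (fun i l => h2 n' hn' s hs has i l j) (fun i l => h2 n hn s hs has i l j)
      (hangle n' (hmem n' hn') n (hmem n hn) hne hopp) i
    calc |B.coef s a i j - (0 : Fin d → Fin d → ℝ) i j| = |B.coef s a i j| := by simp
      _ ≤ (d + (2 * d + 1) / η) * ((1 + 2 * b) * δ) := h3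
      _ ≤ b * δ + (d + (2 * d + 1) / η) * ((1 + 2 * b) * δ) :=
        le_add_of_nonneg_left (by positivity)
      _ = _ := by rw [hQ]; ring

end

section

/-! ### The conforming piecewise polynomial with given Bernstein coefficients -/

variable {Ω : Set (E d)}

open Classical in
/-- The function that on each simplex `s` is `∑ a, w a • bern s a`. -/
def Triangulation.spline (T : Triangulation Ω) (m : ℕ) (w : (E d →₀ ℕ) → ℝ) (x : E d) : ℝ :=
  if h : ∃ s ∈ T.cells, x ∈ hull s then
    ∑ a ∈ nodes m h.choose, w a * bern h.choose a x else 0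

variable (T : Triangulation Ω) (m : ℕ)

/-- The chosen simplex does not matter: on a common face only multi-indices supported there
contribute, with equal Bernstein polynomials and the same weights. -/
theorem Triangulation.spline_eq (w : (E d →₀ ℕ) → ℝ) {s : Finset (E d)} (hs : s ∈ T.cells)
    {x : E d} (hx : x ∈ hull s) : T.spline m w x = ∑ a ∈ nodes m s, w a * bern s a x := by
  classical
  have h : ∃ s ∈ T.cells, x ∈ hull s := ⟨s, hs, hx⟩
  rw [Triangulation.spline, dif_pos h]
  set t := h.choose
  have ht : t ∈ T.cells := h.choose_spec.1
  have hxt : x ∈ hull t := h.choose_spec.2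
  have hst : x ∈ hull (t ∩ s) := by
    have := T.conforming t ht s hs ⟨hxt, hx⟩
    rwa [← Finset.coe_inter] at this
  rw [(T.isSimplex ht).sum_bern_face Finset.inter_subset_left _ hst,
    (T.isSimplex hs).sum_bern_face Finset.inter_subset_right _ hst]
  exact Finset.sum_congr rfl fun a _ => by rw [T.bern_congr ht hs hxt hx]

theorem lipschitzOnWith_of_eqOn {f g : E d → ℝ} {L : NNReal} {S : Set (E d)}
    (hf : LipschitzOnWith L f S) (h : EqOn g f S) : LipschitzOnWith L g S := fun x hx y hy => by
  rw [h hx, h hy]; exact hf hx hy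

theorem exists_closedBall_subset_hull {s : Finset (E d)} (hs : IsSimplex s) :
    ∃ c r, 0 < r ∧ Metric.closedBall c r ⊆ hull s := by
  obtain ⟨r, hr, h⟩ := Metric.isOpen_iff.1 isOpen_interior _ hs.centre_mem_interior
  exact ⟨_, r / 2, by positivity, (Metric.closedBall_subset_ball (by linarith)).trans
    (h.trans interior_subset)⟩

/-- The constant may depend on the mesh; it serves only for membership in H¹. -/
theorem Triangulation.exists_lipschitzOnWith_spline (hΩ : Convex ℝ (closure Ω))
    (w : (E d →₀ ℕ) → ℝ) : ∃ L, LipschitzOnWith L (T.spline m w) (closure Ω) := by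
  have h : ∀ s, ∃ L, s ∈ T.cells → LipschitzOnWith L (T.spline m w) (hull s) := by
    intro s
    by_cases hs : s ∈ T.cells
    · obtain ⟨c, r, hr, hball⟩ := exists_closedBall_subset_hull (T.isSimplex hs)
      exact ⟨_, fun _ => lipschitzOnWith_of_eqOn
        ((T.isSimplex hs).lipschitzOnWith_sum_bern (m := m) hr hball w)
        fun x hx => T.spline_eq m w hs hx⟩
    · exact ⟨0, fun h => absurd h hs⟩
  choose L hL using h
  refine ⟨T.cells.sup L, lipschitzOnWith_of_closed_cover (I := T.cells) (C := hull) hΩ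
    (fun s _ => isClosed_hull s) T.cover.symm.subset fun s hs => ?_⟩
  exact (hL s hs).weaken (Finset.le_sup hs)

/-! ### Local error bounds -/

variable (M : PolyMesh Ω)

/-- Bounds in the open simplices suffice, because boundaries of convex sets are null. -/
theorem PolyMesh.setIntegral_le {K : Set (E d)} (hK : K ∈ M.elements) {h : E d → ℝ}
    (h0 : ∀ x, 0 ≤ h x) {b : Finset (E d) → ℝ} (hb0 : ∀ s, 0 ≤ b s)
    (hb : ∀ s ∈ M.sub.subcells K, ∀ᵐ x, x ∈ interior (hull s) → h x ≤ b s) :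
    ∫ x in interior K, h x ≤ ∑ s ∈ M.sub.subcells K, b s * volume.real (hull s) := by
  have hfin : ∀ s : Finset (E d), volume (hull s) ≠ ⊤ := fun s =>
    (isCompact_hull s).measure_lt_top.ne
  have hm : ∀ s : Finset (E d), MeasurableSet (hull s) := fun s => (isClosed_hull s).measurableSet
  have hintg : ∀ s : Finset (E d), Integrable ((hull s).indicator fun _ => b s) volume := fun s =>
    (integrable_indicator_iff (hm s)).2 (integrableOn_const (hfin s))
  have hnonneg : ∀ (s : Finset (E d)) x, 0 ≤ (hull s).indicator (fun _ => b s) x := fun s x =>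
    indicator_nonneg (fun _ _ => hb0 s) x
  have hae : ∀ᵐ x, x ∈ interior K → h x ≤
      ∑ s ∈ M.sub.subcells K, (hull s).indicator (fun _ => b s) x := by
    have h1 : ∀ᵐ x, ∀ s ∈ M.sub.subcells K, x ∈ interior (hull s) → h x ≤ b s :=
      (Filter.eventually_all_finset _).2 hb
    have h2 : ∀ᵐ x, ∀ s ∈ M.sub.subcells K, x ∉ frontier (hull s) := by
      refine (Filter.eventually_all_finset _).2 fun s _ => ?_
      exact measure_eq_zero_iff_ae_notMem.1 ((convex_hull s).addHaar_frontier volume)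
    filter_upwards [h1, h2] with x hx1 hx2 hxK
    obtain ⟨s, hs, hxs⟩ := M.exists_subcell hK (interior_subset hxK)
    have hxi : x ∈ interior (hull s) := by
      by_contra hni
      exact hx2 s hs ⟨subset_closure hxs, hni⟩
    refine (hx1 s hs hxi).trans ?_
    have h3 := Finset.single_le_sum (f := fun s => (hull s).indicator (fun _ => b s) x)
      (fun s _ => hnonneg s x) hs
    simpa [indicator_of_mem hxs] using h3
  calc ∫ x in interior K, h x
      ≤ ∫ x in interior K, ∑ s ∈ M.sub.subcells K, (hull s).indicator (fun _ => b s) x := by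
        refine integral_mono_of_nonneg (Filter.Eventually.of_forall h0)
          (integrable_finsetSum _ fun s _ => (hintg s).restrict) ?_
        exact (ae_restrict_iff' isOpen_interior.measurableSet).2 hae
    _ ≤ ∫ x, ∑ s ∈ M.sub.subcells K, (hull s).indicator (fun _ => b s) x :=
        setIntegral_le_integral (integrable_finsetSum _ fun s _ => hintg s)
          (Filter.Eventually.of_forall fun x => Finset.sum_nonneg fun s _ => hnonneg s x)
    _ = _ := by
        rw [integral_finsetSum _ fun s _ => hintg s]
        refine Finset.sum_congr rfl fun s _ => ?_
        rw [integral_indicator_const _ (hm s), smul_eq_mul, mul_comm]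

theorem size_nonneg (s : Finset (E d)) : 0 ≤ size s := Metric.diam_nonneg

theorem volume_hull_le (hd : 1 ≤ d) {s : Finset (E d)} (hs : s.Nonempty) :
    volume.real (hull s) ≤ volume.real (Metric.ball (0 : E d) 1) * size s ^ d := by
  have : Nonempty (Fin d) := ⟨⟨0, hd⟩⟩
  have hsub : hull s ⊆ Metric.closedBall (centre s) (size s) := fun x hx =>
    dist_le_size hx (centre_mem_hull hs)
  refine (measureReal_mono hsub measure_closedBall_lt_top.ne).trans ?_
  rw [measureReal_def, Measure.addHaar_closedBall volume _ (size_nonneg s),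
    finrank_euclideanSpace, Fintype.card_fin, ENNReal.toReal_mul,
    ENNReal.toReal_ofReal (pow_nonneg (size_nonneg s) _), mul_comm, measureReal_def]

/-- Crude count: each of the `d + 1` exponents is at most `m`. -/
theorem card_nodes_le {s : Finset (E d)} (hs : s.card = d + 1) :
    (nodes m s).card ≤ (m + 1) ^ (d + 1) := by
  classical
  have h : (nodes m s).card ≤ (Fintype.piFinset fun _ : s => Finset.range (m + 1)).card := by
    refine Finset.card_le_card_of_injOn (fun a v => a v) (fun a ha => ?_) fun a ha b hb hab => ?_
    · refine Finset.mem_coe.2 (Fintype.mem_piFinset.2 fun v => Finset.mem_range.2 ?_)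
      have h1 := (mem_nodes.1 ha).1
      change a v < m + 1
      by_cases hv : (v : E d) ∈ a.support
      · have : a v ≤ ∑ u ∈ a.support, a u :=
          Finset.single_le_sum (f := fun u => a u) (fun _ _ => Nat.zero_le _) hv
        rw [Finsupp.sum] at h1
        omega
      · rw [Finsupp.notMem_support_iff.1 hv]; omega
    · ext v
      by_cases hv : v ∈ s
      · exact congrFun hab ⟨v, hv⟩
      · rw [Finsupp.notMem_support_iff.1 fun h => hv ((mem_nodes.1 ha).2 h),
          Finsupp.notMem_support_iff.1 fun h => hv ((mem_nodes.1 hb).2 h)]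
  simpa [hs] using h

variable {m M} {V : E d → Matrix (Fin d) (Fin d) ℝ} (B : BernForm M m V)
  (w : (E d →₀ ℕ) → Fin d → Fin d → ℝ)

/-- The tensor with the Bernstein coefficients `w`. -/
def Triangulation.tensorSpline (T : Triangulation Ω) (m : ℕ)
    (w : (E d →₀ ℕ) → Fin d → Fin d → ℝ) (x : E d) : Matrix (Fin d) (Fin d) ℝ :=
  fun i j => T.spline m (fun a => w a i j) x

/-- The sum of the errors in the Bernstein coefficients on a simplex. -/
def BernForm.err (s : Finset (E d)) (i j : Fin d) : ℝ :=
  ∑ a ∈ nodes m s, |B.coef s a i j - w a i j|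

theorem BernForm.err_nonneg (s : Finset (E d)) (i j : Fin d) : 0 ≤ B.err w s i j :=
  Finset.sum_nonneg fun _ _ => abs_nonneg _

theorem BernForm.sub_eq {K : Set (E d)} (hK : K ∈ M.elements) {s : Finset (E d)}
    (hs : s ∈ M.sub.subcells K) {x : E d} (hx : x ∈ interior (hull s)) (i j : Fin d) :
    (V - M.sub.tensorSpline m w) x i j =
      ∑ a ∈ nodes m s, (B.coef s a i j - w a i j) * bern s a x := by
  obtain ⟨hs', hsK⟩ := Triangulation.mem_subcells.1 hs
  have h1 := B.eq_poly K hK i j x (interior_mono hsK hx)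
  rw [B.eq_bern K hK s hs] at h1
  change V x i j - M.sub.spline m (fun a => w a i j) x = _
  rw [h1, M.sub.spline_eq m _ hs' (interior_subset hx), ← Finset.sum_sub_distrib]
  exact Finset.sum_congr rfl fun a _ => by ring

theorem BernForm.normSqL2_le {K : Set (E d)} (hK : K ∈ M.elements) :
    normSqL2 (interior K) (V - M.sub.tensorSpline m w) ≤
      ∑ s ∈ M.sub.subcells K, (∑ i, ∑ j, B.err w s i j ^ 2) * volume.real (hull s) := by
  simp only [Finset.sum_mul]
  rw [Finset.sum_comm, normSqL2]
  refine Finset.sum_le_sum fun i _ => ?_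
  rw [Finset.sum_comm]
  refine Finset.sum_le_sum fun j _ => ?_
  refine M.setIntegral_le hK (fun x => sq_nonneg _) (b := fun s => B.err w s i j ^ 2)
    (fun s => sq_nonneg _) fun s hs => Filter.Eventually.of_forall fun x hx => ?_
  rw [B.sub_eq w hK hs hx, ← sq_abs]
  exact pow_le_pow_left₀ (abs_nonneg _) ((M.sub.isSimplex
    (Triangulation.mem_subcells.1 hs).1).abs_sum_bern_le (interior_subset hx) _) 2

/-- The derivatives are not computed: in each simplex they are bounded by the Lipschitz constant of
the Bernstein sum. The factor `d` counts the partial derivatives. -/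
theorem BernForm.normSqGrad_le {κ : ℝ} (hd : 1 ≤ d) (hT : M.sub.Regular κ)
    {K : Set (E d)} (hK : K ∈ M.elements) :
    normSqGrad (interior K) (V - M.sub.tensorSpline m w) ≤
      ∑ s ∈ M.sub.subcells K, (d * (m * κ / size s) ^ 2 * ∑ i, ∑ j, B.err w s i j ^ 2) *
        volume.real (hull s) := by
  have hone : ∀ i j k, ∫ x in interior K,
      weakPartial (interior K) k (fun y => (V - M.sub.tensorSpline m w) y i j) x ^ 2 ≤
      ∑ s ∈ M.sub.subcells K, ((m * κ / size s) ^ 2 * B.err w s i j ^ 2) *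
        volume.real (hull s) := by
    intro i j k
    refine M.setIntegral_le hK (fun x => sq_nonneg _)
      (b := fun s => (m * κ / size s) ^ 2 * B.err w s i j ^ 2) (fun s => by positivity)
      fun s hs => ?_
    obtain ⟨hs', hsK⟩ := Triangulation.mem_subcells.1 hs
    -- Without a weak derivative, `weakPartial` has the default value 0 and the bound is trivial.
    by_cases hex : ∃ g, MemLp g 2 (volume.restrict (interior K)) ∧
        IsWeakPartial (interior K) k (fun y => (V - M.sub.tensorSpline m w) y i j) g
    · obtain ⟨x₀, r, hr, hball, hsz⟩ := hT s hs'
      have hsize : 0 < size s := (M.sub.isSimplex hs').size_pos hd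
      have hlip := lipschitzOnWith_of_eqOn (((M.sub.isSimplex hs').lipschitzOnWith_sum_bern (m := m)
        hr hball (fun a => B.coef s a i j - w a i j)).mono interior_subset)
          (g := fun y => (V - M.sub.tensorSpline m w) y i j)
          fun x hx => B.sub_eq w hK hs hx i j
      rw [weakPartial, dif_pos hex]
      filter_upwards [hex.choose_spec.2.abs_le isOpen_interior (interior_mono hsK)
        hex.choose_spec.1 hlip] with x hx hxs
      have h1 := hx hxs
      rw [Real.coe_toNNReal _ (by positivity)] at h1
      rw [← sq_abs, ← mul_pow]
      refine pow_le_pow_left₀ (abs_nonneg _) (h1.trans ?_) 2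
      change m / r * B.err w s i j ≤ _
      refine mul_le_mul_of_nonneg_right ?_ (B.err_nonneg w s i j)
      rw [div_le_div_iff₀ hr hsize, mul_assoc]
      gcongr
    · rw [weakPartial, dif_neg hex]
      refine Filter.Eventually.of_forall fun x _ => ?_
      simp only [Pi.zero_apply, ne_eq, OfNat.ofNat_ne_zero, not_false_eq_true, zero_pow]
      positivity
  calc normSqGrad (interior K) (V - M.sub.tensorSpline m w)
      ≤ ∑ i, ∑ j, ∑ _k : Fin d, ∑ s ∈ M.sub.subcells K,
        ((m * κ / size s) ^ 2 * B.err w s i j ^ 2) * volume.real (hull s) :=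
        Finset.sum_le_sum fun i _ => Finset.sum_le_sum fun j _ => Finset.sum_le_sum fun k _ =>
          hone i j k
    _ = ∑ i, ∑ j, ∑ s ∈ M.sub.subcells K,
        (d * (m * κ / size s) ^ 2 * B.err w s i j ^ 2) * volume.real (hull s) := by
        refine Finset.sum_congr rfl fun i _ => Finset.sum_congr rfl fun j _ => ?_
        rw [Finset.sum_const, Finset.card_univ, Fintype.card_fin, nsmul_eq_mul, Finset.mul_sum]
        exact Finset.sum_congr rfl fun s _ => by ring
    _ = _ := by
        simp only [Finset.mul_sum, Finset.sum_mul]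
        rw [Finset.sum_comm]
        conv_rhs => rw [Finset.sum_comm]
        rw [Finset.sum_comm]
        refine Finset.sum_congr rfl fun i _ => ?_
        rw [Finset.sum_comm]

theorem PolyMesh.sum_elements_le {X : Finset (E d) → ℝ} (hX : ∀ s ∈ M.sub.cells, 0 ≤ X s) :
    ∑ K ∈ M.elements, ∑ s ∈ M.sub.subcells K, X s ≤ ∑ s ∈ M.sub.cells, X s := by
  classical
  rw [← Finset.sum_biUnion]
  · refine Finset.sum_le_sum_of_subset_of_nonneg (fun s hs => ?_) fun s hs _ => hX s hs
    obtain ⟨K, -, hs⟩ := Finset.mem_biUnion.1 hs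
    exact (Triangulation.mem_subcells.1 hs).1
  · intro K hK L hL hKL
    exact Finset.disjoint_left.2 fun s hsK hsL => hKL (M.element_unique hK hL hsK hsL)

end

section

/-! ### Summation over the mesh -/

variable {Ω : Set (E d)} {M : PolyMesh Ω}

/-- The exponent `-1` needs the reverse comparison, hence both hypotheses. -/
theorem zpow_le_mul_zpow {x y c : ℝ} (hx : 0 < x) (hy : 0 < y) (h1 : x ≤ c * y) (h2 : y ≤ c * x)
    {β : ℤ} (hβ : β = 1 ∨ β = -1) : x ^ β ≤ c * y ^ β := by
  rcases hβ with rfl | rfl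
  · simpa using h1
  · rw [zpow_neg_one, zpow_neg_one, ← div_eq_mul_inv, le_div_iff₀ hy, inv_mul_le_iff₀ hx,
      mul_comm]
    exact h2

theorem PolyMesh.exists_element_of_face {e : Set (E d)} (he : e ∈ M.intFaces ∨ e ∈ M.bdFaces) :
    ∃ K ∈ M.elements, e ⊆ K := by
  rcases he with he | he
  · obtain ⟨K, hK, _, _, _, h, _⟩ := M.intFace e he
    exact ⟨K, hK, h.trans inter_subset_left⟩
  · obtain ⟨-, K, hK, h, -⟩ := M.bdFace e he
    exact ⟨K, hK, h⟩

/-- The simplex `t` may lie on the other side of the face, outside `K`; it still shares a facet with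
a simplex of `K`. -/
theorem PolyMesh.mem_patch_of_touches (hd : 1 ≤ d) {K e : Set (E d)} (hK : K ∈ M.elements)
    (heK : e ⊆ K) {t : Finset (E d)} (ht : t ∈ M.sub.cells) (hte : Touches t e) :
    ∃ t' ∈ M.sub.subcells K, t ∈ M.sub.patch t' := by
  obtain ⟨f, hft, hfe⟩ := hte
  obtain ⟨t', ht', hft'⟩ := M.exists_subcell_facet hd ht hft hK (hfe.trans heK)
  obtain ⟨v, hv⟩ := hft.nonempty hd
  exact ⟨t', ht', M.sub.mem_patch.2 ⟨ht, v, hft'.1 hv, hft.1 hv⟩⟩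

/-- The constant comparing the diameter of a face with the size of the simplices touching it. -/
def faceRatio (d N : ℕ) (κ : ℝ) : ℝ := κ + elementRatio d N κ * sizeRatio d κ

theorem faceRatio_pos (d N : ℕ) {κ : ℝ} (hκ : 1 ≤ κ) : 0 < faceRatio d N κ := by
  have h1 := elementRatio_pos (d := d) N hκ
  have h2 := one_le_sizeRatio (d := d) hκ
  unfold faceRatio
  positivity

variable {N : ℕ} {κ : ℝ}

/-- A touching simplex has an edge inside the face, and the face lies in an element whose diameter
is controlled by its simplices. -/
theorem PolyMesh.size_comparable (hd : 2 ≤ d) (hΩ : IsConvexPolytopeDomain Ω) (hκ : 1 ≤ κ)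
    (hT : M.sub.Regular κ) (hN : ∀ K ∈ M.elements, (M.sub.subcells K).card ≤ N) {e : Set (E d)}
    (he : e ∈ M.intFaces ∨ e ∈ M.bdFaces) {t : Finset (E d)} (ht : t ∈ M.sub.cells)
    (hte : Touches t e) : 0 < Metric.diam e ∧ size t ≤ faceRatio d N κ * Metric.diam e ∧
      Metric.diam e ≤ faceRatio d N κ * size t := by
  have hconv : Convex ℝ (closure Ω) := hΩ.convex.closure
  have h1 := elementRatio_pos (d := d) N hκ
  have h2 := one_le_sizeRatio (d := d) hκ
  have hsize := (M.sub.isSimplex ht).size_pos (by omega)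
  have hle : size t ≤ κ * Metric.diam e := by
    obtain ⟨f, hft, hfe⟩ := hte
    obtain ⟨v, hv, w, hw, hvw⟩ := Finset.one_lt_card.1 (show 1 < f.card by rw [hft.2]; omega)
    refine (hT.size_le_dist (by linarith) ht (hft.1 hv) (hft.1 hw) hvw).trans ?_
    gcongr
    exact Metric.dist_le_diam_of_mem (M.isCompact_face he).isBounded (hfe (subset_hull hv))
      (hfe (subset_hull hw))
  have hpos : 0 < Metric.diam e := pos_of_mul_pos_right (hsize.trans_le hle) (by linarith)
  refine ⟨hpos, hle.trans ?_, ?_⟩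
  · gcongr
    exact le_add_of_nonneg_right (by positivity)
  · obtain ⟨K, hK, heK⟩ := M.exists_element_of_face he
    obtain ⟨t', ht', htt'⟩ := M.mem_patch_of_touches (by omega) hK heK ht hte
    have ht'c := (Triangulation.mem_subcells.1 ht').1
    have hKb : Bornology.IsBounded K := by
      rw [M.element_eq K hK]
      exact (Bornology.isBounded_biUnion_finset _).2 fun s _ => (isCompact_hull s).isBounded
    calc Metric.diam e ≤ Metric.diam K := Metric.diam_mono heK hKb
      _ ≤ elementRatio d N κ * size t' := M.diam_element_le hN hT hconv hd hκ hK ht'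
      _ ≤ elementRatio d N κ * (sizeRatio d κ * size t) := by
        gcongr
        exact hT.size_le_of_mem_patch hconv hd hκ ht (M.sub.mem_patch_comm ht'c htt')
      _ ≤ faceRatio d N κ * size t := by
        rw [faceRatio, add_mul, mul_assoc]
        exact le_add_of_nonneg_left (by positivity)

-- All touching simplices lie in patches of the at most `N` simplices of one element containing the
-- face.
open Classical in
theorem PolyMesh.card_touches_le (hd : 1 ≤ d) (hκ : 1 ≤ κ) (hT : M.sub.Regular κ)
    (hN : ∀ K ∈ M.elements, (M.sub.subcells K).card ≤ N) {e : Set (E d)}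
    (he : e ∈ M.intFaces ∨ e ∈ M.bdFaces) :
    ((M.sub.cells.filter fun t => Touches t e).card : ℝ) ≤ N * ((d + 1) * κ ^ d) := by
  obtain ⟨K, hK, heK⟩ := M.exists_element_of_face he
  have hsub : (M.sub.cells.filter fun t => Touches t e) ⊆
      (M.sub.subcells K).biUnion fun t' => M.sub.patch t' := by
    intro t ht
    obtain ⟨ht, hte⟩ := Finset.mem_filter.1 ht
    obtain ⟨t', ht', h⟩ := M.mem_patch_of_touches hd hK heK ht hte
    exact Finset.mem_biUnion.2 ⟨t', ht', h⟩
  calc ((M.sub.cells.filter fun t => Touches t e).card : ℝ)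
      ≤ ((∑ t' ∈ M.sub.subcells K, (M.sub.patch t').card : ℕ) : ℝ) := by
        exact_mod_cast (Finset.card_le_card hsub).trans Finset.card_biUnion_le
    _ = ∑ t' ∈ M.sub.subcells K, ((M.sub.patch t').card : ℝ) := by push_cast; rfl
    _ ≤ ∑ _t' ∈ M.sub.subcells K, (d + 1) * κ ^ d := Finset.sum_le_sum fun t' ht' =>
        hT.card_patch_le hd (by linarith) (Triangulation.mem_subcells.1 ht').1
    _ = (M.sub.subcells K).card * ((d + 1) * κ ^ d) := by simp
    _ ≤ _ := by
        gcongr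
        exact_mod_cast hN K hK

-- After exchanging the sums, each face is counted for a bounded number of simplices of comparable
-- size.
open Classical in
theorem PolyMesh.sum_touches_le (hd : 2 ≤ d) (hΩ : IsConvexPolytopeDomain Ω) (hκ : 1 ≤ κ)
    (hT : M.sub.Regular κ) (hN : ∀ K ∈ M.elements, (M.sub.subcells K).card ≤ N) {β : ℤ}
    (hβ : β = 1 ∨ β = -1) {F : Finset (Set (E d))}
    (hF : ∀ e ∈ F, e ∈ M.intFaces ∨ e ∈ M.bdFaces) {I : Set (E d) → ℝ} (hI : ∀ e, 0 ≤ I e) :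
    ∑ t ∈ M.sub.cells, size t ^ β * ∑ e ∈ F.filter (Touches t), I e ≤
      N * ((d + 1) * κ ^ d) * faceRatio d N κ * ∑ e ∈ F, Metric.diam e ^ β * I e := by
  have hfr := faceRatio_pos d N hκ
  calc ∑ t ∈ M.sub.cells, size t ^ β * ∑ e ∈ F.filter (Touches t), I e
      = ∑ e ∈ F, ∑ t ∈ M.sub.cells.filter (fun t => Touches t e), size t ^ β * I e := by
        simp only [Finset.mul_sum, Finset.sum_filter, mul_ite, mul_zero]
        rw [Finset.sum_comm]
    _ ≤ ∑ e ∈ F, ∑ _t ∈ M.sub.cells.filter (fun t => Touches t e),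
          faceRatio d N κ * Metric.diam e ^ β * I e := by
        refine Finset.sum_le_sum fun e he => Finset.sum_le_sum fun t ht => ?_
        obtain ⟨ht, hte⟩ := Finset.mem_filter.1 ht
        obtain ⟨h0, h1, h2⟩ := M.size_comparable hd hΩ hκ hT hN (hF e he) ht hte
        exact mul_le_mul_of_nonneg_right (zpow_le_mul_zpow
          ((M.sub.isSimplex ht).size_pos (by omega)) h0 h1 h2 hβ) (hI e)
    _ ≤ ∑ e ∈ F, N * ((d + 1) * κ ^ d) * (faceRatio d N κ * Metric.diam e ^ β * I e) := by
        refine Finset.sum_le_sum fun e he => ?_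
        rw [Finset.sum_const, nsmul_eq_mul]
        refine mul_le_mul_of_nonneg_right (M.card_touches_le (by omega) hκ hT hN (hF e he)) ?_
        have := zpow_nonneg (Metric.diam_nonneg (s := e)) β
        have := hI e
        positivity
    _ = _ := by
        rw [Finset.mul_sum]
        exact Finset.sum_congr rfl fun e _ => by ring

/-- The constant in the summation of the local bounds over the mesh. -/
def meshConst (d N : ℕ) (κ : ℝ) : ℝ :=
  (d + 1) * κ ^ d * sizeRatio d κ * (N * ((d + 1) * κ ^ d) * faceRatio d N κ)

/-- Being in each other's patch is symmetric, so the double sum can be reordered. Each local term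
then occurs at most `(d + 1) * κ ^ d` times. -/
theorem PolyMesh.sum_patch_le (hd : 2 ≤ d) (hΩ : IsConvexPolytopeDomain Ω) (hκ : 1 ≤ κ)
    (hT : M.sub.Regular κ) (hN : ∀ K ∈ M.elements, (M.sub.subcells K).card ≤ N) {β : ℤ}
    (hβ : β = 1 ∨ β = -1) (V : E d → Matrix (Fin d) (Fin d) ℝ) :
    ∑ s ∈ M.sub.cells, size s ^ β * ∑ t ∈ M.sub.patch s, M.cellSq V t ≤
      meshConst d N κ * M.faceTerms β V := by
  classical
  have hconv : Convex ℝ (closure Ω) := hΩ.convex.closure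
  have hΛ := one_le_sizeRatio (d := d) hκ
  have hpos : ∀ s ∈ M.sub.cells, 0 < size s := fun s hs => (M.sub.isSimplex hs).size_pos (by omega)
  calc ∑ s ∈ M.sub.cells, size s ^ β * ∑ t ∈ M.sub.patch s, M.cellSq V t
      ≤ ∑ s ∈ M.sub.cells, ∑ t ∈ M.sub.patch s, sizeRatio d κ * size t ^ β * M.cellSq V t := by
        refine Finset.sum_le_sum fun s hs => ?_
        rw [Finset.mul_sum]
        refine Finset.sum_le_sum fun t ht => ?_
        have htc := (M.sub.mem_patch.1 ht).1
        exact mul_le_mul_of_nonneg_right (zpow_le_mul_zpow (hpos s hs) (hpos t htc)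
          (hT.size_le_of_mem_patch hconv hd hκ htc (M.sub.mem_patch_comm hs ht))
          (hT.size_le_of_mem_patch hconv hd hκ hs ht) hβ) (M.cellSq_nonneg V t)
    _ = ∑ t ∈ M.sub.cells, ∑ _s ∈ M.sub.patch t, sizeRatio d κ * size t ^ β * M.cellSq V t := by
        refine Finset.sum_comm' fun s t => ?_
        constructor
        · rintro ⟨hs, ht⟩
          exact ⟨M.sub.mem_patch_comm hs ht, (M.sub.mem_patch.1 ht).1⟩
        · rintro ⟨hs, ht⟩
          exact ⟨(M.sub.mem_patch.1 hs).1, M.sub.mem_patch_comm ht hs⟩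
    _ ≤ ∑ t ∈ M.sub.cells, (d + 1) * κ ^ d * (sizeRatio d κ * size t ^ β * M.cellSq V t) := by
        refine Finset.sum_le_sum fun t ht => ?_
        rw [Finset.sum_const, nsmul_eq_mul]
        refine mul_le_mul_of_nonneg_right (hT.card_patch_le (by omega) (by linarith) ht) ?_
        have := zpow_nonneg (hpos t ht).le β
        have := M.cellSq_nonneg V t
        positivity
    _ = (d + 1) * κ ^ d * sizeRatio d κ * ∑ t ∈ M.sub.cells, size t ^ β * M.cellSq V t := by
        rw [Finset.mul_sum]
        exact Finset.sum_congr rfl fun t _ => by ring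
    _ ≤ (d + 1) * κ ^ d * sizeRatio d κ *
        (N * ((d + 1) * κ ^ d) * faceRatio d N κ * M.faceTerms β V) := by
        refine mul_le_mul_of_nonneg_left ?_ (by positivity)
        have h1 := M.sum_touches_le hd hΩ hκ hT hN hβ (F := M.intFaces) (fun e he => Or.inl he)
          (M.jumpSq_nonneg V)
        have h2 := M.sum_touches_le hd hΩ hκ hT hN hβ (F := M.bdFaces) (fun e he => Or.inr he)
          (M.tangSq_nonneg V)
        calc ∑ t ∈ M.sub.cells, size t ^ β * M.cellSq V t
            = ∑ t ∈ M.sub.cells, size t ^ β * ∑ e ∈ M.intFaces.filter (Touches t), M.jumpSq V e +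
              ∑ t ∈ M.sub.cells, size t ^ β * ∑ e ∈ M.bdFaces.filter (Touches t), M.tangSq V e := by
              rw [← Finset.sum_add_distrib]
              exact Finset.sum_congr rfl fun t _ => by rw [PolyMesh.cellSq, mul_add]
          _ ≤ _ := add_le_add h1 h2
          _ = _ := by
              rw [← mul_add]
              rfl
    _ = _ := by rw [meshConst]; ring

theorem PolyMesh.faceTerms_nonneg (β : ℤ) (V : E d → Matrix (Fin d) (Fin d) ℝ) :
    0 ≤ M.faceTerms β V :=
  add_nonneg
    (Finset.sum_nonneg fun e _ =>
      mul_nonneg (zpow_nonneg Metric.diam_nonneg _) (M.jumpSq_nonneg V e))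
    (Finset.sum_nonneg fun e _ =>
      mul_nonneg (zpow_nonneg Metric.diam_nonneg _) (M.tangSq_nonneg V e))

/-! ### Global error bounds -/

variable {m : ℕ} {V : E d → Matrix (Fin d) (Fin d) ℝ} (B : BernForm M m V)
  {w : (E d →₀ ℕ) → Fin d → Fin d → ℝ} {c : ℝ}

theorem BernForm.sum_err_sq_le {s : Finset (E d)} (hs : s ∈ M.sub.cells) {G : ℝ}
    (hw : ∀ a ∈ nodes m s, ∀ i j, (B.coef s a i j - w a i j) ^ 2 * size s ^ (d - 1) ≤ G) :
    (∑ i, ∑ j, B.err w s i j ^ 2) * size s ^ (d - 1) ≤ d ^ 2 * ((m + 1) ^ (d + 1)) ^ 2 * G := by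
  have hp : 0 ≤ size s ^ (d - 1) := pow_nonneg (size_nonneg s) _
  have hcard : ((nodes m s).card : ℝ) ≤ (m + 1) ^ (d + 1) := by
    exact_mod_cast card_nodes_le m (M.sub.card_cell s hs)
  have hone : ∀ i j, B.err w s i j ^ 2 * size s ^ (d - 1) ≤ ((m + 1) ^ (d + 1)) ^ 2 * G := by
    intro i j
    -- A node always exists, for instance `m` times a vertex; it yields `0 ≤ G`.
    rcases (nodes m s).eq_empty_or_nonempty with he | ⟨a₀, ha₀⟩
    · rw [BernForm.err, he, Finset.sum_empty]
      obtain ⟨v, hv⟩ := (M.sub.isSimplex hs).nonempty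
      have : Finsupp.single v m ∈ nodes m s := mem_nodes.2 ⟨by simp,
        (Finsupp.support_single_subset).trans (by simpa using hv)⟩
      rw [he] at this
      simp at this
    have hG : 0 ≤ G := le_trans (by positivity) (hw a₀ ha₀ i j)
    calc B.err w s i j ^ 2 * size s ^ (d - 1)
        ≤ ((nodes m s).card * ∑ a ∈ nodes m s, |B.coef s a i j - w a i j| ^ 2) *
            size s ^ (d - 1) := by
          gcongr
          exact sq_sum_le_card_mul_sum_sq
      _ = (nodes m s).card * ∑ a ∈ nodes m s,
            (B.coef s a i j - w a i j) ^ 2 * size s ^ (d - 1) := by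
          simp only [sq_abs, Finset.sum_mul, mul_assoc]
      _ ≤ (nodes m s).card * ∑ _a ∈ nodes m s, G := by
          gcongr with a ha
          exact hw a ha i j
      _ = ((nodes m s).card : ℝ) ^ 2 * G := by
          rw [Finset.sum_const, nsmul_eq_mul]; ring
      _ ≤ _ := by gcongr
  calc (∑ i, ∑ j, B.err w s i j ^ 2) * size s ^ (d - 1)
      = ∑ i, ∑ j, B.err w s i j ^ 2 * size s ^ (d - 1) := by simp only [Finset.sum_mul]
    _ ≤ ∑ _i : Fin d, ∑ _j : Fin d, ((m + 1) ^ (d + 1)) ^ 2 * G :=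
        Finset.sum_le_sum fun i _ => Finset.sum_le_sum fun j _ => hone i j
    _ = _ := by simp; ring

/-- The constant in the bound of the squared errors on a simplex. -/
def cellConst (d m : ℕ) (c : ℝ) : ℝ :=
  volume.real (Metric.ball (0 : E d) 1) * (d ^ 2 * ((m + 1) ^ (d + 1)) ^ 2 * c)

/-- The volume is at most of order `size s ^ d`, one power more than the facet scaling in `hw`; this
power is the weight for the L² norm. -/
theorem BernForm.err_mul_volume_le (hd : 2 ≤ d)
    (hw : ∀ s ∈ M.sub.cells, ∀ a ∈ nodes m s, ∀ i j,
      (B.coef s a i j - w a i j) ^ 2 * size s ^ (d - 1) ≤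
        c * ∑ t ∈ M.sub.patch s, M.cellSq V t)
    {s : Finset (E d)} (hs : s ∈ M.sub.cells) :
    (∑ i, ∑ j, B.err w s i j ^ 2) * volume.real (hull s) ≤
      size s * (cellConst d m c * ∑ t ∈ M.sub.patch s, M.cellSq V t) := by
  have h1 := B.sum_err_sq_le hs (hw s hs)
  have h2 := volume_hull_le (by omega : 1 ≤ d) (M.sub.isSimplex hs).nonempty
  have h3 : 0 ≤ ∑ i, ∑ j, B.err w s i j ^ 2 :=
    Finset.sum_nonneg fun i _ => Finset.sum_nonneg fun j _ => sq_nonneg _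
  have h4 := size_nonneg s
  calc (∑ i, ∑ j, B.err w s i j ^ 2) * volume.real (hull s)
      ≤ (∑ i, ∑ j, B.err w s i j ^ 2) *
        (volume.real (Metric.ball (0 : E d) 1) * size s ^ d) := by gcongr
    _ = volume.real (Metric.ball (0 : E d) 1) * size s *
        ((∑ i, ∑ j, B.err w s i j ^ 2) * size s ^ (d - 1)) := by
        obtain ⟨k, rfl⟩ : ∃ k, d = k + 1 := ⟨d - 1, by omega⟩
        rw [Nat.add_sub_cancel, pow_succ]; ring
    _ ≤ volume.real (Metric.ball (0 : E d) 1) * size s *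
        (d ^ 2 * ((m + 1) ^ (d + 1)) ^ 2 * (c * ∑ t ∈ M.sub.patch s, M.cellSq V t)) := by gcongr
    _ = _ := by rw [cellConst]; ring

theorem BernForm.sum_normSqL2_le (hd : 2 ≤ d) (hΩ : IsConvexPolytopeDomain Ω) (hκ : 1 ≤ κ)
    (hT : M.sub.Regular κ) (hN : ∀ K ∈ M.elements, (M.sub.subcells K).card ≤ N) (hc : 0 ≤ c)
    (hw : ∀ s ∈ M.sub.cells, ∀ a ∈ nodes m s, ∀ i j,
      (B.coef s a i j - w a i j) ^ 2 * size s ^ (d - 1) ≤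
        c * ∑ t ∈ M.sub.patch s, M.cellSq V t) :
    ∑ K ∈ M.elements, normSqL2 (interior K) (V - M.sub.tensorSpline m w) ≤
      cellConst d m c * meshConst d N κ * M.faceTerms 1 V := by
  have hcell : 0 ≤ cellConst d m c := by unfold cellConst; positivity
  calc ∑ K ∈ M.elements, normSqL2 (interior K) (V - M.sub.tensorSpline m w)
      ≤ ∑ K ∈ M.elements, ∑ s ∈ M.sub.subcells K,
        (∑ i, ∑ j, B.err w s i j ^ 2) * volume.real (hull s) :=
        Finset.sum_le_sum fun K hK => B.normSqL2_le w hK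
    _ ≤ ∑ s ∈ M.sub.cells, (∑ i, ∑ j, B.err w s i j ^ 2) * volume.real (hull s) :=
        M.sum_elements_le fun s _ => by positivity
    _ ≤ ∑ s ∈ M.sub.cells, cellConst d m c *
          (size s ^ (1 : ℤ) * ∑ t ∈ M.sub.patch s, M.cellSq V t) := by
        refine Finset.sum_le_sum fun s hs => (B.err_mul_volume_le hd hw hs).trans_eq ?_
        rw [zpow_one]; ring
    _ ≤ cellConst d m c * (meshConst d N κ * M.faceTerms 1 V) := by
        rw [← Finset.mul_sum]
        exact mul_le_mul_of_nonneg_left (M.sum_patch_le hd hΩ hκ hT hN (Or.inl rfl) V) hcell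
    _ = _ := by ring

/-- The factor `(m * κ / size s) ^ 2` of the gradient bound turns the weight `size s` into its
inverse. -/
theorem BernForm.sum_normSqGrad_le (hd : 2 ≤ d) (hΩ : IsConvexPolytopeDomain Ω) (hκ : 1 ≤ κ)
    (hT : M.sub.Regular κ) (hN : ∀ K ∈ M.elements, (M.sub.subcells K).card ≤ N) (hc : 0 ≤ c)
    (hw : ∀ s ∈ M.sub.cells, ∀ a ∈ nodes m s, ∀ i j,
      (B.coef s a i j - w a i j) ^ 2 * size s ^ (d - 1) ≤
        c * ∑ t ∈ M.sub.patch s, M.cellSq V t) :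
    ∑ K ∈ M.elements, normSqGrad (interior K) (V - M.sub.tensorSpline m w) ≤
      d * (m * κ) ^ 2 * cellConst d m c * meshConst d N κ * M.faceTerms (-1) V := by
  have hcell : 0 ≤ cellConst d m c := by unfold cellConst; positivity
  calc ∑ K ∈ M.elements, normSqGrad (interior K) (V - M.sub.tensorSpline m w)
      ≤ ∑ K ∈ M.elements, ∑ s ∈ M.sub.subcells K,
        (d * (m * κ / size s) ^ 2 * ∑ i, ∑ j, B.err w s i j ^ 2) * volume.real (hull s) :=
        Finset.sum_le_sum fun K hK => B.normSqGrad_le w (by omega) hT hK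
    _ ≤ ∑ s ∈ M.sub.cells,
        (d * (m * κ / size s) ^ 2 * ∑ i, ∑ j, B.err w s i j ^ 2) * volume.real (hull s) :=
        M.sum_elements_le fun s _ => by positivity
    _ ≤ ∑ s ∈ M.sub.cells, d * (m * κ) ^ 2 * cellConst d m c *
          (size s ^ (-1 : ℤ) * ∑ t ∈ M.sub.patch s, M.cellSq V t) := by
        refine Finset.sum_le_sum fun s hs => ?_
        have hpos := (M.sub.isSimplex hs).size_pos (by omega)
        calc (d * (m * κ / size s) ^ 2 * ∑ i, ∑ j, B.err w s i j ^ 2) * volume.real (hull s)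
            = d * (m * κ / size s) ^ 2 *
              ((∑ i, ∑ j, B.err w s i j ^ 2) * volume.real (hull s)) := by ring
          _ ≤ d * (m * κ / size s) ^ 2 *
              (size s * (cellConst d m c * ∑ t ∈ M.sub.patch s, M.cellSq V t)) := by
              exact mul_le_mul_of_nonneg_left (B.err_mul_volume_le hd hw hs) (by positivity)
          _ = _ := by rw [zpow_neg_one]; field_simp
    _ ≤ d * (m * κ) ^ 2 * cellConst d m c * (meshConst d N κ * M.faceTerms (-1) V) := by
        rw [← Finset.mul_sum]
        exact mul_le_mul_of_nonneg_left (M.sum_patch_le hd hΩ hκ hT hN (Or.inr rfl) V)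
          (by positivity)
    _ = _ := by ring

/-! ### Properties of the conforming tensor -/

theorem isPiecewisePoly_tensorSpline (T : Triangulation Ω) (m : ℕ)
    (w : (E d →₀ ℕ) → Fin d → Fin d → ℝ) : T.IsPiecewisePoly m (T.tensorSpline m w) := by
  intro s hs i j
  obtain ⟨p, hp, hpx⟩ := exists_poly_of_bern s m fun a => w a i j
  refine ⟨p, hp, fun x hx => ?_⟩
  rw [hpx]
  exact T.spline_eq m _ hs (interior_subset hx)

theorem memH1_tensorSpline (hΩ : IsConvexPolytopeDomain Ω) (T : Triangulation Ω) (m : ℕ)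
    (w : (E d →₀ ℕ) → Fin d → Fin d → ℝ) (i j : Fin d) :
    MemH1 Ω fun x => T.tensorSpline m w x i j := by
  obtain ⟨L, hL⟩ := T.exists_lipschitzOnWith_spline m hΩ.convex.closure fun a => w a i j
  obtain ⟨F, hF⟩ := hΩ.exists_closure_eq
  refine memH1_of_lipschitzOn hΩ.isOpen ?_ (hL.mono subset_closure)
  exact (isCompact_hull F).isBounded.subset (hF ▸ subset_closure)

/-- On a facet the trace involves only coefficients whose nodes lie on that facet, and each of these
satisfies the condition for its normal. -/
theorem tangentialTraceVanishes_tensorSpline (T : Triangulation Ω) (m : ℕ)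
    {w : (E d →₀ ℕ) → Fin d → Fin d → ℝ}
    (hw : ∀ a, ∀ n ∈ T.nodeNormals a, ∀ i j c, n i * w a j c = n j * w a i c) :
    T.TangentialTraceVanishes (T.tensorSpline m w) := by
  intro s hs f hfs hf n hn x hx
  have hS := T.isSimplex hs
  have htr : ∀ i j, traceFrom (hull s) (T.tensorSpline m w) x i j =
      ∑ a ∈ nodes m f, w a i j * bern s a x := by
    intro i j
    rw [traceFrom_eq (continuous_sum_bern s m fun a => w a i j)
      (fun y hy => T.spline_eq m _ hs (interior_subset hy))
      (by rw [hS.closure_interior]; exact hull_mono hfs.1 hx), hS.sum_bern_face hfs.1 _ hx]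
  funext c i j
  simp only [crossCols, htr, Finset.mul_sum, Pi.zero_apply]
  rw [← Finset.sum_sub_distrib]
  refine Finset.sum_eq_zero fun a ha => ?_
  have := hw a n ⟨s, hs, f, hfs, (mem_nodes.1 ha).2, hf, hn⟩ i j c
  linear_combination bern s a x * this

end

end PolyFEM

end

/-! ### Assembly of the constants and conclusion. -/

open PolyFEM in
theorem mainTheorem6 (d : ℕ) (hd : d = 2 ∨ d = 3) (Ω : Set (E d)) (hΩ : IsConvexPolytopeDomain Ω)
    (m : ℕ) (hm : 1 ≤ m) (N : ℕ) (σ : ℝ) (hσ : 0 < σ) :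
    ∃ C : ℝ, 0 < C ∧ ∀ M : PolyMesh Ω, M.ShapeRegular N σ →
      ∀ V : E d → Matrix (Fin d) (Fin d) ℝ, M.IsPiecewisePoly m V →
        ∃ V' : E d → Matrix (Fin d) (Fin d) ℝ,
          M.sub.IsPiecewisePoly m V' ∧
          (∀ i j, MemH1 Ω (fun x => V' x i j)) ∧
          M.sub.TangentialTraceVanishes V' ∧
          ∑ K ∈ M.elements, normSqL2 (interior K) (V - V') ≤ C * M.faceTerms 1 V ∧
          ∑ K ∈ M.elements, normSqGrad (interior K) (V - V') ≤ C * M.faceTerms (-1) V := by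
  have hd2 : 2 ≤ d := by omega
  obtain ⟨C₀, hC₀, hbound⟩ := exists_facetBound (d := d) (by omega) m
  obtain ⟨η, hη, hangle⟩ := exists_angle_bound (by omega) hΩ
  set κ : ℝ := max (2 * σ) 1
  have hκ : 1 ≤ κ := le_max_right _ _
  have hc : 0 ≤ nodeConst d κ C₀ η := by
    have := one_le_sizeRatio (d := d) hκ
    unfold nodeConst
    positivity
  set c := nodeConst d κ C₀ η
  set C₁ := cellConst d m c * meshConst d N κ
  set C₂ := d * (m * κ) ^ 2 * cellConst d m c * meshConst d N κ
  have hmesh : 0 ≤ meshConst d N κ := by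
    have := one_le_sizeRatio (d := d) hκ
    have := faceRatio_pos d N hκ
    unfold meshConst
    positivity
  have hcell : 0 ≤ cellConst d m c := by unfold cellConst; positivity
  have hC₁ : 0 ≤ C₁ := mul_nonneg hcell hmesh
  have hC₂ : 0 ≤ C₂ := mul_nonneg (mul_nonneg (by positivity) hcell) hmesh
  -- One constant for both estimates, fixed before the mesh; the summand 1 makes it positive.
  refine ⟨C₁ + C₂ + 1, by positivity, fun M hM V hV => ?_⟩
  have hT := regular_of_shapeRegular (by omega) hσ hM
  obtain ⟨B⟩ := hV.nonempty_bernForm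
  choose w hw1 hw2 using B.exists_node_value hd2 hΩ hm hκ hT hC₀ hbound hη hangle
  refine ⟨M.sub.tensorSpline m w, isPiecewisePoly_tensorSpline _ _ _,
    memH1_tensorSpline hΩ _ _ _, tangentialTraceVanishes_tensorSpline _ _ hw1, ?_, ?_⟩
  · refine (B.sum_normSqL2_le hd2 hΩ hκ hT hM.1 hc fun s hs a ha => hw2 a s hs ha).trans ?_
    exact mul_le_mul_of_nonneg_right (by linarith) (M.faceTerms_nonneg 1 V)
  · refine (B.sum_normSqGrad_le hd2 hΩ hκ hT hM.1 hc fun s hs a ha => hw2 a s hs ha).trans ?_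
    exact mul_le_mul_of_nonneg_right (by linarith) (M.faceTerms_nonneg (-1) V)
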